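/- **Setting.** Let $G$ be a connected loopless bidirected digraph (parallel edges allowed, each edge consisting of two opposite arcs) embedded in the sphere, with a non-negative real weight on every arc, such that for all $x,y$ there is exactly one $x$–$y$ path of minimum weight (paths may repeat vertices). Let $r\ge 2$. An *$r$-division with few holes* with constants $c_1,c_2,c_3$ is a family of non-empty subgraphs (*regions*) such that every edge of $G$ is in exactly one region; there are at most $c_1|V(G)|/r$ regions; every region $R$ has at most $r$ vertices, at most $c_2\sqrt r$ *boundary vertices* (vertices of $R$ incident to an edge of $G$ not in $R$), and at most $c_3$ *holes* (faces of $R$ that are not faces of $G$). The vertices of $R$ that are not boundary vertices are *internal*. Assume also that every region is connected, every hole is a simple cycle on at least three vertices, all of them boundary vertices, and every other face of a region is a triangle. For a hole $H$ of $R$ let $R_H$ be obtained from $R$ by placing a new vertex in every hole other than $H$ and joining it to all vertices of that hole by bidirected edges of "infinite" weight, that is, with weights larger than the total weight of $G$; shortest paths in every $R_H$ are assumed to be unique, too. Regard $H$ as the outer face of $R_H$. **Voronoi diagrams.** For $u\notin V(R)$ give each $x\in V(H)$ the weight $\omega(x)=d_G(u,x)$, and follow a shortest path tree in $R_H$ from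 the so weighted sites $x\in V(H)$: the Voronoi cell of $x$ consists of the vertices $z$ whose tree path has $x$ as its last vertex in $V(H)$; then $\omega(x)+d_{R_H}(x,z)=\min_{y\in V(H)}(\omega(y)+d_{R_H}(y,z))$. The dual edges of the edges between different cells, with paths of degree-two vertices contracted, form a plane multigraph $\mathrm{Vor}$, whose vertices are $v_\infty$ (in $H$) and the triangles meeting three cells. $\mathrm{Vor}^{\triangle}$ arises from it by adding, inside every cell, an edge from $v_\infty$ to each other vertex of $\mathrm{Vor}$ on the boundary of the cell, and deleting the edges of $\mathrm{Vor}$ at $v_\infty$. A *recursive decomposition* of $\mathrm{Vor}^{\triangle}$ splits each piece with more than six faces by a 2-cycle through $v_\infty$ having between $1/3$ and $2/3$ of the faces of the piece on each side, where the two parts arise by replacing all faces on one side by one face. A separator made of two edges at $v_\infty$ that lead to the corners $x,y$ of a triangle within the cells of $b,b'$ is represented by the edge $xy$ and by $b,b'$. For $b\neq b'$ in $V(H)$ and an edge $xy$ of $R_H$ such that the shortest paths $P(b,x)$, $P(b',y)$ in $R_H$ are disjoint, let $\Box(b,b',x,y)$ be the part of $R_H$ in the closed bounded region with boundary formed by $P(b,x)$,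 the edge $xy$, $P(b',y)$ and the part of $H$ from $b$ to $b'$ in a fixed direction. **Oracle.** It stores: the region of every internal vertex; the $d_G$-distances from and to all boundary vertices, and between internal vertices of the same region; a numbering of the vertices of each region $R$ by $0,\dots,|V(R)|-1$; the holes of each region; for all regions $R$, vertices $u\notin V(R)$ and holes $H$ of $R$, the Voronoi diagram and a recursive decomposition, with the separators represented as above and with every piece with at most six faces replaced by the sites of the cells of its edges at $v_\infty$; and for all $R,H$ and all edges $xy$ of $R_H$, a memory of at most $Cr$ integers between $0$ and $Cr$ with which a fixed loop-free program decides, for every vertex $w$ of $R$ and all $b\ne b'$ as above, whether $w\in\Box(b,b',x,y)$. **Query$(u,v)$.** If $u$ or $v$ is a boundary vertex of some region, or if $u,v$ are internal to the same region, return the stored distance. Otherwise let $R$ be the region of $v$. For every hole $H$ of $R$ descend in the decomposition for $(u,R,H)$, at each separator deciding by the program whether $v\in\Box(b,b',x,y)$ and continuing on that side; let $X_H$ be the resulting list of sites. Return $\min_H\min_{x\in X_H}(d_G(u,x)+d_G(x,v))$, computed from stored distances. Table look-ups, comparisons and arithmetic operations take one step each. **Claim.** For all $c_2,c_3$ there are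 a program and a constant $C$ such that the following holds for all $G$, $r$, $c_1$ and all $r$-divisions as above. An oracle as described exists, and for every such oracle (whatever shortest path trees, balanced separators, numberings and memories were chosen): 1. for all $u,v\in V(G)$ the query returns exactly $d_G(u,v)$; 2. for all $u,v\in V(G)$ the query takes at most $C\log r$ steps; 3. if $u$ and $v$ are internal to different regions and $R$ is the region of $v$, then the shortest $u$–$v$ path in $G$ contains a boundary vertex of $R$, and the last such vertex $x$ lies on a hole of $R$. For every hole $H$ of $R$, the list $X_H$ has at most six elements and contains the site of the Voronoi cell of $v$ with respect to $u$, $R$ and $H$; and for every hole $H$ containing $x$, that cell is the Voronoi cell of $x$. -/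

import Mathlib

open Classical

noncomputable section

/-! ### Embedded weighted digraphs

A bidirected edge-weighted digraph embedded in the sphere is given combinatorially. Every edge
consists of two opposite darts (directed arcs), each with its own weight. -/

/-- A combinatorially embedded bidirected digraph with dart weights. `next d` is the dart that
follows `d` on the boundary walk of the face incident to `d`; the faces are the cycles of `next`. -/
structure EmbeddedGraph (V D : Type*) where
  src : D → V
  rev : Equiv.Perm D
  next : Equiv.Perm D
  wt : D → ℝ

namespace EmbeddedGraph

variable {V D : Type*} (G : EmbeddedGraph V D)

def tgt (d : D) : V := G.src (G.rev d)

/-- The next dart with the same source, in the cyclic order of the embedding. -/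
def rot : Equiv.Perm D := G.next * G.rev

def SameFace (d e : D) : Prop := G.next.SameCycle d e

/-- The faces of the embedding. -/
def Face : Type _ := Quotient (Equiv.Perm.SameCycle.setoid G.next)

/-- The face incident to a dart. -/
def face (d : D) : G.Face := Quotient.mk (Equiv.Perm.SameCycle.setoid G.next) d

/-- `p` is the list of darts of a walk from `u` to `v`. -/
def IsWalk : V → List D → V → Prop
  | u, [], v => u = v
  | u, d :: p, v => G.src d = u ∧ IsWalk (G.tgt d) p v

/-- The length (total weight) of a walk. -/
def len (p : List D) : ℝ := (p.map G.wt).sum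

/-- The list of vertices visited by a walk that starts at `u`. -/
def support (u : V) (p : List D) : List V := u :: p.map G.tgt

def IsShortest (u : V) (p : List D) (v : V) : Prop :=
  G.IsWalk u p v ∧ ∀ q, G.IsWalk u q v → G.len p ≤ G.len q

/-- The shortest path distance. -/
def dist (u v : V) : ℝ := sInf {x | ∃ p, G.IsWalk u p v ∧ x = G.len p}

/-- Between any two vertices there is exactly one path of minimum weight. (Paths may repeat vertices,
so that this excludes closed walks of weight zero.) -/
def UniqueShortestPaths : Prop := ∀ u v : V, ∃! p, G.IsShortest u p v

/-- The shortest path from `u` to `v`. -/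
def sp (u v : V) : List D := if h : ∃ p, G.IsShortest u p v then h.choose else []

/-- `G` is connected, without loops, and embedded in the sphere: `rev` is a fixed point free
involution, the vertices are the cycles of `rot`, and Euler's formula holds
(it reads `2 |V| + 2 |F| = 2 |E| + 4`, and `2 |E|` is the number of darts). -/
structure IsPlane : Prop where
  rev_rev : ∀ d, G.rev (G.rev d) = d
  rev_ne : ∀ d, G.rev d ≠ d
  src_eq_iff : ∀ d e, G.src d = G.src e ↔ G.rot.SameCycle d e
  src_surjective : Function.Surjective G.src
  no_loop : ∀ d, G.src d ≠ G.tgt d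
  connected : ∀ u v, ∃ p, G.IsWalk u p v
  euler : 2 * Nat.card V + 2 * Nat.card G.Face = Nat.card D + 4

/-- The face of `d` is a triangle. -/
def IsTriangle (d : D) : Prop :=
  G.next (G.next (G.next d)) = d ∧ G.src d ≠ G.src (G.next d) ∧
    G.src (G.next d) ≠ G.src (G.next (G.next d)) ∧ G.src (G.next (G.next d)) ≠ G.src d

/-- The face of `d` is bounded by a simple cycle, on at least three vertices. -/
def IsSimpleCycle (d : D) : Prop :=
  (∀ e e', G.SameFace d e → G.SameFace d e' → G.src e = G.src e' → e = e') ∧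
    3 ≤ Nat.card {e // G.SameFace d e}

end EmbeddedGraph

/-! ### Regions -/

theorem exists_return {D : Type*} [Finite D] (σ : Equiv.Perm D) (S : Set D) (d : D) (hd : d ∈ S) :
    ∃ k : ℕ, 0 < k ∧ (σ ^ k) d ∈ S := by
  refine ⟨orderOf σ, orderOf_pos σ, ?_⟩
  rw [pow_orderOf_eq_one]
  exact hd

/-- The map that sends `d ∈ S` to the first of `σ d, σ (σ d), …` that lies in `S`. -/
def firstReturn {D : Type*} [Finite D] (σ : Equiv.Perm D) (S : Set D) (d : {d // d ∈ S}) :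
    {d // d ∈ S} :=
  ⟨(σ ^ (Nat.find (exists_return σ S d d.2))) d, (Nat.find_spec (exists_return σ S d d.2)).2⟩

theorem firstReturn_injective {D : Type*} [Finite D] (σ : Equiv.Perm D) (S : Set D) :
    Function.Injective (firstReturn σ S) := by
  have key : ∀ a b : {d // d ∈ S},
      Nat.find (exists_return σ S a a.2) ≤ Nat.find (exists_return σ S b b.2) →
      firstReturn σ S a = firstReturn σ S b → a = b := by
    intro a b hle hab
    have h1 : (σ ^ (Nat.find (exists_return σ S a a.2))) (a : D) =
        (σ ^ (Nat.find (exists_return σ S b b.2))) (b : D) := congrArg Subtype.val hab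
    obtain ⟨m, hm⟩ := Nat.exists_eq_add_of_le hle
    rw [hm, pow_add, Equiv.Perm.mul_apply] at h1
    have h2 : (a : D) = (σ ^ m) b := (σ ^ _).injective h1
    rcases Nat.eq_zero_or_pos m with h0 | hpos
    · subst h0
      exact Subtype.ext (by simpa using h2)
    · exfalso
      have hlt : m < Nat.find (exists_return σ S b b.2) := by
        have := (Nat.find_spec (exists_return σ S a a.2)).1
        omega
      exact Nat.find_min (exists_return σ S b b.2) hlt ⟨hpos, h2 ▸ a.2⟩
  intro a b hab
  rcases le_total (Nat.find (exists_return σ S a a.2)) (Nat.find (exists_return σ S b b.2)) with h | h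
  · exact key a b h hab
  · exact (key b a h hab.symm).symm

/-- The permutation of `S` induced by `σ`: go on along the cycle of `σ` to the next element of `S`. -/
def inducedPerm {D : Type*} [Finite D] (σ : Equiv.Perm D) (S : Set D) :
    Equiv.Perm {d // d ∈ S} :=
  Equiv.ofBijective (firstReturn σ S) (Finite.injective_iff_bijective.1 (firstReturn_injective σ S))

/-- A subgraph of `G` without isolated vertices: a set of edges, i.e. a set of darts that is closed
under reversal. -/
structure Region {V D : Type*} (G : EmbeddedGraph V D) where
  darts : Set D
  rev_mem : ∀ d, G.rev d ∈ darts ↔ d ∈ darts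

namespace Region

variable {V D : Type*} {G : EmbeddedGraph V D} (R : Region G)

/-- The vertex set of the subgraph. -/
def verts : Set V := {v | ∃ d ∈ R.darts, G.src d = v}

abbrev Dart : Type _ := {d // d ∈ R.darts}

abbrev Vert : Type _ := {v // v ∈ R.verts}

/-- Boundary vertices are incident to an edge of `G` that is not in the subgraph. -/
def IsBoundary (v : V) : Prop := v ∈ R.verts ∧ ∃ d, d ∉ R.darts ∧ G.src d = v

/-- Internal vertices are the other vertices of the subgraph. -/
def IsInternal (v : V) : Prop := v ∈ R.verts ∧ ¬ R.IsBoundary v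

variable [Finite D]

/-- The subgraph with the embedding inherited from `G`: around each vertex, the remaining darts
keep their cyclic order. -/
def graph : EmbeddedGraph R.Vert R.Dart where
  src d := ⟨G.src d, d, d.2, rfl⟩
  rev := G.rev.subtypePerm R.rev_mem
  next := inducedPerm G.rot R.darts * (G.rev.subtypePerm R.rev_mem)⁻¹
  wt d := G.wt d

/-- The face of the subgraph incident to `d` is a hole: it is not a face of `G`. -/
def IsHole (d : R.Dart) : Prop :=
  ¬ ∀ e : D, G.SameFace d e ↔ ∃ he : e ∈ R.darts, R.graph.SameFace d ⟨e, he⟩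

/-- The face of `e` is a hole other than the face of `h`. -/
def IsOtherHole (h e : R.Dart) : Prop := R.IsHole e ∧ ¬ R.graph.SameFace h e

theorem isOtherHole_next (h e : R.Dart) :
    R.IsOtherHole h (R.graph.next e) ↔ R.IsOtherHole h e := by
  have key : ∀ a b : R.Dart, R.graph.SameFace a b → R.IsOtherHole h a → R.IsOtherHole h b := by
    rintro a b hab ⟨h1, h2⟩
    refine ⟨fun hb => h1 fun x => ?_, fun hb => h2 (hb.trans hab.symm)⟩
    have hGa : G.SameFace b a := (hb a).2 ⟨a.2, hab.symm⟩
    constructor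
    · intro hx
      obtain ⟨hm, hy⟩ := (hb x).1 (hGa.trans hx)
      exact ⟨hm, hab.trans hy⟩
    · rintro ⟨hm, hy⟩
      exact hGa.symm.trans ((hb x).2 ⟨hm, hab.symm.trans hy⟩)
  have hs : R.graph.SameFace e (R.graph.next e) := ⟨1, by simp⟩
  exact ⟨key _ _ hs.symm, key _ _ hs⟩

/-- The darts of the spokes: one spoke for each vertex (given by the dart of the hole that starts
there) on each hole other than that of `h`; `false` marks the dart towards the centre of the hole
and `true` the one from the centre. -/
abbrev Spoke (h : R.Dart) : Type _ := {e : R.Dart // R.IsOtherHole h e} × Bool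

abbrev FillDart (h : R.Dart) : Type _ := R.Dart ⊕ R.Spoke h

/-- The vertices of the region, and a new vertex for each hole other than that of `h`. -/
abbrev FillVert (h : R.Dart) : Type _ :=
  R.Vert ⊕ {f : R.graph.Face // ∃ e, R.IsOtherHole h e ∧ R.graph.face e = f}

theorem isOtherHole_prev (h e : R.Dart) (he : R.IsOtherHole h e) :
    R.IsOtherHole h (R.graph.next.symm e) := by
  rw [← isOtherHole_next]
  simpa using he

/-- The boundary walks of the faces after all holes but that of `h` have been filled: a dart `e` of
such a hole bounds the triangle formed by `e`, the spoke from the head of `e` to the centre, and the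
spoke from the centre to the tail of `e`. -/
def fillNext (h : R.Dart) : Equiv.Perm (R.FillDart h) where
  toFun
    | .inl e => if he : R.IsOtherHole h e
        then .inr (⟨R.graph.next e, (R.isOtherHole_next h e).2 he⟩, false)
        else .inl (R.graph.next e)
    | .inr (e, false) => .inr (⟨R.graph.next.symm e, R.isOtherHole_prev h e e.2⟩, true)
    | .inr (e, true) => .inl e
  invFun
    | .inl e => if he : R.IsOtherHole h e then .inr (⟨e, he⟩, true)
        else .inl (R.graph.next.symm e)
    | .inr (e, false) => .inl (R.graph.next.symm e)
    | .inr (e, true) => .inr (⟨R.graph.next e, (R.isOtherHole_next h e).2 e.2⟩, false)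
  left_inv := by
    rintro (e | ⟨e, _ | _⟩)
    · by_cases he : R.IsOtherHole h e
      · simp [he]
      · simp [he, isOtherHole_next]
    · simp
    · simp [e.2]
  right_inv := by
    rintro (e | ⟨e, _ | _⟩)
    · by_cases he : R.IsOtherHole h e
      · simp [he]
      · have : ¬ R.IsOtherHole h (R.graph.next.symm e) := fun h' => he (by
          have := (R.isOtherHole_next h (R.graph.next.symm e)).2 h'
          simpa using this)
        simp [he, this]
    · have := R.isOtherHole_prev h e e.2
      simp [this]
    · simp

/-- The region with a new vertex in every hole other than that of `h`, joined to all vertices of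
that hole by bidirected spokes of the given weights. -/
def fill (h : R.Dart) (spoke : D → Bool → ℝ) : EmbeddedGraph (R.FillVert h) (R.FillDart h) where
  src
    | .inl e => .inl (R.graph.src e)
    | .inr (e, false) => .inl (R.graph.src e)
    | .inr (e, true) => .inr ⟨R.graph.face e, e, e.2, rfl⟩
  rev := Equiv.sumCongr R.graph.rev (Equiv.prodCongr (Equiv.refl _) Equiv.boolNot)
  next := R.fillNext h
  wt
    | .inl e => G.wt e
    | .inr (e, b) => spoke e b

end Region

/-- An `r`-division of `G` with few holes, in which moreover every region is connected, every hole
of a region is a simple cycle of boundary vertices, and every other face of a region is a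
triangle. -/
structure IsRDivision {V D ι : Type*} [Finite D] (G : EmbeddedGraph V D) (R : ι → Region G)
    (r c₁ c₂ : ℝ) (c₃ : ℕ) : Prop where
  partition : ∀ d, ∃! i, d ∈ (R i).darts
  number : (Nat.card ι : ℝ) ≤ c₁ * Nat.card V / r
  verts_le : ∀ i, (Nat.card (R i).Vert : ℝ) ≤ r
  boundary_le : ∀ i, (Nat.card {v // (R i).IsBoundary v} : ℝ) ≤ c₂ * √r
  holes_le : ∀ i, Nat.card {f : (R i).graph.Face // ∃ e, (R i).IsHole e ∧ (R i).graph.face e = f}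
    ≤ c₃
  nonempty : ∀ i, (R i).darts.Nonempty
  connected : ∀ i, ∀ u v, ∃ p, (R i).graph.IsWalk u p v
  hole_cycle : ∀ i, ∀ d, (R i).IsHole d → (R i).graph.IsSimpleCycle d
  hole_boundary : ∀ i, ∀ d, (R i).IsHole d → (R i).IsBoundary (G.src d)
  triangle : ∀ i, ∀ d, ¬ (R i).IsHole d → (R i).graph.IsTriangle d

/-! ### Voronoi diagrams and their separators -/

namespace EmbeddedGraph

variable {V D : Type*} (K : EmbeddedGraph V D)

/-- The `i`-th vertex on the boundary walk of the face of `h`. -/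
def bpos (h : D) (i : ℕ) : V := K.src ((K.next ^ i) h)

/-- The length of the boundary walk of the face of `h`. -/
def bsize (h : D) : ℕ := Nat.card {e // K.SameFace h e}

/-- The part of the boundary walk of the face of `h` from position `i` to position `j`. -/
def arc (h : D) (i j : ℕ) : List D :=
  (List.range ((j + K.bsize h - i) % K.bsize h)).map fun t => (K.next ^ (i + t)) h

/-- `site` describes the Voronoi diagram of the vertices on the face of `h` with additive weights
`ω`: it sends every vertex `z` to the site whose cell contains `z`. The shortest path tree from the
weighted sites is followed: `site z` minimizes `ω x + dist x z`, and all vertices on the shortest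
path from `site z` to `z` belong to the same cell (so that, beyond `site z`, it contains no vertex
of the face of `h`). -/
structure IsVoronoi (h : D) (ω : V → ℝ) (site : V → V) : Prop where
  site_mem : ∀ z, ∃ e, K.SameFace h e ∧ K.src e = site z
  site_self : ∀ e, K.SameFace h e → site (K.src e) = K.src e
  minimal : ∀ z e, K.SameFace h e →
    ω (site z) + K.dist (site z) z ≤ ω (K.src e) + K.dist (K.src e) z
  closed : ∀ z, ∀ y ∈ K.support (site z) (K.sp (site z) z), site y = site z

/-- The Voronoi cell of `x`. -/
def voronoiCell (site : V → V) (x : V) : Set V := {z | site z = x}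

/-- The face of `a` is a vertex of the Voronoi diagram other than the one in the face of `h`:
a triangle that meets three cells. -/
def IsVorVertex (h : D) (site : V → V) (a : D) : Prop :=
  ¬ K.SameFace h a ∧ site (K.src a) ≠ site (K.src (K.next a)) ∧
    site (K.src (K.next a)) ≠ site (K.src (K.next (K.next a))) ∧
    site (K.src (K.next (K.next a))) ≠ site (K.src a)

/-- Let the head of the dart `a` lie in the cell `C` and its tail in another cell. Traverse the
boundary of `C` across the edge of `a`, into the triangle of `rev a`: the result is the dart of that
triangle by which the boundary of `C` leaves this triangle, again with its head in `C` and its tail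
not in `C`. (If the triangle meets three cells, it is the dart whose head is the corner in `C`.) -/
def vorCross (site : V → V) (a : D) : D :=
  if site (K.src (K.next.symm (K.rev a))) = site (K.tgt a) then K.next (K.rev a)
  else K.next.symm (K.rev a)

/-- One step along a path of degree-two vertices of the dual boundary graph. -/
def VorStep (h : D) (site : V → V) (a b : D) : Prop :=
  ¬ K.SameFace h (K.rev a) ∧ b = K.vorCross site a ∧ ¬ K.IsVorVertex h site b

/-- The edges that join `v∞` (the dual vertex in the face of `h`) to the other Voronoi vertices in
the triangulated Voronoi diagram correspond to the corners of the triangles that meet three cells: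
there is one such edge in each cell with a corner in the triangle. A corner is represented
by the dart `a` of the triangle whose head it is. `SpokeNext a b` says that the edge of `b` follows
that of `a` in the cyclic order around `v∞`. To find it, follow the Voronoi edge that leaves the
triangle through `a`. If it ends at `v∞`, the next edge leads to the same triangle from the cell on
the other side of the Voronoi edge, and both edges bound a face with two edges. If it ends in another
triangle that meets three cells, the next edge leads to the corner of that triangle in the same cell,
and both edges and the Voronoi edge bound a face. -/
def SpokeNext (h : D) (site : V → V) (a b : D) : Prop :=
  ∃ e, Relation.ReflTransGen (K.VorStep h site) a e ∧
    ((K.SameFace h (K.rev e) ∧ b = K.next.symm a) ∨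
      (¬ K.SameFace h (K.rev e) ∧ K.IsVorVertex h site (K.vorCross site e) ∧
        b = K.vorCross site e))

/-- `L` lists the edges at `v∞` of the triangulated Voronoi diagram in their cyclic order. -/
structure IsTriVor (h : D) (site : V → V) (L : List D) : Prop where
  nodup : L.Nodup
  mem_iff : ∀ a, a ∈ L ↔ K.IsVorVertex h site a
  next : ∀ k (hk : k < L.length),
    K.SpokeNext h site L[k] (L[(k + 1) % L.length]'(Nat.mod_lt _ (by omega)))

end EmbeddedGraph

/-- The stored form of a recursive decomposition. A node stores the representation of its separator:
a dart `e` from `x` to `y`, and the positions `i`, `j` of the sites of `x` and `y` on the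
hole. A leaf stores the sites of the Voronoi cells that meet the piece. -/
inductive SepTree (E S : Type*) where
  | leaf (cells : List S) : SepTree E S
  | node (e : E) (i j : ℕ) (l r : SepTree E S) : SepTree E S

namespace EmbeddedGraph

variable {V D S : Type*} (K : EmbeddedGraph V D)

/-- `Decomposes h site name L t`: the tree `t` is a recursive decomposition of the piece with the
edges `L` at `v∞`, in cyclic order. Every face of a piece contains `v∞` exactly once, so the faces
correspond to the pairs of cyclically consecutive elements of `L`, and `L.length` is their number.
Two edges `a`, `b` at `v∞` with the same other end form a 2-cycle separator. It is balanced if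
each side has between one third and two thirds of the faces. The two parts consist of the faces on
one side and one new face in place of those on the other side. The recursion stops at pieces with at
most six faces. The function `name` gives the names under which sites are stored. -/
inductive Decomposes (h : D) (site : V → V) (name : V → S) : List D → SepTree D S → Prop
  | leaf (L : List D) (hL : L.length ≤ 6) :
      Decomposes h site name L (.leaf (L.map fun a => name (site (K.tgt a))))
  | node (L : List D) (a b : D) (A B : List D) (e : D) (i j : ℕ) (l r : SepTree D S)
      (hL : 6 < L.length)
      (rotated : L.IsRotated (a :: A ++ b :: B))
      (same : K.SameFace a b)
      (balanced_left : L.length ≤ 3 * (A.length + 1) ∧ 3 * (A.length + 1) ≤ 2 * L.length)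
      (balanced_right : L.length ≤ 3 * (B.length + 1) ∧ 3 * (B.length + 1) ≤ 2 * L.length)
      (edge : K.src e = K.tgt a ∧ K.tgt e = K.tgt b ∧ (K.SameFace a e ∨ K.SameFace a (K.rev e)))
      (pos_i : i < K.bsize h ∧ K.bpos h i = site (K.tgt a))
      (pos_j : j < K.bsize h ∧ K.bpos h j = site (K.tgt b))
      (left : Decomposes h site name (a :: A ++ [b]) l)
      (right : Decomposes h site name (b :: B ++ [a]) r) :
      Decomposes h site name L (.node e i j l r)

/-! ### The closed region cut off by a separator -/

/-- The number of times that the walk `γ` uses the edge of `d`, in either direction. -/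
def crossings (γ : List D) (d : D) : ℕ := γ.count d + γ.count (K.rev d)

/-- The face of `d` lies inside the closed walk `γ` with respect to the outer face, that of `h`:
walks in the dual graph from the outer face to that of `d` cross `γ` an odd number of times. -/
def Inside (h : D) (γ : List D) (d : D) : Prop :=
  ∃ col : D → ZMod 2, (∀ e, col (K.next e) = col e) ∧
    (∀ e, col (K.rev e) = col e + K.crossings γ e) ∧ col h = 0 ∧ col d = 1

/-- The vertex set of the subgraph contained in the closed bounded region with boundary defined by
the shortest path from the `i`-th boundary vertex to the tail of `e`, the edge of `e`, the shortest
path from the `j`-th boundary vertex to the head of `e`, and the part of the outer face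
(that of `h`) from position `i` to position `j`. -/
def box (h : D) (i j : ℕ) (e : D) : Set V :=
  let p := K.sp (K.bpos h i) (K.src e)
  let q := K.sp (K.bpos h j) (K.tgt e)
  let b := K.arc h i j
  {w | w ∈ K.support (K.bpos h i) p ∨ w ∈ K.support (K.bpos h j) q ∨
    w ∈ K.support (K.bpos h i) b ∨ ∃ d, K.src d = w ∧ K.Inside h (p ++ e :: (q ++ b)) d}

end EmbeddedGraph

/-! ### Step counting -/

/-- A computed value together with the number of elementary steps used. -/
structure Timed (α : Type*) where
  val : α
  time : ℕ

namespace Timed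

/-- One elementary step: a table look-up, a comparison, or an addition. -/
def step {α : Type*} (a : α) : Timed α := ⟨a, 1⟩

/-- Sequential composition; the steps add up. -/
def andThen {α β : Type*} (x : Timed α) (f : α → Timed β) : Timed β :=
  ⟨(f x.val).val, x.time + (f x.val).time⟩

/-- The minimum of `f a` over the elements `a` of a list, one after the other. -/
def minOver {α : Type*} (f : α → Timed (WithTop ℝ)) : List α → Timed (WithTop ℝ)
  | [] => step ⊤
  | a :: l => (f a).andThen fun x => (minOver f l).andThen fun y => step (min x y)

end Timed

/-- Loop-free programs over a memory of natural numbers, with three inputs. -/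
inductive Code where
  | arg (k : Fin 3) : Code
  | const (n : ℕ) : Code
  | load (a : Code) : Code
  | add (a b : Code) : Code
  | mul (a b : Code) : Code
  | ifLe (a b c d : Code) : Code

/-- Run a program: `load a` reads the memory cell whose address is the value of `a`, and
`ifLe a b c d` continues with `c` if the value of `a` is at most that of `b`, and with `d` otherwise.
Every operation takes one step. -/
def Code.run (mem : List ℕ) (x : Fin 3 → ℕ) : Code → Timed ℕ
  | .arg k => .step (x k)
  | .const n => .step n
  | .load a => (run mem x a).andThen fun s => .step (mem.getD s 0)
  | .add a b => (run mem x a).andThen fun s => (run mem x b).andThen fun t => .step (s + t)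
  | .mul a b => (run mem x a).andThen fun s => (run mem x b).andThen fun t => .step (s * t)
  | .ifLe a b c d => (run mem x a).andThen fun s => (run mem x b).andThen fun t =>
      (Timed.step (decide (s ≤ t))).andThen fun o => if o then run mem x c else run mem x d

/-! ### The distance oracle -/

/-- The data stored by the distance oracle. A hole is referred to by one of its darts, whose tail is
the boundary vertex at position `0`. -/
structure Oracle {V D ι : Type*} (G : EmbeddedGraph V D) (R : ι → Region G) [Finite D] where
  /-- the region to which an internal vertex belongs; `none` for boundary vertices -/
  home : V → Option ι
  /-- the distances from and to boundary vertices -/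
  bdist : V → V → ℝ
  /-- the distances between internal vertices of the same region -/
  idist : V → V → ℝ
  /-- the holes of a region -/
  holes : (i : ι) → List (R i).Dart
  /-- the Voronoi diagrams, for a vertex outside of the region, and a hole of the region -/
  site : V → (i : ι) → (h : (R i).Dart) → (R i).FillVert h → (R i).FillVert h
  /-- the separator decompositions of these Voronoi diagrams -/
  tree : V → (i : ι) → (h : (R i).Dart) → SepTree ((R i).FillDart h) V
  /-- a numbering of the vertices of each region -/
  num : ι → V → ℕ
  /-- for each region, hole, and edge, a memory for deciding on which side of a separator with that
  edge a vertex lies -/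
  mem : (i : ι) → (h : (R i).Dart) → (R i).FillDart h → List ℕ

namespace Oracle

variable {V D ι : Type*} [Finite D] {G : EmbeddedGraph V D} {R : ι → Region G}

/-- The data have been computed by the preprocessing. The last two conditions say that the memory for
each region, hole and edge `e` consists of at most `C * r` numbers of size at most `C * r`, and that
with it the program `code` decides whether a vertex `w` of the region belongs to the closed region
cut off by `e` and the shortest paths to its ends from the boundary vertices at positions `a` and
`b`, for all `a ≠ b` for which these paths are disjoint. -/
structure Valid (O : Oracle G R) (spoke : D → Bool → ℝ) (r C : ℝ) (code : Code) : Prop where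
  home_iff : ∀ v i, O.home v = some i ↔ (R i).IsInternal v
  bdist_eq : ∀ u v, ((∃ i, (R i).IsBoundary u) ∨ ∃ i, (R i).IsBoundary v) →
    O.bdist u v = G.dist u v
  idist_eq : ∀ i u v, (R i).IsInternal u → (R i).IsInternal v → O.idist u v = G.dist u v
  holes_hole : ∀ i, ∀ h ∈ O.holes i, (R i).IsHole h
  holes_pairwise : ∀ i, (O.holes i).Pairwise fun h h' => ¬ (R i).graph.SameFace h h'
  holes_all : ∀ i e, (R i).IsHole e → ∃ h ∈ O.holes i, (R i).graph.SameFace h e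
  voronoi : ∀ u i, u ∉ (R i).verts → ∀ h ∈ O.holes i,
    ((R i).fill h spoke).IsVoronoi (.inl h) (Sum.elim (fun x => G.dist u x) fun _ => 0)
      (O.site u i h)
  decomposes : ∀ u i, u ∉ (R i).verts → ∀ h ∈ O.holes i, ∃ L name,
    ((R i).fill h spoke).IsTriVor (.inl h) (O.site u i h) L ∧
    (∀ x : (R i).Vert, name (.inl x) = (x : V)) ∧
    ((R i).fill h spoke).Decomposes (.inl h) (O.site u i h) name L (O.tree u i h)
  num_inj : ∀ i, Set.InjOn (O.num i) (R i).verts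
  num_lt : ∀ i, ∀ v ∈ (R i).verts, O.num i v < Nat.card (R i).Vert
  mem_size : ∀ i, ∀ h ∈ O.holes i, ∀ e, ((O.mem i h e).length : ℝ) ≤ C * r ∧
    ∀ n ∈ O.mem i h e, (n : ℝ) ≤ C * r
  mem_correct : ∀ i, ∀ h ∈ O.holes i, ∀ e, ∀ a < ((R i).fill h spoke).bsize (.inl h),
    ∀ b < ((R i).fill h spoke).bsize (.inl h), a ≠ b →
    let K := (R i).fill h spoke
    (K.support (K.bpos (.inl h) a) (K.sp (K.bpos (.inl h) a) (K.src e))).Disjoint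
      (K.support (K.bpos (.inl h) b) (K.sp (K.bpos (.inl h) b) (K.tgt e))) →
    ∀ w : (R i).Vert, (code.run (O.mem i h e) ![O.num i w, a, b]).val ≠ 0 ↔
      .inl w ∈ K.box (.inl h) a b e

/-- Binary search in a separator decomposition for the vertex with number `w`: at every node, decide
whether the vertex lies in the closed region cut off by the separator, and continue on that
side. -/
def search {E S : Type*} (code : Code) (mem : E → List ℕ) (w : ℕ) : SepTree E S → Timed (List S)
  | .leaf cells => .step cells
  | .node e i j l r =>
      (Timed.step (mem e)).andThen fun m =>
      (code.run m ![w, i, j]).andThen fun s =>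
      (Timed.step (decide (s ≠ 0))).andThen fun o =>
      if o then search code mem w l else search code mem w r

/-- The sites of the candidate cells for `v` in the Voronoi diagram of `u` with respect to the
region `i` and its hole `h`. -/
def candidates (O : Oracle G R) (code : Code) (u v : V) (i : ι) (h : (R i).Dart) :
    Timed (List V) :=
  (Timed.step (O.tree u i h)).andThen fun t =>
  (Timed.step (O.num i v)).andThen fun w =>
  search code (O.mem i h) w t

/-- The distance query. -/
def query (O : Oracle G R) (code : Code) (u v : V) : Timed (WithTop ℝ) :=
  (Timed.step (O.home u)).andThen fun iu =>
  (Timed.step (O.home v)).andThen fun iv =>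
  match iu, iv with
  | some i, some j =>
      (Timed.step (decide (i = j))).andThen fun same =>
      if same then .step (O.idist u v : WithTop ℝ)
      else (Timed.step (O.holes j)).andThen fun hs =>
        Timed.minOver (fun h => (O.candidates code u v j h).andThen fun X =>
          Timed.minOver (fun x =>
            (Timed.step (O.bdist u x)).andThen fun a =>
            (Timed.step (O.bdist x v)).andThen fun b =>
            .step ((a + b : ℝ) : WithTop ℝ)) X) hs
  | _, _ => .step (O.bdist u v : WithTop ℝ)

end Oracle

end

set_option linter.unusedSectionVars false

noncomputable section

namespace EmbeddedGraph

variable {V D : Type*} {K : EmbeddedGraph V D}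

/-! ### Walks and shortest paths -/

/-! Planarity is used only through homology modulo two: an edge set that meets every vertex an even
number of times is the set of edges at which some two-colouring of the faces changes. For `G` this
follows from Euler's formula by counting dimensions (`IsPlane.isMap`). It passes to regions and to
filled regions without any further counting of faces (`Region.graph_isMap`, `Region.fill_isMap`).
Each filled region is therefore a disc: a simple outer cycle, with triangles as all other faces.

Correctness of the query. Let `x` be the last boundary vertex on the shortest `u`–`v` path, and let
it lie on the hole of `h`. The path through the optimal site of that hole is also a shortest path in
`G`. By uniqueness both paths agree, so the optimal site comes no later than `x`, the tree path from
it to `v` passes through `x`, and `x` itself is the site of `v` (`site_eq`). So the true distance is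
among the sums that are compared; by the triangle inequality no sum is smaller. The search finds the
cell of `v` for this reason: the boundary of a box meets a third cell at most in its site, so that
all of the cell lies in the box if the site is on the arc of the box, and none of it otherwise
(`mem_box_iff`). Along the edges at the outer Voronoi vertex the sites move once around the hole
(`arranged`), so the two sides of a separator correspond to complementary arcs (`search_spec`).

Existence of decompositions. The triangles that meet at least two cells, joined across edges between
different cells, form a tree. A cycle would enclose a cell that does not reach the hole (`acyclic`);
and the boundary of each cell is connected, because the rest of the hole joins all other cells
(`connected_inner`). Walking around the tree lists the corners in nested groups; such a list is
built by adding leaves (`exists_fan`). Descending into the group that holds more than two thirds of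
the list leads to a balanced separator (`exists_balanced`).

Memory. For a fixed edge, lying on one of the two paths means being an ancestor in a shortest path
tree, which is an interval test on preorder ranks (`exists_intervals`). The interior of a box is, up
to corrections, the symmetric difference of two sectors, one for each end of the edge. The sectors
of one tree are nested, so that each face needs just one threshold (`exists_sector`). A bounded
number of integers per vertex thus suffices for all pairs of positions (`exists_memory`).

Time. A separator reduces the number of faces minus three to at most two thirds, so the depth is
logarithmic (`search_time`, `exists_depth`). -/

theorem isWalk_append_iff {u w : V} {p q : List D} :
    K.IsWalk u (p ++ q) w ↔ ∃ v, K.IsWalk u p v ∧ K.IsWalk v q w := by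
  induction p generalizing u with
  | nil => simp [IsWalk]
  | cons d p ih => simp [IsWalk, ih, and_assoc]

theorem IsWalk.append {u v w : V} {p q : List D} (hp : K.IsWalk u p v) (hq : K.IsWalk v q w) :
    K.IsWalk u (p ++ q) w :=
  isWalk_append_iff.2 ⟨v, hp, hq⟩

theorem IsWalk.eq_of_isWalk {u v w : V} {p : List D} (h : K.IsWalk u p v) (h' : K.IsWalk u p w) :
    v = w := by
  induction p generalizing u with
  | nil => exact h.symm.trans h'
  | cons d p ih => exact ih h.2 h'.2

@[simp] theorem len_append (p q : List D) : K.len (p ++ q) = K.len p + K.len q := by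
  simp [len]

@[simp] theorem len_cons (d : D) (p : List D) : K.len (d :: p) = K.wt d + K.len p := by
  simp [len]

@[simp] theorem len_nil : K.len [] = 0 := rfl

theorem len_nonneg (hw : ∀ d, 0 ≤ K.wt d) (p : List D) : 0 ≤ K.len p := by
  induction p with
  | nil => simp
  | cons d p ih => simpa using add_nonneg (hw d) ih

theorem wt_le_len (hw : ∀ d, 0 ≤ K.wt d) {d : D} {p : List D} (hd : d ∈ p) :
    K.wt d ≤ K.len p := by
  induction p with
  | nil => simp at hd
  | cons e p ih =>
    rcases List.mem_cons.1 hd with rfl | h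
    · simpa using len_nonneg hw p
    · have := ih h
      have := hw e
      simp only [len_cons]
      linarith

theorem IsShortest.dist_eq {u v : V} {p : List D} (h : K.IsShortest u p v) :
    K.dist u v = K.len p := by
  apply IsLeast.csInf_eq
  refine ⟨⟨p, h.1, rfl⟩, ?_⟩
  rintro x ⟨q, hq, rfl⟩
  exact h.2 q hq

theorem sp_isShortest (hK : K.UniqueShortestPaths) (u v : V) : K.IsShortest u (K.sp u v) v := by
  have h : ∃ p, K.IsShortest u p v := (hK u v).exists
  rw [sp, dif_pos h]
  exact h.choose_spec

theorem sp_isWalk (hK : K.UniqueShortestPaths) (u v : V) : K.IsWalk u (K.sp u v) v :=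
  (sp_isShortest hK u v).1

theorem dist_eq_len_sp (hK : K.UniqueShortestPaths) (u v : V) : K.dist u v = K.len (K.sp u v) :=
  (sp_isShortest hK u v).dist_eq

theorem IsShortest.eq_sp (hK : K.UniqueShortestPaths) {u v : V} {p : List D}
    (h : K.IsShortest u p v) : p = K.sp u v :=
  (hK u v).unique h (sp_isShortest hK u v)

theorem dist_le_len (hK : K.UniqueShortestPaths) {u v : V} {p : List D} (h : K.IsWalk u p v) :
    K.dist u v ≤ K.len p := by
  rw [dist_eq_len_sp hK]
  exact (sp_isShortest hK u v).2 p h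

theorem isShortest_of_len_le (hK : K.UniqueShortestPaths) {u v : V} {p : List D}
    (h : K.IsWalk u p v) (hl : K.len p ≤ K.dist u v) : K.IsShortest u p v :=
  ⟨h, fun _ hq => hl.trans (dist_le_len hK hq)⟩

theorem dist_triangle (hK : K.UniqueShortestPaths) (u v w : V) :
    K.dist u w ≤ K.dist u v + K.dist v w := by
  rw [dist_eq_len_sp hK u v, dist_eq_len_sp hK v w, ← len_append]
  exact dist_le_len hK ((sp_isWalk hK u v).append (sp_isWalk hK v w))

theorem IsShortest.of_append {u v w : V} {p q : List D}
    (h : K.IsShortest u (p ++ q) w) (hp : K.IsWalk u p v) (hq : K.IsWalk v q w) :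
    K.IsShortest u p v ∧ K.IsShortest v q w := by
  constructor
  · refine ⟨hp, fun p' hp' => ?_⟩
    have := h.2 _ (hp'.append hq)
    simpa using this
  · refine ⟨hq, fun q' hq' => ?_⟩
    have := h.2 _ (hp.append hq')
    simpa using this

theorem dist_self (hK : K.UniqueShortestPaths) (hw : ∀ d, 0 ≤ K.wt d) (u : V) :
    K.dist u u = 0 := by
  apply le_antisymm
  · exact dist_le_len hK (p := []) rfl
  · rw [dist_eq_len_sp hK]
    exact len_nonneg hw _

theorem sp_self (hK : K.UniqueShortestPaths) (hw : ∀ d, 0 ≤ K.wt d) (u : V) : K.sp u u = [] :=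
  (IsShortest.eq_sp (p := []) hK ⟨rfl, fun q _ => len_nonneg hw q⟩).symm

theorem mem_support_iff {u v y : V} {p : List D} (h : K.IsWalk u p v) :
    y ∈ K.support u p ↔ ∃ p₁ p₂, p = p₁ ++ p₂ ∧ K.IsWalk u p₁ y ∧ K.IsWalk y p₂ v := by
  induction p generalizing u with
  | nil =>
    obtain rfl : u = v := h
    constructor
    · intro hy
      obtain rfl : y = u := by simpa [support] using hy
      exact ⟨[], [], rfl, rfl, rfl⟩
    · rintro ⟨p₁, p₂, hp, h1, h2⟩
      obtain ⟨rfl, rfl⟩ := List.append_eq_nil_iff.1 hp.symm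
      obtain rfl : u = y := h1
      simp [support]
  | cons d p ih =>
    have key : y ∈ K.support u (d :: p) ↔ y = u ∨ y ∈ K.support (K.tgt d) p := by simp [support]
    rw [key, ih h.2]
    constructor
    · rintro (rfl | ⟨p₁, p₂, rfl, h1, h2⟩)
      · exact ⟨[], d :: p, rfl, rfl, h⟩
      · exact ⟨d :: p₁, p₂, rfl, ⟨h.1, h1⟩, h2⟩
    · rintro ⟨_ | ⟨e, p₁⟩, p₂, hp, h1, h2⟩
      · exact .inl h1.symm
      · obtain ⟨rfl, rfl⟩ := List.cons.inj hp
        exact .inr ⟨p₁, p₂, rfl, h1.2, h2⟩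

theorem start_mem_support (u : V) (p : List D) : u ∈ K.support u p := by simp [support]

theorem end_mem_support {u v : V} {p : List D} (h : K.IsWalk u p v) : v ∈ K.support u p :=
  (mem_support_iff h).2 ⟨p, [], by simp, h, rfl⟩

theorem tgt_mem_support {u : V} {p : List D} {d : D} (hd : d ∈ p) : K.tgt d ∈ K.support u p := by
  simp only [support, List.mem_cons, List.mem_map]
  exact .inr ⟨d, hd, rfl⟩

theorem src_mem_support {u v : V} {p : List D} (h : K.IsWalk u p v) {d : D} (hd : d ∈ p) :
    K.src d ∈ K.support u p := by
  obtain ⟨p₁, p₂, rfl⟩ := List.append_of_mem hd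
  obtain ⟨y, h1, h2⟩ := isWalk_append_iff.1 h
  rw [mem_support_iff h]
  exact ⟨p₁, d :: p₂, rfl, h2.1 ▸ h1, ⟨rfl, h2.2⟩⟩

/-- Shortest paths split at each of their vertices. -/
theorem sp_split (hK : K.UniqueShortestPaths) {u v y : V} (hy : y ∈ K.support u (K.sp u v)) :
    K.sp u v = K.sp u y ++ K.sp y v := by
  obtain ⟨p₁, p₂, hp, h1, h2⟩ := (mem_support_iff (sp_isWalk hK u v)).1 hy
  have h := sp_isShortest hK u v
  rw [hp] at h
  obtain ⟨h3, h4⟩ := h.of_append h1 h2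
  rw [hp, h3.eq_sp hK, h4.eq_sp hK]

/-- Take a walk with the fewest darts; the stretch between two occurrences of a dart could be cut
out. Its length is at most the total weight, which is less than the weight of a single spoke. -/
theorem exists_walk_nodup {u v : V} (h : ∃ p, K.IsWalk u p v) : ∃ p, K.IsWalk u p v ∧ p.Nodup := by
  have hex : ∃ n p, K.IsWalk u p v ∧ p.length = n := by
    obtain ⟨p, hp⟩ := h
    exact ⟨_, p, hp, rfl⟩
  obtain ⟨p, hp, hn⟩ := Nat.find_spec hex
  refine ⟨p, hp, ?_⟩
  by_contra hnd
  obtain ⟨d, hd⟩ := List.exists_duplicate_iff_not_nodup.2 hnd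
  obtain ⟨a, b, hab, ha, hb⟩ : ∃ a b, p = a ++ b ∧ d ∈ a ∧ d ∈ b := by
    have h2 := List.duplicate_iff_two_le_count.1 hd
    obtain ⟨a, b, rfl⟩ := List.append_of_mem hd.mem
    by_cases hda : d ∈ a
    · exact ⟨a, d :: b, rfl, hda, by simp⟩
    · have : d ∈ b := by
        by_contra hdb
        rw [List.count_append, List.count_cons_self, List.count_eq_zero_of_not_mem hda,
          List.count_eq_zero_of_not_mem hdb] at h2
        omega
      exact ⟨a ++ [d], b, by simp, by simp, this⟩
  obtain ⟨a₁, a₂, rfl⟩ := List.append_of_mem ha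
  obtain ⟨b₁, b₂, rfl⟩ := List.append_of_mem hb
  subst hab
  obtain ⟨x, h1, h2⟩ := isWalk_append_iff.1 hp
  obtain ⟨y, h3, h4⟩ := isWalk_append_iff.1 h1
  obtain ⟨z, h5, h6⟩ := isWalk_append_iff.1 h2
  have hw : K.IsWalk u (a₁ ++ d :: b₂) v := h3.append ⟨h4.1, h6.2⟩
  refine Nat.find_min hex (m := (a₁ ++ d :: b₂).length) ?_ ⟨_, hw, rfl⟩
  rw [← hn]
  simp only [List.length_append, List.length_cons]
  omega

theorem len_le_sum [Fintype D] (hw : ∀ d, 0 ≤ K.wt d) {p : List D} (hp : p.Nodup) :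
    K.len p ≤ ∑ d, K.wt d := by
  rw [len, ← List.sum_toFinset _ hp]
  exact Finset.sum_le_univ_sum_of_nonneg hw

/-! ### Maps on the sphere and their homology modulo two -/

/-- The sum of `z` over the darts with source `v`. -/
def starSum [Fintype D] {M : Type*} [AddCommMonoid M] (K : EmbeddedGraph V D) (z : D → M) (v : V) :
    M :=
  ∑ d, if K.src d = v then z d else 0

/-- A connected map whose first homology modulo two vanishes: every set of edges that meets every
vertex an even number of times separates the faces into two classes. -/
structure IsMap [Fintype D] (K : EmbeddedGraph V D) : Prop where
  rev_rev : ∀ d, K.rev (K.rev d) = d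
  rev_ne : ∀ d, K.rev d ≠ d
  src_rot : ∀ d, K.src (K.rot d) = K.src d
  sameCycle : ∀ d e, K.src d = K.src e → K.rot.SameCycle d e
  src_surjective : Function.Surjective K.src
  connected : ∀ u v, ∃ p, K.IsWalk u p v
  exact : ∀ z : D → ZMod 2, (∀ d, z (K.rev d) = z d) →
    (∀ v, K.starSum z v = 0) →
    ∃ col : D → ZMod 2, (∀ d, col (K.next d) = col d) ∧ ∀ d, col (K.rev d) = col d + z d

theorem rot_apply (d : D) : K.rot d = K.next (K.rev d) := rfl

theorem eq_of_sameCycle {α : Type*} {σ : Equiv.Perm D} {f : D → α} (hf : ∀ d, f (σ d) = f d)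
    {d e : D} (h : σ.SameCycle d e) : f e = f d := by
  have hpow : ∀ (n : ℕ) (x : D), f ((σ ^ n) x) = f x := by
    intro n
    induction n with
    | zero => simp
    | succ n ih => intro x; rw [pow_succ', Equiv.Perm.mul_apply, hf, ih]
  obtain ⟨k, rfl⟩ := h
  cases k with
  | ofNat n => exact hpow n d
  | negSucc n =>
    have := hpow (n + 1) ((σ ^ (Int.negSucc n)) d)
    rw [← this, ← Equiv.Perm.mul_apply, zpow_negSucc, mul_inv_cancel]
    rfl

/-- Connectedness of the dual graph. The function is invariant under `rot`, hence constant on the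
darts at a vertex, and `rev` carries its value along walks from one vertex to the next. -/
theorem eq_of_invariant {α : Type*} 
    (hs : ∀ d e, K.src d = K.src e → K.rot.SameCycle d e)
    (hc : ∀ u v, ∃ p, K.IsWalk u p v) {f : D → α} (hn : ∀ d, f (K.next d) = f d)
    (hr : ∀ d, f (K.rev d) = f d) (d e : D) : f d = f e := by
  have hrot : ∀ d, f (K.rot d) = f d := fun d => by rw [rot_apply, hn, hr]
  obtain ⟨p, hp⟩ := hc (K.src d) (K.src e)
  induction p generalizing d with
  | nil => exact (eq_of_sameCycle hrot (hs d e hp)).symm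
  | cons a p ih =>
    rw [eq_of_sameCycle hrot (hs a d hp.1), ← hr a]
    exact ih (K.rev a) hp.2

/-- A sum over darts as a sum over edges: the enumeration `o` selects the smaller of two opposite
darts. -/
theorem sum_half {M : Type*} [AddCommMonoid M] [Fintype D] {n : ℕ} (ρ : D → D)
    (hrr : ∀ d, ρ (ρ d) = d) (hne : ∀ d, ρ d ≠ d) (o : D ≃ Fin n) (g : D → M) :
    ∑ e : {d // o d < o (ρ d)}, (g e + g (ρ e)) = ∑ d, g d := by
  rw [Finset.sum_add_distrib, ← Finset.sum_filter_add_sum_filter_not Finset.univ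
    (fun d => o d < o (ρ d)) g]
  congr 1
  · exact (Finset.sum_subtype _ (by simp) g).symm
  · refine Finset.sum_bij' (fun e _ => ρ e) (fun d hd => ⟨ρ d, ?_⟩) ?_ ?_ ?_ ?_ ?_
    · have := (Finset.mem_filter.1 hd).2
      rw [hrr]
      rcases lt_trichotomy (o d) (o (ρ d)) with h | h | h
      · exact absurd h this
      · exact absurd (o.injective h).symm (hne d)
      · exact h
    · intro e _
      simp only [Finset.mem_filter, Finset.mem_univ, true_and, hrr, not_lt]
      exact e.2.le
    · simp
    · intro e _; simp [hrr]
    · intro d _; simp [hrr]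
    · simp

theorem starSum_rot [Fintype D] (hsr : ∀ d, K.src (K.rot d) = K.src d) {M : Type*}
    [AddCommMonoid M] (f : D → M) (v : V) :
    K.starSum (fun d => f (K.rot d)) v = K.starSum f v := by
  rw [starSum, starSum, ← Equiv.sum_comp K.rot fun d => if K.src d = v then f d else 0]
  simp [hsr]

theorem starSum_add [Fintype D] {M : Type*} [AddCommMonoid M] (f g : D → M) (v : V) :
    K.starSum (fun d => f d + g d) v = K.starSum f v + K.starSum g v := by
  rw [starSum, starSum, starSum, ← Finset.sum_add_distrib]
  refine Finset.sum_congr rfl fun d _ => ?_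
  split_ifs <;> simp

theorem face_next (d : D) : K.face (K.next d) = K.face d :=
  Quotient.sound (s := Equiv.Perm.SameCycle.setoid K.next)
    (Equiv.Perm.SameCycle.symm ⟨1, by simp⟩)

theorem face_eq_iff {d e : D} : K.face d = K.face e ↔ K.SameFace d e :=
  Quotient.eq (r := Equiv.Perm.SameCycle.setoid K.next)

theorem face_surjective : Function.Surjective K.face := Quotient.mk_surjective

instance [Finite D] : Finite K.Face :=
  inferInstanceAs (Finite (Quotient (Equiv.Perm.SameCycle.setoid K.next)))

theorem finrank_le_one_of_constant {ι F : Type*} [Field F] (S : Submodule F (ι → F))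
    (h : ∀ f ∈ S, ∀ i j, f i = f j) : Module.finrank F S ≤ 1 := by
  have hle : S ≤ Submodule.span F {fun _ => (1 : F)} := by
    intro f hf
    rw [Submodule.mem_span_singleton]
    rcases isEmpty_or_nonempty ι with hι | ⟨⟨i⟩⟩
    · exact ⟨0, Subsingleton.elim _ _⟩
    · exact ⟨f i, funext fun j => by simpa using h f hf i j⟩
  exact (Submodule.finrank_mono hle).trans ((finrank_span_le_card _).trans (by simp))

/-- Coboundaries of face colourings are cycles, and Euler's formula makes both spaces equally large.
Vanishing homology is the form of planarity that survives the deletion of edges and the filling of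
holes. -/
theorem IsPlane.isMap [Fintype V] [Fintype D] {G : EmbeddedGraph V D} (hG : G.IsPlane) :
    G.IsMap := by
  have hsr : ∀ d, G.src (G.rot d) = G.src d := fun d =>
    (hG.src_eq_iff _ _).2 (Equiv.Perm.SameCycle.symm ⟨1, by simp⟩)
  have hsc : ∀ d e, G.src d = G.src e → G.rot.SameCycle d e := fun d e => (hG.src_eq_iff d e).1
  refine ⟨hG.rev_rev, hG.rev_ne, hsr, hsc, hG.src_surjective, hG.connected, ?_⟩
  let o := Fintype.equivFin D
  -- `H` stands for the set of edges, and `M` is the incidence matrix of vertices and edges modulo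
  -- two.
  let H := {d // o d < o (G.rev d)}
  have : Fintype G.Face := Fintype.ofFinite _
  have hcard : 2 * Fintype.card H = Fintype.card D := by
    have := sum_half G.rev hG.rev_rev hG.rev_ne o (fun _ => (1 : ℕ))
    simpa [H, mul_comm] using this
  let M : Matrix V H (ZMod 2) := fun v e =>
    (if G.src e = v then 1 else 0) + (if G.tgt e = v then 1 else 0)
  have hMz : ∀ z : D → ZMod 2, (∀ d, z (G.rev d) = z d) → ∀ v,
      M.mulVec (fun e => z e) v = G.starSum z v := by
    intro z hz v
    rw [starSum, ← sum_half G.rev hG.rev_rev hG.rev_ne o]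
    refine Finset.sum_congr rfl fun e _ => ?_
    have : ∀ (P Q : Prop) (a : ZMod 2), ((if P then 1 else 0) + (if Q then 1 else 0)) * a =
        (if P then a else 0) + if Q then a else 0 := by
      intro P Q a
      split_ifs <;> ring
    rw [hz]
    exact this _ _ _
  -- By connectedness the left kernel consists of constants, so the rank of `M` is at least `|V| -
  -- 1`.
  have hker : ∀ f ∈ LinearMap.ker M.transpose.mulVecLin, ∀ i j, f i = f j := by
    intro f hf u v
    have hf' : ∀ e : H, f (G.src e) + f (G.tgt e) = 0 := by
      intro e
      have := congrFun (LinearMap.mem_ker.1 hf) e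
      simpa [Matrix.mulVec, dotProduct, M, Matrix.transpose, add_mul, Finset.sum_add_distrib]
        using this
    have hf'' : ∀ d, f (G.src d) = f (G.tgt d) := by
      intro d
      rcases lt_trichotomy (o d) (o (G.rev d)) with h | h | h
      · exact CharTwo.add_eq_zero.1 (hf' ⟨d, h⟩)
      · exact absurd (o.injective h).symm (hG.rev_ne d)
      · have := CharTwo.add_eq_zero.1 (hf' ⟨G.rev d, by rwa [hG.rev_rev]⟩)
        simpa [tgt, hG.rev_rev] using this.symm
    obtain ⟨p, hp⟩ := hG.connected u v
    induction p generalizing u with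
    | nil => exact congrArg f hp
    | cons d p ih => rw [← hp.1, hf'']; exact ih _ hp.2
  have hr1 : Fintype.card V ≤ M.rank + 1 := by
    have h1 := LinearMap.finrank_range_add_finrank_ker M.transpose.mulVecLin
    have h2 := finrank_le_one_of_constant _ hker
    have h3 : M.transpose.rank = M.rank := Matrix.rank_transpose M
    rw [Matrix.rank] at h3
    simp only [Module.finrank_fintype_fun_eq_card] at h1
    omega
  -- The coboundary: the edges at which a face colouring changes. Its kernel is at most
  -- one-dimensional because the dual graph is connected.
  let δ : (G.Face → ZMod 2) →ₗ[ZMod 2] (H → ZMod 2) :=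
    { toFun := fun c e => c (G.face e) + c (G.face (G.rev e))
      map_add' := fun c c' => by ext e; simp only [Pi.add_apply]; ring
      map_smul' := fun a c => by ext e; simp only [Pi.smul_apply, smul_eq_mul, RingHom.id_apply]; ring }
  have hδker : Module.finrank (ZMod 2) (LinearMap.ker δ) ≤ 1 := by
    apply finrank_le_one_of_constant
    intro c hc
    have h1 : ∀ e : H, c (G.face e) + c (G.face (G.rev e)) = 0 := fun e =>
      congrFun (LinearMap.mem_ker.1 hc) e
    have h2 : ∀ d, c (G.face (G.rev d)) = c (G.face d) := by
      intro d
      rcases lt_trichotomy (o d) (o (G.rev d)) with h | h | h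
      · exact (CharTwo.add_eq_zero.1 (h1 ⟨d, h⟩)).symm
      · exact absurd (o.injective h).symm (hG.rev_ne d)
      · have := CharTwo.add_eq_zero.1 (h1 ⟨G.rev d, by rwa [hG.rev_rev]⟩)
        simpa [hG.rev_rev] using this
    intro f g
    obtain ⟨d, rfl⟩ := face_surjective f
    obtain ⟨e, rfl⟩ := face_surjective g
    exact eq_of_invariant (f := fun d => c (G.face d)) hsc hG.connected
      (fun d => by rw [face_next]) h2 d e
  have hle : LinearMap.range δ ≤ LinearMap.ker M.mulVecLin := by
    rintro _ ⟨c, rfl⟩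
    rw [LinearMap.mem_ker]
    ext v
    have h1 := hMz (fun d => c (G.face d) + c (G.face (G.rev d)))
      (fun d => by rw [hG.rev_rev, add_comm]) v
    -- The face of `rev d` is that of `rot d`. So around a vertex the colours on both sides of the
    -- edges have the same sum, and the total is twice this sum.
    have h2 := starSum_rot hsr (fun d => c (G.face d)) v
    have h3 : ∀ d, c (G.face (G.rot d)) = c (G.face (G.rev d)) := fun d => by
      rw [rot_apply, face_next]
    simp only [h3] at h2
    rw [starSum_add, h2, CharTwo.add_self_eq_zero] at h1
    exact h1
  -- The kernel of `M` has dimension at most `|E| - |V| + 1`, the range of `δ` at least `|F| - 1`,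
  -- and these numbers agree by Euler's formula.
  have heq : LinearMap.range δ = LinearMap.ker M.mulVecLin := by
    apply Submodule.eq_of_le_of_finrank_le hle
    have h1 := LinearMap.finrank_range_add_finrank_ker M.mulVecLin
    have h2 := LinearMap.finrank_range_add_finrank_ker δ
    have h3 := hG.euler
    simp only [Module.finrank_fintype_fun_eq_card, Nat.card_eq_fintype_card] at h1 h2 h3
    rw [Matrix.rank] at hr1
    omega
  intro z hz hev
  have hmem : (fun e : H => z e) ∈ LinearMap.ker M.mulVecLin := by
    rw [LinearMap.mem_ker]
    ext v
    exact (hMz z hz v).trans (hev v)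
  rw [← heq] at hmem
  obtain ⟨c, hc⟩ := hmem
  have hc' : ∀ e : H, c (G.face (G.rev e)) = c (G.face e) + z e := by
    intro e
    have : c (G.face e) + c (G.face (G.rev e)) = z e := congrFun hc e
    rw [← this, ← add_assoc, CharTwo.add_self_eq_zero, zero_add]
  refine ⟨fun d => c (G.face d), fun d => by simp only [face_next], fun d => ?_⟩
  rcases lt_trichotomy (o d) (o (G.rev d)) with h | h | h
  · exact hc' ⟨d, h⟩
  · exact absurd (o.injective h).symm (hG.rev_ne d)
  · have := hc' ⟨G.rev d, by rwa [hG.rev_rev]⟩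
    simp only [hG.rev_rev, hz] at this
    simp only [this, add_assoc, CharTwo.add_self_eq_zero, add_zero]

end EmbeddedGraph
end

/-! ### Darts of a face, and functions whose sums over the cycles of a permutation vanish -/

noncomputable section

namespace EmbeddedGraph

variable {V D : Type*} {K : EmbeddedGraph V D}

theorem SameFace.next {d e : D} (h : K.SameFace d e) : K.SameFace d (K.next e) :=
  h.trans ⟨1, by simp⟩

theorem SameFace.prev {d e : D} (h : K.SameFace d e) : K.SameFace d (K.next.symm e) :=
  h.trans (Equiv.Perm.SameCycle.symm ⟨1, by simp⟩)

theorem sameFace_next_iff {d e : D} : K.SameFace d (K.next e) ↔ K.SameFace d e :=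
  ⟨fun h => by simpa using h.prev, fun h => h.next⟩

theorem sameFace_prev_iff {d e : D} : K.SameFace d (K.next.symm e) ↔ K.SameFace d e :=
  ⟨fun h => by simpa using h.next, fun h => h.prev⟩

namespace IsMap

variable [Fintype D] (hK : K.IsMap)
include hK

theorem src_next (d : D) : K.src (K.next d) = K.tgt d := by
  have := hK.src_rot (K.rev d)
  rwa [rot_apply, hK.rev_rev] at this

theorem tgt_rev (d : D) : K.tgt (K.rev d) = K.src d := by rw [tgt, hK.rev_rev]

theorem tgt_prev (d : D) : K.tgt (K.next.symm d) = K.src d := by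
  rw [← hK.src_next, Equiv.apply_symm_apply]

theorem eq_of_invariant {α : Type*} {f : D → α} (hn : ∀ d, f (K.next d) = f d)
    (hr : ∀ d, f (K.rev d) = f d) (d e : D) : f d = f e :=
  EmbeddedGraph.eq_of_invariant hK.sameCycle hK.connected hn hr d e

end IsMap

end EmbeddedGraph

section Primitive

variable {D : Type*} [Fintype D]

/-- A closed stretch of an orbit consists of full turns around the cycle, each of sum zero. -/
theorem sum_range_eq_zero_of_pow_apply_eq (σ : Equiv.Perm D) (w : D → ZMod 2)
    (hw : ∀ d, (∑ e, if σ.SameCycle d e then w e else 0) = 0) (n : ℕ) (d : D)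
    (hn : (σ ^ n) d = d) : ∑ i ∈ Finset.range n, w ((σ ^ (i + 1)) d) = 0 := by
  induction n using Nat.strong_induction_on with
  | _ n ih =>
  rcases Nat.eq_zero_or_pos n with rfl | hpos
  · simp
  -- An earlier return splits the stretch into two closed stretches; without one, the stretch runs
  -- through the cycle exactly once.
  by_cases hp : ∃ p, 0 < p ∧ p < n ∧ (σ ^ p) d = d
  · obtain ⟨p, hp0, hpn, hp⟩ := hp
    obtain ⟨m, rfl⟩ := Nat.exists_eq_add_of_lt hpn
    have hm : (σ ^ (m + 1)) d = d := by
      rw [show p + m + 1 = (m + 1) + p by ring, pow_add, Equiv.Perm.mul_apply, hp] at hn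
      exact hn
    rw [show p + m + 1 = p + (m + 1) by ring, Finset.sum_range_add, ih p hpn hp, zero_add]
    rw [← ih (m + 1) (by omega) hm]
    refine Finset.sum_congr rfl fun i _ => ?_
    rw [show p + i + 1 = (i + 1) + p by ring, pow_add σ (i + 1) p, Equiv.Perm.mul_apply, hp]
  · rw [← hw d, ← Finset.sum_filter]
    have hmod : ∀ k, (σ ^ k) d = (σ ^ (k % n)) d := by
      intro k
      have hq : ∀ q, (σ ^ (n * q)) d = d := by
        intro q
        induction q with
        | zero => simp
        | succ q ihq => rw [mul_add, mul_one, pow_add, Equiv.Perm.mul_apply, hn, ihq]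
      conv_lhs => rw [← Nat.mod_add_div k n, pow_add, Equiv.Perm.mul_apply, hq]
    refine Finset.sum_bij (fun i _ => (σ ^ (i + 1)) d) ?_ ?_ ?_ (fun _ _ => rfl)
    · intro i _
      simp only [Finset.mem_filter, Finset.mem_univ, true_and]
      exact ⟨(i + 1 : ℕ), rfl⟩
    · have key : ∀ i j, i < j → j < n → (σ ^ (i + 1)) d = (σ ^ (j + 1)) d → False := by
        intro i j hij hj h
        obtain ⟨m, rfl⟩ := Nat.exists_eq_add_of_lt hij
        refine hp ⟨m + 1, by omega, by omega, ?_⟩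
        rw [show i + m + 1 + 1 = (i + 1) + (m + 1) by ring, pow_add σ (i + 1) (m + 1),
          Equiv.Perm.mul_apply] at h
        exact ((σ ^ (i + 1)).injective h).symm
      intro i hi j hj h
      rcases lt_trichotomy i j with hij | hij | hij
      · exact (key i j hij (Finset.mem_range.1 hj) h).elim
      · exact hij
      · exact (key j i hij (Finset.mem_range.1 hi) h.symm).elim
    · intro e he
      simp only [Finset.mem_filter, Finset.mem_univ, true_and] at he
      obtain ⟨k, hk, -, rfl⟩ := he.exists_pow_eq'' 
      refine ⟨(k - 1) % n, Finset.mem_range.2 (Nat.mod_lt _ hpos), ?_⟩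
      rw [hmod ((k - 1) % n + 1), Nat.mod_add_mod, ← hmod, Nat.sub_add_cancel hk]

/-- A function on a permuted set whose sums over all cycles vanish is a difference. -/
theorem exists_primitive (σ : Equiv.Perm D) (w : D → ZMod 2)
    (hw : ∀ d, (∑ e, if σ.SameCycle d e then w e else 0) = 0) :
    ∃ c : D → ZMod 2, ∀ d, c (σ d) = c d + w (σ d) := by
  -- `r` chooses a base point on every cycle. The primitive at `d` is the sum of `w` on the way from
  -- the base point to `d`.
  let r : D → D := fun d => (Quotient.mk (Equiv.Perm.SameCycle.setoid σ) d).out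
  have hr : ∀ d, σ.SameCycle (r d) d := fun d =>
    Quotient.exact (s := Equiv.Perm.SameCycle.setoid σ)
      (Quotient.out_eq (Quotient.mk (Equiv.Perm.SameCycle.setoid σ) d))
  have hrσ : ∀ d, r (σ d) = r d := fun d => congrArg Quotient.out
    (Quotient.sound (s := Equiv.Perm.SameCycle.setoid σ) (Equiv.Perm.SameCycle.symm ⟨1, by simp⟩))
  have hk : ∀ d, ∃ k : ℕ, (σ ^ k) (r d) = d := fun d => by
    obtain ⟨k, -, hk⟩ := (hr d).exists_pow_eq'
    exact ⟨k, hk⟩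
  choose k hk using hk
  -- The sum does not depend on how many full turns are made on the way.
  have hindep : ∀ (d : D) (a b : ℕ), a ≤ b → (σ ^ a) d = (σ ^ b) d →
      ∑ i ∈ Finset.range a, w ((σ ^ (i + 1)) d) = ∑ i ∈ Finset.range b, w ((σ ^ (i + 1)) d) := by
    intro d a b hab h
    obtain ⟨m, rfl⟩ := Nat.exists_eq_add_of_le hab
    have hm : (σ ^ m) d = d := by
      rw [pow_add, Equiv.Perm.mul_apply] at h
      exact ((σ ^ a).injective h).symm
    rw [add_comm a m, Finset.sum_range_add, sum_range_eq_zero_of_pow_apply_eq σ w hw m d hm,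
      zero_add]
    refine Finset.sum_congr rfl fun i _ => ?_
    rw [show m + i + 1 = (i + 1) + m by ring, pow_add σ (i + 1) m, Equiv.Perm.mul_apply, hm]
  refine ⟨fun d => ∑ i ∈ Finset.range (k d), w ((σ ^ (i + 1)) (r d)), fun d => ?_⟩
  have h1 : (σ ^ (k d + 1)) (r d) = σ d := by
    rw [pow_succ', Equiv.Perm.mul_apply, hk]
  have h2 : ∑ i ∈ Finset.range (k (σ d)), w ((σ ^ (i + 1)) (r (σ d))) =
      ∑ i ∈ Finset.range (k d + 1), w ((σ ^ (i + 1)) (r d)) := by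
    have h3 := hk (σ d)
    rw [hrσ] at h3 ⊢
    rcases le_total (k (σ d)) (k d + 1) with h | h
    · exact hindep _ _ _ h (h3.trans h1.symm)
    · exact (hindep _ _ _ h (h1.trans h3.symm)).symm
  simp only [h2, Finset.sum_range_succ, h1]

end Primitive

/-! ### The embedding that a region inherits -/

theorem inducedPerm_spec {D : Type*} [Finite D] (σ : Equiv.Perm D) (S : Set D)
    (d : {d // d ∈ S}) : ∃ k : ℕ, 0 < k ∧ (inducedPerm σ S d : D) = (σ ^ k) d ∧
      ∀ j, 0 < j → j < k → (σ ^ j) (d : D) ∉ S :=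
  ⟨_, (Nat.find_spec (exists_return σ S d d.2)).1, rfl, fun _ h0 hj hm =>
    Nat.find_min (exists_return σ S d d.2) hj ⟨h0, hm⟩⟩

theorem inducedPerm_sameCycle {D : Type*} [Finite D] (σ : Equiv.Perm D) (S : Set D)
    (d e : {d // d ∈ S}) (h : σ.SameCycle (d : D) e) : (inducedPerm σ S).SameCycle d e := by
  have key : ∀ (n : ℕ) (d e : {d // d ∈ S}), (σ ^ n) (d : D) = e →
      (inducedPerm σ S).SameCycle d e := by
    intro n
    induction n using Nat.strong_induction_on with
    | _ n ih =>
    intro d e h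
    rcases Nat.eq_zero_or_pos n with rfl | hpos
    · obtain rfl : d = e := Subtype.ext h
      exact .refl _ _
    · obtain ⟨k, hk0, hk, hmin⟩ := inducedPerm_spec σ S d
      have hkn : k ≤ n := by
        by_contra hlt
        exact hmin n hpos (by omega) (h ▸ e.2)
      obtain ⟨m, rfl⟩ := Nat.exists_eq_add_of_le' hkn
      refine Equiv.Perm.SameCycle.trans ⟨1, rfl⟩ (ih m (by omega) (inducedPerm σ S d) e ?_)
      rw [← h, pow_add, Equiv.Perm.mul_apply, hk]
  obtain ⟨n, -, hn⟩ := h.exists_pow_eq'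
  exact key n d e hn

namespace Region

open EmbeddedGraph

variable {V D : Type*} {G : EmbeddedGraph V D} (R : Region G) [Fintype D]

theorem graph_rot : R.graph.rot = inducedPerm G.rot R.darts := by
  show inducedPerm G.rot R.darts * (G.rev.subtypePerm R.rev_mem)⁻¹ *
    (G.rev.subtypePerm R.rev_mem) = _
  rw [mul_assoc, inv_mul_cancel, mul_one]

theorem coe_graph_src (d : R.Dart) : ((R.graph.src d : R.Vert) : V) = G.src d := rfl

theorem coe_graph_tgt (d : R.Dart) : ((R.graph.tgt d : R.Vert) : V) = G.tgt d := rfl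

/-- A cycle of the region, extended by zero, is a cycle of `G`. The colouring that it has there does
not change across deleted edges, hence is constant on the faces of the region, which are unions of
faces of `G` merged across these edges. -/
theorem graph_isMap (hG : G.IsMap) (hc : ∀ u v, ∃ p, R.graph.IsWalk u p v) : R.graph.IsMap := by
  have hpow : ∀ (k : ℕ) d, G.src ((G.rot ^ k) d) = G.src d := by
    intro k
    induction k with
    | zero => simp
    | succ k ih => intro d; rw [pow_succ', Equiv.Perm.mul_apply, hG.src_rot, ih]
  have hrr : ∀ d, R.graph.rev (R.graph.rev d) = d := fun d => Subtype.ext (hG.rev_rev d)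
  refine ⟨hrr, fun d h => hG.rev_ne d (congrArg Subtype.val h), ?_, ?_, ?_, hc, ?_⟩
  · intro d
    rw [graph_rot]
    obtain ⟨k, -, hk, -⟩ := inducedPerm_spec G.rot R.darts d
    exact Subtype.ext (by rw [coe_graph_src, coe_graph_src, hk, hpow])
  · intro d e h
    rw [graph_rot]
    exact inducedPerm_sameCycle _ _ _ _ (hG.sameCycle _ _ (congrArg Subtype.val h))
  · rintro ⟨v, d, hd, rfl⟩
    exact ⟨⟨d, hd⟩, rfl⟩
  · intro z hz hev
    let z' : D → ZMod 2 := fun d => if hd : d ∈ R.darts then z ⟨d, hd⟩ else 0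
    have hz' : ∀ d, z' (G.rev d) = z' d := by
      intro d
      by_cases hd : d ∈ R.darts
      · simp only [z', dif_pos hd, dif_pos ((R.rev_mem d).2 hd)]
        exact hz ⟨d, hd⟩
      · simp only [z', dif_neg hd, dif_neg (fun h => hd ((R.rev_mem d).1 h))]
    have hev' : ∀ v, G.starSum z' v = 0 := by
      intro v
      rw [starSum, ← Finset.sum_subset (Finset.subset_univ (Finset.univ.filter (· ∈ R.darts)))]
      · rw [Finset.sum_subtype (p := (· ∈ R.darts)) _ (by simp)]
        by_cases hv : v ∈ R.verts
        · refine Eq.trans (Finset.sum_congr rfl fun d _ => ?_) (hev ⟨v, hv⟩)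
          have : R.graph.src d = ⟨v, hv⟩ ↔ G.src d = v := Subtype.ext_iff
          simp only [this, z', d.2, dite_true]
        · refine Finset.sum_eq_zero fun d _ => if_neg fun h => hv ⟨d, d.2, h⟩
      · intro d _ hd
        have hd' : d ∉ R.darts := by simpa using hd
        simp [z', hd']
    obtain ⟨col, hn, hr⟩ := hG.exact z' hz' hev'
    have hrot : ∀ d, col (G.rot d) = col d + z' d := fun d => by rw [rot_apply, hn, hr]
    refine ⟨fun d => col d, fun d => ?_, fun d => ?_⟩
    · have h1 : R.graph.next d = inducedPerm G.rot R.darts (R.graph.rev d) := by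
        rw [← graph_rot, rot_apply, hrr]
      obtain ⟨k, hk0, hk, hmin⟩ := inducedPerm_spec G.rot R.darts (R.graph.rev d)
      -- The first rotation leads from `rev d` to the successor of `d` in its face in `G`; each
      -- further one crosses a deleted edge, where `z'` vanishes.
      have h2 : ∀ j, 0 < j → j ≤ k → col ((G.rot ^ j) (G.rev d)) = col d := by
        intro j
        induction j with
        | zero => simp
        | succ j ih =>
          intro _ hj
          rcases Nat.eq_zero_or_pos j with rfl | hj0
          · rw [zero_add, pow_one, rot_apply, hn, hG.rev_rev]
          · rw [pow_succ', Equiv.Perm.mul_apply, hrot, ih hj0 (by omega)]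
            have : (G.rot ^ j) (G.rev d) ∉ R.darts := hmin j hj0 (by omega)
            simp [z', this]
      simp only [h1, hk]
      exact h2 k hk0 le_rfl
    · have := hr d
      rwa [show z' d = z d by simp [z']] at this

end Region

/-! ### Filling the holes of a region -/

namespace Region

open EmbeddedGraph

variable {V D : Type*} {G : EmbeddedGraph V D} {R : Region G} [Fintype D] {h : R.Dart}
  {spoke : D → Bool → ℝ}

theorem fill_next_inl (e : R.Dart) : (R.fill h spoke).next (.inl e) =
    if he : R.IsOtherHole h e
        then .inr (⟨R.graph.next e, (R.isOtherHole_next h e).2 he⟩, false)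
        else .inl (R.graph.next e) := rfl

theorem fill_next_false (e : {e : R.Dart // R.IsOtherHole h e}) :
    (R.fill h spoke).next (.inr (e, false)) =
      .inr (⟨R.graph.next.symm e, R.isOtherHole_prev h e e.2⟩, true) := rfl

theorem fill_next_true (e : {e : R.Dart // R.IsOtherHole h e}) :
    (R.fill h spoke).next (.inr (e, true)) = .inl e := rfl

theorem fill_rev_inl (e : R.Dart) : (R.fill h spoke).rev (.inl e) = .inl (R.graph.rev e) := rfl

theorem fill_rev_inr (e : {e : R.Dart // R.IsOtherHole h e}) (b : Bool) :
    (R.fill h spoke).rev (.inr (e, b)) = .inr (e, !b) := by cases b <;> rfl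

theorem fill_src_inl (e : R.Dart) : (R.fill h spoke).src (.inl e) = .inl (R.graph.src e) := rfl

theorem fill_src_false (e : {e : R.Dart // R.IsOtherHole h e}) :
    (R.fill h spoke).src (.inr (e, false)) = .inl (R.graph.src e) := rfl

theorem fill_src_true (e : {e : R.Dart // R.IsOtherHole h e}) :
    (R.fill h spoke).src (.inr (e, true)) = .inr ⟨R.graph.face e, e, e.2, rfl⟩ := rfl

theorem isWalk_map_inl {u v : R.Vert} {p : List R.Dart} (hp : R.graph.IsWalk u p v) :
    (R.fill h spoke).IsWalk (.inl u) (p.map .inl) (.inl v) := by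
  induction p generalizing u with
  | nil => exact congrArg _ hp
  | cons d p ih => exact ⟨congrArg _ hp.1, ih hp.2⟩

theorem isOtherHole_congr {d e : R.Dart} (hde : R.graph.SameFace d e) :
    R.IsOtherHole h d ↔ R.IsOtherHole h e := by
  have := eq_of_sameCycle (f := R.IsOtherHole h) (fun d => propext (R.isOtherHole_next h d)) hde
  exact (Eq.to_iff this).symm

/-- The values of a cycle on the spokes of a hole sum to zero at its centre, so they are the
differences of a function `c` along the hole. Adding the boundaries of the triangles on which `c` is
one removes the spokes from the cycle. What remains is a cycle of the unfilled region; correcting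
its colouring by `c` colours the triangles. -/
theorem fill_exact (hR : R.graph.IsMap) (z : R.FillDart h → ZMod 2)
    (hz : ∀ d, z ((R.fill h spoke).rev d) = z d)
    (hev : ∀ v, (R.fill h spoke).starSum z v = 0) :
    ∃ col : R.FillDart h → ZMod 2, (∀ d, col ((R.fill h spoke).next d) = col d) ∧
      ∀ d, col ((R.fill h spoke).rev d) = col d + z d := by
  let w : R.Dart → ZMod 2 := fun e => if he : R.IsOtherHole h e then z (.inr (⟨e, he⟩, false)) else 0
  have hspoke : ∀ e, z (.inr (e, true)) = z (.inr (e, false)) := fun e => hz (.inr (e, false))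
  have hsplit : ∀ f : R.FillDart h → ZMod 2, ∑ d, f d =
      ∑ e, f (.inl e) + (∑ e, f (.inr (e, true)) + ∑ e, f (.inr (e, false))) := by
    intro f
    rw [Fintype.sum_sum_type, Fintype.sum_prod_type]
    simp [Finset.sum_add_distrib]
  have hsub : ∀ g : {e : R.Dart // R.IsOtherHole h e} → ZMod 2, ∑ e, g e =
      ∑ e, if he : R.IsOtherHole h e then g ⟨e, he⟩ else 0 := by
    intro g
    rw [← Finset.sum_subset (Finset.subset_univ (Finset.univ.filter (R.IsOtherHole h)))]
    · rw [Finset.sum_subtype (p := R.IsOtherHole h) _ (by simp)]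
      exact Finset.sum_congr rfl fun e _ => by simp [e.2]
    · intro d _ hd
      have hd' : ¬ R.IsOtherHole h d := by simpa using hd
      simp [hd']
  -- On a filled hole this is the condition of evenness at the centre; on all other faces `w`
  -- vanishes.
  have hw : ∀ d, (∑ e, if R.graph.next.SameCycle d e then w e else 0) = 0 := by
    intro d
    by_cases hd : R.IsOtherHole h d
    · have h1 := hev (.inr ⟨R.graph.face d, d, hd, rfl⟩)
      rw [starSum, hsplit] at h1
      simp only [fill_src_inl, fill_src_false, fill_src_true, reduceCtorEq, if_false,
        Finset.sum_const_zero, zero_add, add_zero, Sum.inr.injEq, Subtype.mk.injEq, face_eq_iff,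
        hspoke] at h1
      rw [hsub] at h1
      refine Eq.trans (Finset.sum_congr rfl fun e _ => ?_) h1
      have hsymm : R.graph.SameFace e d ↔ R.graph.next.SameCycle d e :=
        ⟨fun x => x.symm, fun x => x.symm⟩
      by_cases he : R.IsOtherHole h e
      · simp [he, w, hsymm]
      · simp [he, w]
    · refine Finset.sum_eq_zero fun e _ => ?_
      split_ifs with hde
      · exact dif_neg fun he => hd ((isOtherHole_congr hde).2 he)
      · rfl
  obtain ⟨c', hc'⟩ := exists_primitive R.graph.next w (fun d => by convert hw d)
  let c : R.Dart → ZMod 2 := fun e => if R.IsOtherHole h e then c' e else 0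
  have hc : ∀ e, c (R.graph.next e) = c e + w (R.graph.next e) := by
    intro e
    by_cases he : R.IsOtherHole h e
    · simp only [c, he, R.isOtherHole_next, if_true, hc']
    · simp [c, w, he, R.isOtherHole_next]
  -- Rotation about `v` pairs the two dart sides of consecutive edges, so the change of `c` there is
  -- accounted for by the spokes at `v`.
  have hcsum : ∀ v, R.graph.starSum c v =
      R.graph.starSum (fun e => c (R.graph.rev e)) v + R.graph.starSum w v := by
    intro v
    rw [← starSum_rot hR.src_rot c v, ← starSum_rot hR.src_rot w v, ← starSum_add]
    congr 1
    ext e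
    rw [rot_apply, hc]
  have hz2 : ∀ Z W Y : ZMod 2, Z + W = 0 → Z + (Y + W) + Y = 0 := by grind
  have hz3 : ∀ a b x y : ZMod 2, a + (x + b + y) + y = a + b + x := by grind
  have hz4 : ∀ a b x : ZMod 2, a + b = a + (b + x) + x := by grind
  obtain ⟨col, hn, hr⟩ := hR.exact (fun e => z (.inl e) + c e + c (R.graph.rev e))
    (fun d => by
      rw [hR.rev_rev, ← hz (.inl d), fill_rev_inl]
      exact add_right_comm _ _ _)
    (fun v => by
      have h3 := hev (.inl v)
      rw [starSum, hsplit] at h3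
      simp only [fill_src_inl, fill_src_false, fill_src_true, reduceCtorEq, if_false,
        Finset.sum_const_zero, zero_add, Sum.inl.injEq] at h3
      rw [hsub] at h3
      have h4 : R.graph.starSum (fun e => z (.inl e)) v + R.graph.starSum w v = 0 := by
        rw [← h3]
        refine congrArg₂ _ (Finset.sum_congr rfl fun e _ => by congr)
          (Finset.sum_congr rfl fun e _ => ?_)
        by_cases he : R.IsOtherHole h e <;> simp [w, he]
      rw [starSum_add, starSum_add, hcsum v]
      exact hz2 _ _ _ h4)
  -- All three darts of the triangle on `e` receive the colour `col e + c e`; the spoke towards the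
  -- centre at the tail of `e` belongs to the triangle on the preceding dart.
  let colK : R.FillDart h → ZMod 2
    | .inl e => col e + c e
    | .inr (e, false) => col (R.graph.next.symm e) + c (R.graph.next.symm e)
    | .inr (e, true) => col e + c e
  refine ⟨colK, ?_, ?_⟩
  · rintro (e | ⟨e, _ | _⟩)
    · rw [fill_next_inl]
      split_ifs with he
      · simp [colK]
      · simp [colK, hn, c, he, R.isOtherHole_next]
    · rfl
    · rfl
  · rintro (e | ⟨e, _ | _⟩)
    · simp only [fill_rev_inl, colK, hr]
      exact hz3 _ _ _ _
    · have h1 := hc (R.graph.next.symm e)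
      have h2 := hn (R.graph.next.symm e)
      rw [Equiv.apply_symm_apply] at h1 h2
      simp only [fill_rev_inr, colK, Bool.not_false, h1, h2, w, e.2, dif_pos]
      exact (add_assoc _ _ _).symm
    · have h1 := hc (R.graph.next.symm e)
      have h2 := hn (R.graph.next.symm e)
      rw [Equiv.apply_symm_apply] at h1 h2
      simp only [fill_rev_inr, colK, Bool.not_true, h1, h2, w, e.2, dif_pos, hspoke]
      exact hz4 _ _ _

/-- Around an old vertex, the rotation only gains the spokes, each followed by the dart of the hole
that starts there. Around a centre, it runs backwards through the hole. -/
theorem fill_isMap (hR : R.graph.IsMap) : (R.fill h spoke).IsMap := by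
  have hrr : ∀ d, (R.fill h spoke).rev ((R.fill h spoke).rev d) = d := by
    rintro (e | ⟨e, b⟩)
    · simp [fill_rev_inl, hR.rev_rev]
    · simp [fill_rev_inr]
  have hfalse : ∀ e, (R.fill h spoke).rot (.inr (e, false)) = .inl e := fun e => rfl
  have htrue : ∀ e, (R.fill h spoke).rot (.inr (e, true)) =
      .inr (⟨R.graph.next.symm e, R.isOtherHole_prev h e e.2⟩, true) := fun e => rfl
  have hinl : ∀ e, (R.fill h spoke).rot (.inl e) = if he : R.IsOtherHole h (R.graph.rev e)
        then .inr (⟨R.graph.next (R.graph.rev e), (R.isOtherHole_next h _).2 he⟩, false)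
        else .inl (R.graph.next (R.graph.rev e)) := fun e => rfl
  have hone : ∀ (σ : Equiv.Perm (R.FillDart h)) x, σ.SameCycle x (σ x) := fun σ x => ⟨1, by simp⟩
  have hrotc : ∀ e, (R.fill h spoke).rot.SameCycle (.inl e) (.inl (R.graph.rot e)) := by
    intro e
    by_cases he : R.IsOtherHole h (R.graph.rev e)
    · have h1 := hone (R.fill h spoke).rot (.inl e)
      rw [hinl, dif_pos he] at h1
      exact h1.trans (hone _ _)
    · have h1 := hone (R.fill h spoke).rot (.inl e)
      rwa [hinl, dif_neg he] at h1
  have hcyc : ∀ e e', R.graph.src e = R.graph.src e' →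
      (R.fill h spoke).rot.SameCycle (.inl e) (.inl e') := by
    intro e e' hee
    obtain ⟨n, -, rfl⟩ := (hR.sameCycle e e' hee).exists_pow_eq'
    clear hee
    induction n with
    | zero => exact .refl _ _
    | succ n ih =>
      rw [pow_succ', Equiv.Perm.mul_apply]
      exact ih.trans (hrotc _)
  have hsp : ∀ e, (R.fill h spoke).rot.SameCycle (.inr (e, false)) (.inl e) := fun e => hone _ _
  have hce : ∀ e e' : {e : R.Dart // R.IsOtherHole h e}, R.graph.SameFace e' e →
      (R.fill h spoke).rot.SameCycle (.inr (e, true)) (.inr (e', true)) := by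
    rintro ⟨e, he⟩ ⟨e', he'⟩ hee
    obtain ⟨n, -, hn⟩ := hee.exists_pow_eq'
    simp only at hn
    induction n generalizing e with
    | zero => obtain rfl : e' = e := hn; exact .refl _ _
    | succ n ih =>
      have h1 := hone (R.fill h spoke).rot (.inr (⟨e, he⟩, true))
      rw [htrue] at h1
      refine h1.trans (ih (R.graph.next.symm e) (R.isOtherHole_prev h e he) hee.prev ?_)
      rw [← hn, pow_succ', Equiv.Perm.mul_apply, Equiv.symm_apply_apply]
  refine ⟨hrr, ?_, ?_, ?_, ?_, ?_, fill_exact hR⟩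
  · rintro (e | ⟨e, b⟩) he
    · exact hR.rev_ne e (Sum.inl.inj he)
    · rw [fill_rev_inr] at he
      simp at he
  · rintro (e | ⟨e, _ | _⟩)
    · rw [hinl]
      have := hR.src_rot e
      split_ifs
      · exact congrArg Sum.inl this
      · exact congrArg Sum.inl this
    · rfl
    · rw [htrue, fill_src_true, fill_src_true]
      congr 2
      have := face_next (K := R.graph) (R.graph.next.symm e)
      rwa [Equiv.apply_symm_apply, eq_comm] at this
  · rintro (e | ⟨e, _ | _⟩) (e' | ⟨e', _ | _⟩) hee
    · exact hcyc _ _ (Sum.inl.inj hee)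
    · exact (hcyc _ _ (Sum.inl.inj hee)).trans (hsp e').symm
    · exact (Sum.inl_ne_inr hee).elim
    · exact (hsp e).trans (hcyc _ _ (Sum.inl.inj hee))
    · exact ((hsp e).trans (hcyc _ _ (Sum.inl.inj hee))).trans (hsp e').symm
    · exact (Sum.inl_ne_inr hee).elim
    · exact (Sum.inl_ne_inr hee.symm).elim
    · exact (Sum.inl_ne_inr hee.symm).elim
    · exact hce e e' (face_eq_iff.1 (congrArg Subtype.val (Sum.inr.inj hee))).symm
  · rintro (v | ⟨_, e, he, rfl⟩)
    · obtain ⟨e, rfl⟩ := hR.src_surjective v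
      exact ⟨.inl e, rfl⟩
    · exact ⟨.inr (⟨e, he⟩, true), rfl⟩
  · have h1 : ∀ u v, ∃ p, (R.fill h spoke).IsWalk (.inl u) p (.inl v) := fun u v => by
      obtain ⟨p, hp⟩ := hR.connected u v
      exact ⟨_, isWalk_map_inl hp⟩
    have h2 : ∀ u, ∃ v p, (R.fill h spoke).IsWalk u p (.inl v) := by
      rintro (v | ⟨_, e, he, rfl⟩)
      · exact ⟨v, [], rfl⟩
      · exact ⟨R.graph.src e, [.inr (⟨e, he⟩, true)], rfl, rfl⟩
    have h3 : ∀ u, ∃ v p, (R.fill h spoke).IsWalk (.inl v) p u := by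
      rintro (v | ⟨_, e, he, rfl⟩)
      · exact ⟨v, [], rfl⟩
      · exact ⟨R.graph.src e, [.inr (⟨e, he⟩, false)], rfl, rfl⟩
    intro u v
    obtain ⟨u', p, hp⟩ := h2 u
    obtain ⟨v', q, hq⟩ := h3 v
    obtain ⟨s, hs⟩ := h1 u' v'
    exact ⟨_, (hp.append hs).append hq⟩

end Region

end

noncomputable section

namespace EmbeddedGraph

variable {V D : Type*} {K : EmbeddedGraph V D}

/-! ### Positions on the boundary of a face -/

section Boundary

variable [Finite D]

/-- The number of darts of a face is the least period of `next` on it, because the powers below this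
period run through the face without repetition. -/
theorem exists_bsize (K : EmbeddedGraph V D) (h : D) : (K.next ^ K.bsize h) h = h ∧ 0 < K.bsize h ∧
    ∀ i, 0 < i → i < K.bsize h → (K.next ^ i) h ≠ h := by
  have hex : ∃ p, 0 < p ∧ (K.next ^ p) h = h :=
    ⟨orderOf K.next, orderOf_pos _, by rw [pow_orderOf_eq_one]; rfl⟩
  obtain ⟨hp0, hp⟩ := Nat.find_spec hex
  have hmin : ∀ i, 0 < i → i < Nat.find hex → (K.next ^ i) h ≠ h := fun i h0 hi hh =>
    Nat.find_min hex hi ⟨h0, hh⟩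
  suffices hn : K.bsize h = Nat.find hex by
    rw [hn]
    exact ⟨hp, hp0, hmin⟩
  generalize Nat.find hex = p at *
  have hinj : ∀ i j, i < j → j < p → (K.next ^ i) h ≠ (K.next ^ j) h := by
    intro i j hij hj hh
    obtain ⟨m, rfl⟩ := Nat.exists_eq_add_of_lt hij
    rw [show i + m + 1 = i + (m + 1) by ring, pow_add K.next i (m + 1), Equiv.Perm.mul_apply] at hh
    exact hmin (m + 1) (by omega) (by omega) ((K.next ^ i).injective hh).symm
  have hmod : ∀ k, (K.next ^ (k % p)) h = (K.next ^ k) h := by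
    intro k
    have hq : ∀ q, (K.next ^ (p * q)) h = h := by
      intro q
      induction q with
      | zero => simp
      | succ q ihq => rw [mul_add, mul_one, pow_add, Equiv.Perm.mul_apply, hp, ihq]
    conv_rhs => rw [← Nat.mod_add_div k p, pow_add, Equiv.Perm.mul_apply, hq]
  let f : Fin p → {e // K.SameFace h e} := fun i => ⟨(K.next ^ (i : ℕ)) h, (i : ℕ), rfl⟩
  have hf : Function.Bijective f := by
    constructor
    · intro i j hij
      have hij' : (K.next ^ (i : ℕ)) h = (K.next ^ (j : ℕ)) h := congrArg Subtype.val hij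
      rcases lt_trichotomy (i : ℕ) j with hlt | heq | hlt
      · exact absurd hij' (hinj _ _ hlt j.2)
      · exact Fin.ext heq
      · exact absurd hij'.symm (hinj _ _ hlt i.2)
    · rintro ⟨e, he⟩
      obtain ⟨k, -, rfl⟩ := Equiv.Perm.SameCycle.exists_pow_eq' he
      exact ⟨⟨k % p, Nat.mod_lt _ hp0⟩, Subtype.ext (hmod k)⟩
  rw [bsize, ← Nat.card_congr (Equiv.ofBijective f hf)]
  simp

theorem bsize_pos (K : EmbeddedGraph V D) (h : D) : 0 < K.bsize h := (K.exists_bsize h).2.1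

theorem next_pow_mod (K : EmbeddedGraph V D) (h : D) (k : ℕ) :
    (K.next ^ (k % K.bsize h)) h = (K.next ^ k) h := by
  have hq : ∀ q, (K.next ^ (K.bsize h * q)) h = h := by
    intro q
    induction q with
    | zero => simp
    | succ q ihq =>
      rw [mul_add, mul_one, pow_add, Equiv.Perm.mul_apply, (K.exists_bsize h).1, ihq]
  conv_rhs => rw [← Nat.mod_add_div k (K.bsize h), pow_add, Equiv.Perm.mul_apply, hq]

theorem next_pow_inj {h : D} {i j : ℕ} (hi : i < K.bsize h) (hj : j < K.bsize h)
    (hij : (K.next ^ i) h = (K.next ^ j) h) : i = j := by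
  have key : ∀ i j, i < j → j < K.bsize h → (K.next ^ i) h ≠ (K.next ^ j) h := by
    intro i j hij hj hh
    obtain ⟨m, rfl⟩ := Nat.exists_eq_add_of_lt hij
    rw [show i + m + 1 = i + (m + 1) by ring, pow_add K.next i (m + 1), Equiv.Perm.mul_apply] at hh
    exact (K.exists_bsize h).2.2 (m + 1) (by omega) (by omega) ((K.next ^ i).injective hh).symm
  rcases lt_trichotomy i j with hlt | heq | hlt
  · exact absurd hij (key _ _ hlt hj)
  · exact heq
  · exact absurd hij.symm (key _ _ hlt hi)

theorem sameFace_pow (h : D) (k : ℕ) : K.SameFace h ((K.next ^ k) h) := ⟨k, rfl⟩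

theorem exists_pow_of_sameFace {h e : D} (he : K.SameFace h e) :
    ∃ i < K.bsize h, (K.next ^ i) h = e := by
  obtain ⟨k, -, rfl⟩ := Equiv.Perm.SameCycle.exists_pow_eq' he
  exact ⟨k % K.bsize h, Nat.mod_lt _ (K.bsize_pos h), K.next_pow_mod h k⟩

end Boundary

/-! ### Colourings of the faces by closed walks -/

theorem crossings_append (p q : List D) (d : D) :
    K.crossings (p ++ q) d = K.crossings p d + K.crossings q d := by
  simp only [crossings, List.count_append]
  omega

theorem crossings_cons (e : D) (p : List D) (d : D) :
    K.crossings (e :: p) d = K.crossings [e] d + K.crossings p d :=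
  crossings_append [e] p d

theorem crossings_eq_zero {p : List D} {d : D} (h1 : d ∉ p) (h2 : K.rev d ∉ p) :
    K.crossings p d = 0 := by
  rw [crossings, List.count_eq_zero_of_not_mem h1, List.count_eq_zero_of_not_mem h2]

section Coloring

variable [Fintype D]

/-- Each passage of a walk through a vertex uses two ends of edges, so only the two ends of the walk
count. The direction of travel does not matter, and closed curves may be put together from walks of
either direction. -/
theorem starSum_crossings (hrr : ∀ d, K.rev (K.rev d) = d) {u v : V} {p : List D}
    (hp : K.IsWalk u p v) (w : V) :
    K.starSum (fun d => (K.crossings p d : ZMod 2)) w =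
      (if u = w then 1 else 0) + if v = w then 1 else 0 := by
  induction p generalizing u with
  | nil =>
    obtain rfl : u = v := hp
    rw [CharTwo.add_self_eq_zero]
    simp [starSum, crossings]
  | cons d p ih =>
    have h1 : K.starSum (fun e => (K.crossings [d] e : ZMod 2)) w =
        (if K.src d = w then 1 else 0) + if K.tgt d = w then 1 else 0 := by
      have h2 : ∀ e, (K.crossings [d] e : ZMod 2) =
          (if e = d then 1 else 0) + if e = K.rev d then 1 else 0 := by
        intro e
        have h3 : K.rev e = d ↔ e = K.rev d :=
          ⟨fun h => by rw [← h, hrr], fun h => by rw [h, hrr]⟩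
        simp only [crossings, List.count_cons, List.count_nil, beq_iff_eq, eq_comm (a := d)]
        simp [h3]
      simp only [h2, starSum_add]
      have h4 : ∀ x : D, K.starSum (fun e => if e = x then (1 : ZMod 2) else 0) w =
          if K.src x = w then 1 else 0 := by
        intro x
        rw [starSum, Finset.sum_eq_single x]
        · simp
        · intro b _ hb; simp [hb]
        · simp
      rw [h4, h4]
      rfl
    have h5 : (fun e => (K.crossings (d :: p) e : ZMod 2)) =
        fun e => (K.crossings [d] e : ZMod 2) + (K.crossings p e : ZMod 2) := by
      ext e
      rw [crossings_cons, Nat.cast_add]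
    rw [h5, starSum_add, h1, ih hp.2, hp.1]
    grind

/-- A colouring of the faces that changes exactly at the edges of `γ`, and is zero at the face
of `h`. -/
structure IsColoring (K : EmbeddedGraph V D) (h : D) (γ : List D) (col : D → ZMod 2) : Prop where
  next : ∀ e, col (K.next e) = col e
  rev : ∀ e, col (K.rev e) = col e + K.crossings γ e
  zero : col h = 0

theorem inside_iff {h : D} {γ : List D} {d : D} :
    K.Inside h γ d ↔ ∃ col, K.IsColoring h γ col ∧ col d = 1 :=
  ⟨fun ⟨c, h1, h2, h3, h4⟩ => ⟨c, ⟨h1, h2, h3⟩, h4⟩, fun ⟨c, h, h4⟩ => ⟨c, h.1, h.2, h.3, h4⟩⟩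

theorem IsColoring.sameFace {h : D} {γ : List D} {col : D → ZMod 2} (hc : K.IsColoring h γ col)
    {d e : D} (hde : K.SameFace d e) : col e = col d :=
  eq_of_sameCycle hc.next hde

theorem IsMap.exists_coloring (hK : K.IsMap) (h : D) (γ : List D)
    (hγ : ∀ w, K.starSum (fun d => (K.crossings γ d : ZMod 2)) w = 0) :
    ∃ col, K.IsColoring h γ col := by
  obtain ⟨col, hn, hr⟩ := hK.exact (fun d => (K.crossings γ d : ZMod 2))
    (fun d => by simp only [crossings, hK.rev_rev, add_comm]) hγ
  refine ⟨fun d => col d + col h, fun d => by rw [hn], fun d => ?_, CharTwo.add_self_eq_zero _⟩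
  rw [hr]
  ring

theorem IsMap.coloring_unique (hK : K.IsMap) {h : D} {γ : List D} {col col' : D → ZMod 2}
    (hc : K.IsColoring h γ col) (hc' : K.IsColoring h γ col') : col = col' := by
  ext d
  have := hK.eq_of_invariant (f := fun d => col d + col' d)
    (fun d => by rw [hc.next, hc'.next]) (fun d => by rw [hc.rev, hc'.rev]; grind) d h
  rw [hc.zero, hc'.zero] at this
  exact CharTwo.add_eq_zero.1 (this.trans (add_zero 0))

theorem IsColoring.rot {h : D} {γ : List D} {col : D → ZMod 2} (hc : K.IsColoring h γ col)
    (d : D) : col (K.rot d) = col d + K.crossings γ d := by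
  rw [rot_apply, hc.next, hc.rev]

/-- A closed walk does not pass through the vertex `w`. -/
def Avoids (K : EmbeddedGraph V D) (γ : List D) (w : V) : Prop :=
  ∀ d ∈ γ, K.src d ≠ w ∧ K.tgt d ≠ w

theorem IsMap.crossings_of_avoids (hK : K.IsMap) {γ : List D} {d : D}
    (h : K.Avoids γ (K.src d)) : K.crossings γ d = 0 :=
  crossings_eq_zero (fun hd => (h d hd).1 rfl) (fun hd => (h _ hd).2 (hK.tgt_rev d))

/-- Turning around a vertex off the closed walk never crosses it. -/
theorem IsMap.coloring_eq_of_avoids (hK : K.IsMap) {h : D} {γ : List D} {col : D → ZMod 2}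
    (hc : K.IsColoring h γ col) {w : V} (hw : K.Avoids γ w) {d e : D} (hd : K.src d = w)
    (he : K.src e = w) : col d = col e := by
  obtain ⟨k, -, rfl⟩ := (hK.sameCycle d e (hd.trans he.symm)).exists_pow_eq'
  clear he
  induction k with
  | zero => rfl
  | succ k ih =>
    have hk : ∀ k, K.src ((K.rot ^ k) d) = w := by
      intro k
      induction k with
      | zero => exact hd
      | succ k ih => rw [pow_succ', Equiv.Perm.mul_apply, hK.src_rot, ih]
    rw [ih, pow_succ', Equiv.Perm.mul_apply, hc.rot, hK.crossings_of_avoids ((hk k).symm ▸ hw)]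
    simp

end Coloring

/-! ### Arcs of the boundary -/

section Arc

variable [Fintype D]

theorem mem_arc {h : D} {i j : ℕ} {d : D} :
    d ∈ K.arc h i j ↔ ∃ t < (j + K.bsize h - i) % K.bsize h, (K.next ^ (i + t)) h = d := by
  simp [arc]

theorem IsMap.isWalk_range (hK : K.IsMap) (h : D) (i m : ℕ) :
    K.IsWalk (K.bpos h i) ((List.range m).map fun t => (K.next ^ (i + t)) h) (K.bpos h (i + m)) := by
  induction m with
  | zero => rfl
  | succ m ih =>
    rw [List.range_succ, List.map_append]
    refine ih.append ⟨rfl, ?_⟩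
    show K.tgt ((K.next ^ (i + m)) h) = _
    rw [← hK.src_next, bpos, ← add_assoc, pow_succ', Equiv.Perm.mul_apply]

theorem bpos_mod (h : D) (k : ℕ) : K.bpos h (k % K.bsize h) = K.bpos h k := by
  rw [bpos, bpos, next_pow_mod]

theorem IsMap.isWalk_arc (hK : K.IsMap) {h : D} {i : ℕ} (hi : i < K.bsize h) (j : ℕ) :
    K.IsWalk (K.bpos h i) (K.arc h i j) (K.bpos h j) := by
  have h1 := hK.isWalk_range h i ((j + K.bsize h - i) % K.bsize h)
  have h2 : K.bpos h (i + (j + K.bsize h - i) % K.bsize h) = K.bpos h j := by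
    rw [← bpos_mod, Nat.add_mod_mod, show i + (j + K.bsize h - i) = j + K.bsize h by omega,
      Nat.add_mod_right, bpos_mod]
  rwa [h2] at h1

theorem arc_nodup (h : D) (i j : ℕ) : (K.arc h i j).Nodup := by
  refine (List.nodup_map_iff_inj_on List.nodup_range).2 ?_
  intro s hs t ht hst
  have hm : ∀ t ∈ List.range ((j + K.bsize h - i) % K.bsize h), t < K.bsize h := fun t ht =>
    (List.mem_range.1 ht).trans (Nat.mod_lt _ (K.bsize_pos h))
  simp only [pow_add, Equiv.Perm.mul_apply] at hst
  exact next_pow_inj (hm s hs) (hm t ht) ((K.next ^ i).injective hst)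

theorem pow_mem_arc_iff {h : D} {i q : ℕ} (hi : i < K.bsize h) (hq : q < K.bsize h) (j : ℕ) :
    (K.next ^ q) h ∈ K.arc h i j ↔
      (q + K.bsize h - i) % K.bsize h < (j + K.bsize h - i) % K.bsize h := by
  rw [mem_arc]
  have hn := K.bsize_pos h
  constructor
  · rintro ⟨t, ht, htq⟩
    have : (i + t) % K.bsize h = q := next_pow_inj (Nat.mod_lt _ hn) hq
      ((K.next_pow_mod h _).trans htq)
    have h2 : (q + K.bsize h - i) % K.bsize h = t := by
      have htn : t < K.bsize h := ht.trans (Nat.mod_lt _ hn)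
      rcases lt_or_ge (i + t) (K.bsize h) with hlt | hge
      · rw [Nat.mod_eq_of_lt hlt] at this
        rw [show q + K.bsize h - i = t + K.bsize h by omega, Nat.add_mod_right,
          Nat.mod_eq_of_lt htn]
      · rw [Nat.mod_eq_sub_mod hge, Nat.mod_eq_of_lt (by omega)] at this
        rw [show q + K.bsize h - i = t by omega, Nat.mod_eq_of_lt htn]
    rwa [h2]
  · intro hlt
    refine ⟨_, hlt, ?_⟩
    rw [← next_pow_mod, Nat.add_mod_mod, show i + (q + K.bsize h - i) = q + K.bsize h by omega,
      Nat.add_mod_right, next_pow_mod]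

theorem sameFace_of_mem_arc {h : D} {i j : ℕ} {d : D} (hd : d ∈ K.arc h i j) : K.SameFace h d := by
  obtain ⟨t, -, rfl⟩ := mem_arc.1 hd
  exact sameFace_pow h _

end Arc

/-! ### Discs -/

/-- A map in which the face of `h` is a simple cycle on at least three vertices, and all other faces
are triangles. -/
structure IsDisc [Fintype D] (K : EmbeddedGraph V D) (h : D) : Prop where
  map : K.IsMap
  simple : ∀ e e', K.SameFace h e → K.SameFace h e' → K.src e = K.src e' → e = e'
  three : 3 ≤ K.bsize h
  triangle : ∀ d, ¬ K.SameFace h d → K.next (K.next (K.next d)) = d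

namespace IsDisc

variable [Fintype D] {h : D} (hK : K.IsDisc h)
include hK

theorem next_next_ne {d : D} (hd : K.SameFace h d) : K.next (K.next d) ≠ d := by
  intro h2
  obtain ⟨i, hi, rfl⟩ := exists_pow_of_sameFace hd
  have h3 := hK.three
  have : (K.next ^ ((2 + i) % K.bsize h)) h = (K.next ^ i) h := by
    rw [next_pow_mod, pow_add, Equiv.Perm.mul_apply]
    exact h2
  have := next_pow_inj (Nat.mod_lt _ (by omega)) hi this
  rcases lt_or_ge (2 + i) (K.bsize h) with hlt | hge
  · rw [Nat.mod_eq_of_lt hlt] at this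
    omega
  · rw [Nat.mod_eq_sub_mod hge, Nat.mod_eq_of_lt (by omega)] at this
    omega

theorem next_ne {d : D} (hd : K.SameFace h d) : K.next d ≠ d := fun h1 =>
  hK.next_next_ne hd (by rw [h1, h1])

/-- If an edge had the outer face on both sides, simplicity would force `rev d = next d`, and then a
closed outer walk of length two. -/
theorem not_sameFace_rev {d : D} (hd : K.SameFace h d) : ¬ K.SameFace h (K.rev d) := by
  intro hr
  have h1 : K.rev d = K.next d := hK.simple _ _ hr hd.next (hK.map.src_next d).symm
  refine hK.next_next_ne hd (hK.simple _ _ hd.next.next hd ?_)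
  rw [hK.map.src_next, ← h1, hK.map.tgt_rev]

theorem prev_eq {d : D} (hd : ¬ K.SameFace h d) : K.next.symm d = K.next (K.next d) := by
  rw [Equiv.symm_apply_eq, hK.triangle d hd]

theorem prev_prev_eq {d : D} (hd : ¬ K.SameFace h d) : K.next.symm (K.next.symm d) = K.next d := by
  rw [hK.prev_eq hd, Equiv.symm_apply_apply]

theorem bpos_inj {i j : ℕ} (hi : i < K.bsize h) (hj : j < K.bsize h)
    (hij : K.bpos h i = K.bpos h j) : i = j :=
  next_pow_inj hi hj (hK.simple _ _ (sameFace_pow h i) (sameFace_pow h j) hij)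

end IsDisc

/-! ### Cells -/

/-- The vertices of a disc are partitioned into connected cells, one for each vertex on its
boundary. -/
structure IsCells [Fintype D] (K : EmbeddedGraph V D) (h : D) (site : V → V) : Prop
    extends K.IsDisc h where
  site_mem : ∀ z, ∃ e, K.SameFace h e ∧ K.src e = site z
  site_self : ∀ e, K.SameFace h e → site (K.src e) = K.src e
  path : ∀ z, ∃ p, K.IsWalk (site z) p z ∧ ∀ y ∈ K.support (site z) p, site y = site z

theorem IsVoronoi.isCells [Fintype D] {h : D} {ω : V → ℝ} {site : V → V}
    (hv : K.IsVoronoi h ω site) (hK : K.IsDisc h) (hu : K.UniqueShortestPaths) :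
    K.IsCells h site where
  toIsDisc := hK
  site_mem := hv.site_mem
  site_self := hv.site_self
  path z := ⟨_, sp_isWalk hu _ _, hv.closed z⟩

namespace IsCells

variable [Fintype D] {h : D} {site : V → V} (hK : K.IsCells h site)
include hK

theorem site_site (z : V) : site (site z) = site z := by
  obtain ⟨e, he, h1⟩ := hK.site_mem z
  rw [← h1, hK.site_self e he]

theorem eq_of_site_eq {d e : D} (hd : K.SameFace h d) (he : K.SameFace h e)
    (hs : site (K.src d) = site (K.src e)) : d = e := by
  rw [hK.site_self d hd, hK.site_self e he] at hs
  exact hK.simple d e hd he hs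

theorem site_tgt_ne {d : D} (hd : K.SameFace h d) : site (K.src d) ≠ site (K.tgt d) := by
  rw [← hK.map.src_next]
  exact fun h1 => hK.next_ne hd (hK.eq_of_site_eq hd hd.next h1).symm

/-- The closed region cut off by two paths within different cells contains those other cells
whose boundary vertex lies on its part of the outer face. -/
theorem mem_box_iff (hu : K.UniqueShortestPaths)
    (hclosed : ∀ z, ∀ y ∈ K.support (site z) (K.sp (site z) z), site y = site z)
    {i j q : ℕ} (hi : i < K.bsize h) (hj : j < K.bsize h) (hq : q < K.bsize h) {e : D} {v : V}
    (hia : K.bpos h i = site (K.src e)) (hjb : K.bpos h j = site (K.tgt e))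
    (hv : site v = K.bpos h q) (hqi : q ≠ i) (hqj : q ≠ j) :
    v ∈ K.box h i j e ↔
      (q + K.bsize h - i) % K.bsize h < (j + K.bsize h - i) % K.bsize h := by
  set p := K.sp (K.bpos h i) (K.src e) with hp
  set p' := K.sp (K.bpos h j) (K.tgt e) with hp'
  set b := K.arc h i j with hb
  have hwp : K.IsWalk (K.bpos h i) p (K.src e) := sp_isWalk hu _ _
  have hwp' : K.IsWalk (K.bpos h j) p' (K.tgt e) := sp_isWalk hu _ _
  have hwb : K.IsWalk (K.bpos h i) b (K.bpos h j) := hK.map.isWalk_arc hi j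
  set c := K.bpos h q with hc
  have hci : site (K.bpos h i) ≠ c := by
    rw [bpos, hK.site_self _ (sameFace_pow h i)]
    exact fun h1 => hqi (hK.bpos_inj hi hq h1).symm
  have hcj : site (K.bpos h j) ≠ c := by
    rw [bpos, hK.site_self _ (sameFace_pow h j)]
    exact fun h1 => hqj (hK.bpos_inj hj hq h1).symm
  have hsp : ∀ y ∈ K.support (K.bpos h i) p, site y ≠ c := by
    intro y hy
    rw [hp, hia] at hy
    rwa [hclosed _ y hy, ← hK.site_site, ← hia]
  have hsp' : ∀ y ∈ K.support (K.bpos h j) p', site y ≠ c := by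
    intro y hy
    rw [hp', hjb] at hy
    rwa [hclosed _ y hy, ← hK.site_site, ← hjb]
  have hex : site (K.src e) ≠ c := hsp _ (end_mem_support hwp)
  have hey : site (K.tgt e) ≠ c := hsp' _ (end_mem_support hwp')
  have hvp : v ∉ K.support (K.bpos h i) p := fun h1 => hsp v h1 hv
  have hvp' : v ∉ K.support (K.bpos h j) p' := fun h1 => hsp' v h1 hv
  set γ := p ++ e :: (p' ++ b) with hγ
  -- Both paths stay in cells other than that of `c`. So `γ` can meet the cell of `c` only along the
  -- arc, and there only at `c`, the one boundary vertex of this cell.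
  have hmem : ∀ d, (site (K.src d) = c ∨ site (K.tgt d) = c) → d ∈ γ → d ∈ b := by
    intro d hd hdγ
    simp only [hγ, List.mem_append, List.mem_cons] at hdγ
    rcases hdγ with h1 | rfl | h1 | h1
    · rcases hd with hd | hd
      · exact absurd hd (hsp _ (src_mem_support hwp h1))
      · exact absurd hd (hsp _ (tgt_mem_support h1))
    · exact absurd hd (by simp [hex, hey])
    · rcases hd with hd | hd
      · exact absurd hd (hsp' _ (src_mem_support hwp' h1))
      · exact absurd hd (hsp' _ (tgt_mem_support h1))
    · exact h1
  set g := (K.next ^ q) h with hg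
  have hgf : K.SameFace h g := sameFace_pow h q
  have hgc : K.src g = c := rfl
  have hsc : site c = c := hK.site_self g hgf
  have hbsrc : ∀ d, site (K.src d) = c → d ∈ b → d = g := by
    intro d hd hdb
    exact hK.eq_of_site_eq (sameFace_of_mem_arc hdb) hgf (by rw [hd, hgc, hsc])
  have hbtgt : ∀ d, site (K.tgt d) = c → d ∈ b → K.next d = g := by
    intro d hd hdb
    exact hK.eq_of_site_eq (sameFace_of_mem_arc hdb).next hgf
      (by rw [hK.map.src_next, hd, hgc, hsc])
  have havoid : ∀ w, site w = c → w ≠ c → K.Avoids γ w := by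
    intro w hw hwc d hd
    constructor
    · rintro rfl
      exact hwc (by rw [hbsrc d hw (hmem d (.inl hw) hd), hgc])
    · rintro rfl
      have h1 := hbtgt d hw (hmem d (.inr hw) hd)
      exact hwc (by rw [← hK.map.src_next, h1, hgc])
  obtain ⟨w, hw, hwc⟩ := hK.path v
  rw [hv] at hw hwc
  rw [← pow_mem_arc_iff hi hq, ← hb, ← hg]
  constructor
  · intro hbox
    by_contra hgb
    -- The arc does not end at `c` either, since it ends at position `j ≠ q`. So `γ` avoids the
    -- whole cell.
    have hprev : ∀ d ∈ b, K.next d ≠ g := by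
      intro d hd hdg
      obtain ⟨t, ht, rfl⟩ := mem_arc.1 hd
      have h1 : (K.next ^ (i + (t + 1))) h = g := by
        rw [← hdg, ← add_assoc, pow_succ', Equiv.Perm.mul_apply]
      rcases Nat.lt_or_ge (t + 1) ((j + K.bsize h - i) % K.bsize h) with hlt | hge
      · exact hgb (mem_arc.2 ⟨t + 1, hlt, h1⟩)
      · have h2 : t + 1 = (j + K.bsize h - i) % K.bsize h := by omega
        rw [h2, ← next_pow_mod, Nat.add_mod_mod,
          show i + (j + K.bsize h - i) = j + K.bsize h by omega, Nat.add_mod_right,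
          next_pow_mod] at h1
        exact hqj (next_pow_inj hj hq h1).symm
    have havoid' : ∀ w, site w = c → K.Avoids γ w := by
      intro w hw d hd
      constructor
      · rintro rfl
        have h1 := hmem d (.inl hw) hd
        exact hgb (hbsrc d hw h1 ▸ h1)
      · rintro rfl
        have h1 := hmem d (.inr hw) hd
        exact hprev d h1 (hbtgt d hw h1)
    have hvb : v ∉ K.support (K.bpos h i) b := by
      intro h1
      simp only [support, List.mem_cons, List.mem_map] at h1
      rcases h1 with rfl | ⟨d, hd, rfl⟩
      · exact hci hv
      · exact hprev d hd (hbtgt d hv hd)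
    have hout : ∀ d, K.src d = v → ¬ K.Inside h γ d := by
      intro d hd hin
      obtain ⟨col, hcol, hd1⟩ := inside_iff.1 hin
      -- The colour is constant along a walk from `c` to `v` inside the cell, and at `c` the dart
      -- `g` has the colour of the outer face.
      have key : ∀ (w : List D) (u : V), K.IsWalk u w v → (∀ y ∈ K.support u w, site y = c) →
          ∀ d', K.src d' = u → col d' = col d := by
        intro w
        induction w with
        | nil =>
          intro u hu' hs d' hd'
          obtain rfl : u = v := hu'
          exact hK.map.coloring_eq_of_avoids hcol (havoid' u hv) hd' hd
        | cons a w ih =>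
          intro u hu' hs d' hd'
          have hu0 : site u = c := hs u (start_mem_support _ _)
          rw [hK.map.coloring_eq_of_avoids hcol (havoid' u hu0) hd' hu'.1,
            ← ih _ hu'.2 (fun y hy => hs y (by
              simp only [support, List.map_cons, List.mem_cons] at hy ⊢
              exact .inr hy)) (K.rev a) rfl, hcol.rev,
            hK.map.crossings_of_avoids (hu'.1.symm ▸ havoid' u hu0)]
          simp
      have h1 := key w c hw hwc g hgc
      rw [hcol.sameFace hgf, hcol.zero, hd1] at h1
      exact zero_ne_one h1
    rcases hbox with h1 | h1 | h1 | ⟨d, hd, hin⟩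
    · exact hvp h1
    · exact hvp' h1
    · exact hvb h1
    · exact hout d hd hin
  · intro hgb
    by_cases hvc : v = c
    · refine .inr (.inr (.inl ?_))
      rw [hvc, ← hgc]
      exact src_mem_support hwb hgb
    -- Modulo two the ends of `p`, `e`, `p'` and the arc cancel in pairs, although these walks are
    -- not all traversed in one direction.
    obtain ⟨col, hcol⟩ := hK.map.exists_coloring h γ (by
      intro x
      have h5 : (fun d => (K.crossings γ d : ZMod 2)) = fun d => (K.crossings p d : ZMod 2) +
          ((K.crossings [e] d : ZMod 2) + ((K.crossings p' d : ZMod 2) + (K.crossings b d : ZMod 2))) := by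
        ext d
        rw [hγ, crossings_append, crossings_cons, crossings_append]
        push_cast
        rfl
      rw [h5, starSum_add, starSum_add, starSum_add, starSum_crossings hK.map.rev_rev hwp,
        starSum_crossings hK.map.rev_rev hwp', starSum_crossings hK.map.rev_rev hwb,
        starSum_crossings (p := [e]) hK.map.rev_rev ⟨rfl, rfl⟩]
      grind)
    have hg0 : col g = 0 := by rw [hcol.sameFace hgf, hcol.zero]
    -- Only the arc uses the edge of `g`, and it does so once: the opposite dart is not on the outer
    -- face.
    have hgγ : K.crossings γ g = 1 := by
      have h1 : K.rev g ∉ γ := fun h2 => hK.not_sameFace_rev hgf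
        (sameFace_of_mem_arc (hmem _ (.inr (by rw [hK.map.tgt_rev, hgc, hsc])) h2))
      have hne : ∀ l : List D, (∀ d ∈ l, site (K.src d) ≠ c) → l.count g = 0 := fun l hl =>
        List.count_eq_zero_of_not_mem fun h2 => hl g h2 hsc
      have hcb : b.count g = 1 := List.count_eq_one_of_mem (arc_nodup h i j) hgb
      rw [crossings, List.count_eq_zero_of_not_mem h1, hγ, List.count_append, List.count_cons,
        List.count_append, hne p fun d hd => hsp _ (src_mem_support hwp hd),
        hne p' fun d hd => hsp' _ (src_mem_support hwp' hd), hcb]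
      have : e ≠ g := by rintro rfl; exact hex hsc
      simp [this]
    -- Turning around `c` from `g`, the first edge changes the colour from zero to one. The next
    -- edge of `γ` at `c` can only be the one by which the arc arrives, and behind it comes `g`
    -- again.
    have hcone : ∀ d, K.src d = c → d = g ∨ col d = 1 := by
      intro d hd
      obtain ⟨k, -, rfl⟩ := (hK.map.sameCycle g d (hgc.trans hd.symm)).exists_pow_eq'
      have hk : ∀ k, K.src ((K.rot ^ k) g) = c := by
        intro k
        induction k with
        | zero => exact hgc
        | succ k ih => rw [pow_succ', Equiv.Perm.mul_apply, hK.map.src_rot, ih]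
      clear hd
      induction k with
      | zero => exact .inl rfl
      | succ k ih =>
        rw [pow_succ', Equiv.Perm.mul_apply]
        by_cases hkg : (K.rot ^ k) g = g
        · right
          rw [hkg, hcol.rot, hg0, hgγ]
          simp
        · by_cases hkr : K.rev ((K.rot ^ k) g) ∈ γ
          · left
            have h1 : site (K.tgt (K.rev ((K.rot ^ k) g))) = c := by
              rw [hK.map.tgt_rev, hk, hsc]
            rw [rot_apply]
            exact hbtgt _ h1 (hmem _ (.inr h1) hkr)
          · right
            have h1 : (K.rot ^ k) g ∉ γ := fun h2 => hkg
              (hbsrc _ (by rw [hk, hsc]) (hmem _ (.inl (by rw [hk, hsc])) h2))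
            rw [hcol.rot, crossings_eq_zero h1 hkr, ih.resolve_left hkg]
            simp
    have hdg : ∀ d, site (K.src d) = c → site (K.tgt d) = c → d ∉ b := by
      intro d h1 h2 hdb
      exact hK.site_tgt_ne (sameFace_of_mem_arc hdb) (h1.trans h2.symm)
    -- Colour one is carried through the cell: by `hdg` no step inside it is an edge of `γ`, and the
    -- vertices other than `c` are avoided.
    have key : ∀ (w : List D) (u : V), K.IsWalk u w v → (∀ y ∈ K.support u w, site y = c) →
        (∀ d, K.src d = u → d = g ∨ col d = 1) → ∀ d, K.src d = v → d = g ∨ col d = 1 := by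
      intro w
      induction w with
      | nil =>
        intro u hu' hs hd
        obtain rfl : u = v := hu'
        exact hd
      | cons a w ih =>
        intro u hu' hs hd
        have hs' : ∀ y ∈ K.support (K.tgt a) w, site y = c := fun y hy => hs y (by
          simp only [support, List.map_cons, List.mem_cons] at hy ⊢
          exact .inr hy)
        have ha1 : site (K.src a) = c := hu'.1.symm ▸ hs u (start_mem_support _ _)
        have ha2 : site (K.tgt a) = c := hs' _ (start_mem_support _ _)
        refine ih _ hu'.2 hs' fun d hd' => ?_
        by_cases htc : K.tgt a = c
        · exact hcone d (hd'.trans htc)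
        right
        have hag : a ≠ g := by
          rintro rfl
          exact hK.site_tgt_ne hgf (ha1.trans ha2.symm)
        have h1 : a ∉ γ := fun h2 => hdg a ha1 ha2 (hmem a (.inl ha1) h2)
        have h2 : K.rev a ∉ γ := fun h2 => hdg (K.rev a) ha2 (by rwa [hK.map.tgt_rev])
          (hmem _ (.inl ha2) h2)
        rw [hK.map.coloring_eq_of_avoids hcol (havoid _ ha2 htc) hd' (show K.src (K.rev a) = _ from rfl),
          hcol.rev, crossings_eq_zero h1 h2, (hd a hu'.1).resolve_left hag]
        simp
    obtain ⟨d, hd⟩ := hK.map.src_surjective v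
    refine .inr (.inr (.inr ⟨d, hd, inside_iff.2 ⟨col, hcol, ?_⟩⟩))
    refine (key w c hw hwc hcone d hd).resolve_left ?_
    rintro rfl
    exact hvc (hd.symm.trans hgc)

end IsCells

end EmbeddedGraph
end

noncomputable section

namespace EmbeddedGraph

variable {V D : Type*} {K : EmbeddedGraph V D} {h : D} {site : V → V}

/-! ### Following the boundary of a cell -/

/-- The ends of the dart lie in different cells. -/
def Crossing (K : EmbeddedGraph V D) (site : V → V) (a : D) : Prop :=
  site (K.src a) ≠ site (K.tgt a)

theorem isVorVertex_next [Fintype D] (hK : K.IsDisc h) {a : D} :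
    K.IsVorVertex h site (K.next a) ↔ K.IsVorVertex h site a := by
  unfold IsVorVertex
  rw [sameFace_next_iff]
  by_cases ha : K.SameFace h a
  · simp [ha]
  · rw [hK.triangle a ha]
    tauto

theorem isVorVertex_prev [Fintype D] (hK : K.IsDisc h) {a : D} :
    K.IsVorVertex h site (K.next.symm a) ↔ K.IsVorVertex h site a := by
  rw [← isVorVertex_next hK, Equiv.apply_symm_apply]

theorem isVorVertex_congr [Fintype D] (hK : K.IsDisc h) {a b : D} (hab : K.SameFace a b) :
    K.IsVorVertex h site a ↔ K.IsVorVertex h site b := by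
  have := eq_of_sameCycle (f := K.IsVorVertex h site) (fun d => propext (isVorVertex_next hK)) hab
  exact (Eq.to_iff this).symm

theorem VorStep.not_isVorVertex {a b : D} (hab : K.VorStep h site a b) :
    ¬ K.IsVorVertex h site b := hab.2.2

namespace IsCells

variable [Fintype D] (hK : K.IsCells h site)
include hK

theorem crossing_rev {a : D} : K.Crossing site (K.rev a) ↔ K.Crossing site a := by
  rw [Crossing, Crossing, hK.map.tgt_rev]
  exact ne_comm

theorem crossing_of_sameFace {a : D} (ha : K.SameFace h a) : K.Crossing site a :=
  hK.site_tgt_ne ha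

theorem crossing_of_isVorVertex {a : D} (ha : K.IsVorVertex h site a) : K.Crossing site a := by
  rw [Crossing, ← hK.map.src_next]
  exact ha.2.1

theorem vorCross_eq_or (a : D) :
    (site (K.src (K.next.symm (K.rev a))) = site (K.tgt a) ∧
      K.vorCross site a = K.next (K.rev a)) ∨
    (site (K.src (K.next.symm (K.rev a))) ≠ site (K.tgt a) ∧
      K.vorCross site a = K.next.symm (K.rev a)) := by
  by_cases h1 : site (K.src (K.next.symm (K.rev a))) = site (K.tgt a)
  · exact .inl ⟨h1, if_pos h1⟩
  · exact .inr ⟨h1, if_neg h1⟩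

theorem vorCross_sameFace (a : D) : K.SameFace (K.rev a) (K.vorCross site a) := by
  have h0 : K.SameFace (K.rev a) (K.rev a) := Equiv.Perm.SameCycle.refl _ _
  rcases hK.vorCross_eq_or a with ⟨-, h1⟩ | ⟨-, h1⟩ <;> rw [h1]
  · exact h0.next
  · exact h0.prev

theorem sameFace_vorCross_iff {a : D} :
    K.SameFace h (K.vorCross site a) ↔ K.SameFace h (K.rev a) :=
  ⟨fun h1 => h1.trans (hK.vorCross_sameFace a).symm, fun h1 => h1.trans (hK.vorCross_sameFace a)⟩

/-- On the outer face, the boundary of a cell goes on with the preceding dart. -/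
theorem vorCross_of_sameFace {a : D} (ha : K.SameFace h (K.rev a)) :
    K.vorCross site a = K.next.symm (K.rev a) := by
  rcases hK.vorCross_eq_or a with ⟨h1, -⟩ | ⟨-, h2⟩
  · have h3 : K.next.symm (K.rev a) = K.rev a := hK.eq_of_site_eq ha.prev ha h1
    exact absurd (by rwa [Equiv.symm_apply_eq, eq_comm] at h3) (hK.next_ne ha)
  · exact h2

theorem tgt_vorCross_eq (a : D) (ha : K.SameFace h (K.rev a)) :
    K.tgt (K.vorCross site a) = K.tgt a := by
  rw [hK.vorCross_of_sameFace ha, hK.map.tgt_prev]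
  rfl

theorem site_tgt_vorCross (a : D) : site (K.tgt (K.vorCross site a)) = site (K.tgt a) := by
  rcases hK.vorCross_eq_or a with ⟨h1, h2⟩ | ⟨h1, h2⟩
  · by_cases hf : K.SameFace h (K.rev a)
    · rw [hK.tgt_vorCross_eq a hf]
    · rw [h2, ← hK.map.src_next, ← hK.prev_eq hf, h1]
  · rw [h2, hK.map.tgt_prev]
    rfl

theorem crossing_vorCross {a : D} (ha : K.Crossing site a) :
    K.Crossing site (K.vorCross site a) := by
  rw [Crossing, hK.site_tgt_vorCross]
  rcases hK.vorCross_eq_or a with ⟨h1, h2⟩ | ⟨h1, h2⟩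
  · rw [h2, hK.map.src_next, hK.map.tgt_rev]
    exact ha
  · rw [h2]
    exact h1

theorem site_src_vorCross {a : D} (ha : K.Crossing site a) (hf : ¬ K.SameFace h (K.rev a))
    (hv : ¬ K.IsVorVertex h site (K.vorCross site a)) :
    site (K.src (K.vorCross site a)) = site (K.src a) := by
  rcases hK.vorCross_eq_or a with ⟨h1, h2⟩ | ⟨h1, h2⟩
  · rw [h2, hK.map.src_next, hK.map.tgt_rev]
  · rw [h2] at hv ⊢
    by_contra hne
    refine hv ⟨fun h3 => hf (sameFace_prev_iff.1 h3), ?_, ?_, ?_⟩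
    · rw [Equiv.apply_symm_apply]
      exact h1
    · rw [Equiv.apply_symm_apply, hK.map.src_next, hK.map.tgt_rev]
      exact ha.symm
    · rw [Equiv.apply_symm_apply, hK.map.src_next, hK.map.tgt_rev]
      exact fun h3 => hne h3.symm

/-- The step along the boundary of a cell can be undone. Results of different branches cannot
coincide, since then the tail of one of the two darts would lie in the cell of its head. -/
theorem vorCross_injOn {a b : D} (ha : K.Crossing site a) (hb : K.Crossing site b)
    (hab : K.vorCross site a = K.vorCross site b) : a = b := by
  have key : ∀ a b, K.Crossing site a → K.Crossing site b →
      K.vorCross site a = K.vorCross site b →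
      site (K.src (K.next.symm (K.rev a))) = site (K.tgt a) →
      K.vorCross site a = K.next (K.rev a) →
      K.vorCross site b = K.next.symm (K.rev b) → False := by
    intro a b ha hb hab h1 h2 h4
    have hf : ¬ K.SameFace h (K.rev a) := fun hf => by
      have h3 := hK.vorCross_of_sameFace hf
      rw [h2] at h3
      exact hK.next_next_ne hf (by rw [h3, Equiv.apply_symm_apply])
    have h5 : K.rev b = K.next.symm (K.rev a) := by
      rw [hK.prev_eq hf, ← Equiv.symm_apply_eq, ← h4, ← hab, h2]
    have h6 := hK.site_tgt_vorCross a
    rw [hab, hK.site_tgt_vorCross] at h6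
    have h7 : site (K.src b) = site (K.tgt a) := by
      rw [← hK.map.tgt_rev, h5, hK.map.tgt_prev]
      rfl
    exact hb (h7.trans h6.symm)
  rcases hK.vorCross_eq_or a with ⟨h1, h2⟩ | ⟨h1, h2⟩ <;>
    rcases hK.vorCross_eq_or b with ⟨h3, h4⟩ | ⟨h3, h4⟩
  · exact K.rev.injective (K.next.injective (h2.symm.trans (hab.trans h4)))
  · exact (key a b ha hb hab h1 h2 h4).elim
  · exact (key b a hb ha hab.symm h3 h4 h2).elim
  · exact K.rev.injective (K.next.symm.injective (h2.symm.trans (hab.trans h4)))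

/-- In a triangle that meets two cells, the boundaries of both cells use the same two edges. -/
theorem vorCross_rev_vorCross {a : D} (ha : K.Crossing site a) (hf : ¬ K.SameFace h (K.rev a))
    (hv : ¬ K.IsVorVertex h site (K.vorCross site a)) :
    K.vorCross site (K.rev (K.vorCross site a)) = K.rev a := by
  have h3 := hK.site_src_vorCross ha hf hv
  rcases hK.vorCross_eq_or a with ⟨h1, h2⟩ | ⟨h1, h2⟩
  · rw [h2, vorCross, hK.map.rev_rev, if_neg, Equiv.symm_apply_apply]
    rw [Equiv.symm_apply_apply, hK.map.tgt_rev, hK.map.src_next, hK.map.tgt_rev]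
    exact ha.symm
  · rw [h2] at h3
    rw [h2, vorCross, hK.map.rev_rev, if_pos, Equiv.apply_symm_apply]
    rw [hK.prev_prev_eq hf, hK.map.tgt_rev, h3, hK.map.src_next, hK.map.tgt_rev]

theorem vorCross_rev_of_isVorVertex {a : D} (ha : K.IsVorVertex h site a) :
    K.vorCross site (K.rev a) = K.next.symm a := by
  rw [vorCross, hK.map.rev_rev, if_neg]
  rw [hK.prev_eq ha.1, hK.map.tgt_rev]
  exact ha.2.2.2

/-- The darts between different cells. -/
abbrev _root_.EmbeddedGraph.CrossingDart (K : EmbeddedGraph V D) (site : V → V) : Type _ :=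
  {a // K.Crossing site a}

/-- The permutation of the darts between different cells that follows the boundaries of the
cells. -/
def crossPerm : Equiv.Perm (K.CrossingDart site) :=
  Equiv.ofBijective (fun a => ⟨K.vorCross site a, hK.crossing_vorCross a.2⟩)
    (Finite.injective_iff_bijective.1 fun a b hab =>
      Subtype.ext (hK.vorCross_injOn a.2 b.2 (congrArg Subtype.val hab)))

theorem crossPerm_apply (a : K.CrossingDart site) :
    (hK.crossPerm a : D) = K.vorCross site a := rfl

theorem site_tgt_crossPerm_pow (a : K.CrossingDart site) (k : ℕ) :
    site (K.tgt ((hK.crossPerm ^ k) a : D)) = site (K.tgt a) := by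
  induction k with
  | zero => rfl
  | succ k ih => rw [pow_succ', Equiv.Perm.mul_apply, crossPerm_apply, hK.site_tgt_vorCross, ih]

/-- Along a path of degree-two vertices, both neighbouring cells remain the same. -/
theorem vorSteps_site {a e : D} (ha : K.Crossing site a)
    (hae : Relation.ReflTransGen (K.VorStep h site) a e) :
    K.Crossing site e ∧ site (K.tgt e) = site (K.tgt a) ∧ site (K.src e) = site (K.src a) := by
  induction hae with
  | refl => exact ⟨ha, rfl, rfl⟩
  | tail _ hst ih =>
    obtain ⟨h1, h2, h3⟩ := ih
    obtain ⟨hf, rfl, hv⟩ := hst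
    exact ⟨hK.crossing_vorCross h1, by rw [hK.site_tgt_vorCross, h2],
      by rw [hK.site_src_vorCross h1 hf hv, h3]⟩

/-- A path of degree-two vertices can be traced backwards, and the trace stops at the first triangle
that meets three cells. -/
theorem vorSteps_unique {a b e : D} (ha : K.IsVorVertex h site a) (hb : K.IsVorVertex h site b)
    (hae : Relation.ReflTransGen (K.VorStep h site) a e)
    (hbe : Relation.ReflTransGen (K.VorStep h site) b e) : a = b := by
  induction hae with
  | refl =>
    rcases Relation.ReflTransGen.cases_tail hbe with h1 | ⟨c, -, hc⟩
    · exact h1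
    · exact absurd ha hc.not_isVorVertex
  | tail hac hst ih =>
    rcases Relation.ReflTransGen.cases_tail hbe with h1 | ⟨c, hbc, hc⟩
    · subst h1
      exact absurd hb hst.not_isVorVertex
    · refine ih ?_
      have h1 := (hK.vorSteps_site (hK.crossing_of_isVorVertex ha) hac).1
      have h2 := (hK.vorSteps_site (hK.crossing_of_isVorVertex hb) hbc).1
      rw [hK.vorCross_injOn h1 h2 (hst.2.1.symm.trans hc.2.1)]
      exact hbc

/-- If the boundary of a cell arrives at the outer face, it does so at the dart that leaves the
site of the cell. -/
theorem rev_eq_of_sameFace {e g : D} (he : K.SameFace h (K.rev e)) (hg : K.SameFace h g)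
    (hs : site (K.tgt e) = site (K.src g)) : K.rev e = g :=
  hK.eq_of_site_eq he hg hs

/-- Every cell meets a triangle that meets three cells. -/
theorem exists_isVorVertex {e : D} (he : K.SameFace h e) :
    ∃ a, K.IsVorVertex h site a ∧ site (K.tgt a) = site (K.tgt e) := by
  let e' : K.CrossingDart site := ⟨e, hK.crossing_of_sameFace he⟩
  -- A full period leads back to `e`, which is on the outer face, so the search for the first event
  -- ends.
  have hex : ∃ k, 0 < k ∧ (K.IsVorVertex h site ((hK.crossPerm ^ k) e' : D) ∨
      K.SameFace h ((hK.crossPerm ^ k) e' : D)) :=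
    ⟨orderOf hK.crossPerm, orderOf_pos _, .inr (by rw [pow_orderOf_eq_one]; exact he)⟩
  obtain ⟨hk0, hk⟩ := Nat.find_spec hex
  have hmin : ∀ j, 0 < j → j < Nat.find hex → ¬ K.IsVorVertex h site ((hK.crossPerm ^ j) e' : D) ∧
      ¬ K.SameFace h ((hK.crossPerm ^ j) e' : D) := fun j h0 hj =>
    not_or.1 fun h1 => Nat.find_min hex hj ⟨h0, h1⟩
  generalize Nat.find hex = k at *
  rcases hk with hk | hk
  · exact ⟨_, hk, hK.site_tgt_crossPerm_pow e' k⟩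
  exfalso
  obtain ⟨m, rfl⟩ := Nat.exists_eq_succ_of_ne_zero hk0.ne'
  -- Without a triangle that meets three cells, the neighbouring cell never changes.
  have hsrc : ∀ j ≤ m, site (K.src ((hK.crossPerm ^ j) e' : D)) = site (K.src e) := by
    intro j
    induction j with
    | zero => intro _; rfl
    | succ j ih =>
      intro hj
      obtain ⟨h1, h2⟩ := hmin (j + 1) (by omega) (by omega)
      rw [pow_succ', Equiv.Perm.mul_apply, crossPerm_apply] at h1 h2 ⊢
      rw [hK.site_src_vorCross (Subtype.prop _) (fun h3 => h2 (hK.sameFace_vorCross_iff.2 h3)) h1,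
        ih (by omega)]
  set f := ((hK.crossPerm ^ m) e' : D) with hf
  rw [Nat.succ_eq_add_one, pow_succ', Equiv.Perm.mul_apply, crossPerm_apply,
    hK.sameFace_vorCross_iff] at hk
  -- The boundary of the cell returns to the outer face at the dart that leaves the site. The
  -- neighbouring cell there would be the one before the site as well as the one after it, but the
  -- outer cycle has at least three vertices.
  have h1 : K.rev f = K.next e := hK.rev_eq_of_sameFace hk he.next (by
    rw [hf, hK.site_tgt_crossPerm_pow, hK.map.src_next])
  have h2 : site (K.src f) = site (K.src (K.next (K.next e))) := by
    rw [hK.map.src_next, ← h1, hK.map.tgt_rev]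
  rw [hf, hsrc m le_rfl] at h2
  exact hK.next_next_ne he (hK.eq_of_site_eq he he.next.next h2).symm

/-! ### The position of the cell of a dart -/

theorem exists_pos (a : D) : ∃ i < K.bsize h, K.bpos h i = site (K.tgt a) := by
  obtain ⟨e, he, h1⟩ := hK.site_mem (K.tgt a)
  obtain ⟨i, hi, rfl⟩ := exists_pow_of_sameFace he
  exact ⟨i, hi, h1⟩

end IsCells

end EmbeddedGraph
end

noncomputable section

/-! ### Cyclic arrangements -/

/-- The elements of the list are met in this order on less than one full turn around a cycle of
length `n`, where `p x` is the position of `x`. -/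
def Arranged {D : Type*} (n : ℕ) (p : D → ℕ) (M : List D) : Prop :=
  ∃ t : D → ℕ, M.Pairwise (fun x y => t x ≤ t y) ∧ (∀ x ∈ M, t x % n = p x) ∧
    ∀ x ∈ M, ∀ y ∈ M, t x ≤ t y + n

namespace Arranged

variable {D : Type*} {n : ℕ} {p : D → ℕ} {L M : List D}

theorem sublist (h : Arranged n p L) (hs : M.Sublist L) : Arranged n p M := by
  obtain ⟨t, h1, h2, h3⟩ := h
  exact ⟨t, h1.sublist hs, fun x hx => h2 x (hs.subset hx),
    fun x hx y hy => h3 x (hs.subset hx) y (hs.subset hy)⟩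

/-- The first element is met again one full turn later. -/
theorem rotate_one {x : D} (hnd : (x :: M).Nodup) (h : Arranged n p (x :: M)) :
    Arranged n p (M ++ [x]) := by
  obtain ⟨t, h1, h2, h3⟩ := h
  obtain ⟨hx, hM⟩ := List.nodup_cons.1 hnd
  rw [List.pairwise_cons] at h1
  have hne : ∀ y ∈ M, y ≠ x := fun y hy h => hx (h ▸ hy)
  refine ⟨Function.update t x (t x + n), ?_, ?_, ?_⟩
  · rw [List.pairwise_append]
    refine ⟨?_, by simp, ?_⟩
    · refine h1.2.imp_of_mem fun {a b} ha hb hab => ?_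
      rwa [Function.update_of_ne (hne a ha), Function.update_of_ne (hne b hb)]
    · intro a ha b hb
      obtain rfl := List.mem_singleton.1 hb
      rw [Function.update_of_ne (hne a ha), Function.update_self]
      exact h3 a (by simp [ha]) b (by simp)
  · intro y hy
    by_cases hyx : y = x
    · rw [hyx, Function.update_self, Nat.add_mod_right]
      exact h2 x (by simp)
    · rw [Function.update_of_ne hyx]
      refine h2 y ?_
      simpa [hyx] using hy
  · have key : ∀ y ∈ M, t x ≤ t y := h1.1
    intro y hy z hz
    by_cases hyx : y = x <;> by_cases hzx : z = x
    · subst hyx hzx; omega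
    · subst hyx
      have hz' : z ∈ M := by simpa [hzx] using hz
      rw [Function.update_self, Function.update_of_ne hzx]
      have := key z hz'
      omega
    · subst hzx
      have hy' : y ∈ M := by simpa [hyx] using hy
      rw [Function.update_self, Function.update_of_ne hyx]
      have := h3 y (by simp [hy']) z (by simp)
      omega
    · have hy' : y ∈ M := by simpa [hyx] using hy
      have hz' : z ∈ M := by simpa [hzx] using hz
      rw [Function.update_of_ne hyx, Function.update_of_ne hzx]
      exact h3 y (by simp [hy']) z (by simp [hz'])

theorem isRotated (hnd : L.Nodup) (h : Arranged n p L) (hr : L.IsRotated M) : Arranged n p M := by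
  obtain ⟨k, rfl⟩ := hr
  induction k with
  | zero => simpa using h
  | succ k ih =>
    have hk : (L.rotate k).Nodup := List.nodup_rotate.2 hnd
    rw [← List.rotate_rotate]
    generalize L.rotate k = N at *
    cases N with
    | nil => simpa using ih
    | cons x N => simpa using ih.rotate_one hk

/-- In a cyclic arrangement, positions after `a` are measured by the elapsed distance. -/
theorem sub_mod_le {a b : D} {A : List D} (h : Arranged n p (a :: A ++ [b])) {x : D} (hx : x ∈ A)
    (hn : 0 < n) (hab : p a ≠ p b) :
    (p x + n - p a) % n ≤ (p b + n - p a) % n := by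
  obtain ⟨t, h1, h2, h3⟩ := h
  have hxa : t a ≤ t x := by
    rw [List.cons_append, List.pairwise_cons] at h1
    exact h1.1 x (by simp [hx])
  have hxb : t x ≤ t b := (List.pairwise_append.1 h1).2.2 x (by simp [hx]) b (by simp)
  have hba : t b ≤ t a + n := h3 b (by simp) a (by simp)
  have key : ∀ y, t a ≤ t y → t y % n = p y → (p y + n - p a) % n = (t y - t a) % n := by
    intro y hy hpy
    have hpa : t a % n = p a := h2 a (by simp)
    have hlt : p a < n := hpa ▸ Nat.mod_lt _ hn
    have e1 : (p y + n - p a) + p a ≡ (t y - t a) + t a [MOD n] := by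
      rw [show p y + n - p a + p a = p y + n by omega, Nat.sub_add_cancel hy]
      unfold Nat.ModEq
      rw [Nat.add_mod_right, ← hpy, Nat.mod_mod]
    have e2 : p a ≡ t a [MOD n] := by
      unfold Nat.ModEq
      rw [← hpa, Nat.mod_mod]
    exact Nat.ModEq.add_right_cancel e2 e1
  rw [key x hxa (h2 x (by simp [hx])), key b (by omega) (h2 b (by simp))]
  have hne : t b ≠ t a + n := by
    intro h4
    apply hab
    rw [← h2 a (by simp), ← h2 b (by simp), h4, Nat.add_mod_right]
  rw [Nat.mod_eq_of_lt (show t b - t a < n by omega)]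
  exact (Nat.mod_le _ _).trans (by omega)

end Arranged

namespace EmbeddedGraph

variable {V D : Type*} {K : EmbeddedGraph V D} {h : D} {site : V → V}

namespace IsCells

variable [Fintype D] (hK : K.IsCells h site)
include hK

/-- The position of the site of the cell of the head of a dart. -/
def pos (a : D) : ℕ := (hK.exists_pos a).choose

theorem pos_lt (a : D) : hK.pos a < K.bsize h := (hK.exists_pos a).choose_spec.1

theorem bpos_pos (a : D) : K.bpos h (hK.pos a) = site (K.tgt a) := (hK.exists_pos a).choose_spec.2

theorem pos_eq {a : D} {k : ℕ} (hk : K.bpos h k = site (K.tgt a)) :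
    hK.pos a = k % K.bsize h := by
  refine hK.bpos_inj (hK.pos_lt a) (Nat.mod_lt _ (K.bsize_pos h)) ?_
  rw [hK.bpos_pos, bpos_mod, hk]

/-- The position advances by one exactly when the Voronoi edge from `a` ends in the hole. The dart
reached there is determined by the position, which limits the number of advances. -/
theorem spokeNext_pos {a b : D} (ha : K.IsVorVertex h site a) (hab : K.SpokeNext h site a b) :
    ∃ i, (i = 0 ∨ i = 1) ∧ hK.pos b = (hK.pos a + i) % K.bsize h ∧
      (i = 1 → ∃ e, Relation.ReflTransGen (K.VorStep h site) a e ∧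
        K.rev e = (K.next ^ hK.pos a) h) := by
  obtain ⟨e, hae, ⟨hf, rfl⟩ | ⟨hf, hv, rfl⟩⟩ := hab
  · obtain ⟨h1, h2, h3⟩ := hK.vorSteps_site (hK.crossing_of_isVorVertex ha) hae
    have h4 : K.rev e = (K.next ^ hK.pos a) h := by
      refine hK.rev_eq_of_sameFace hf (sameFace_pow h _) ?_
      rw [h2]
      show _ = site (K.bpos h (hK.pos a))
      rw [hK.bpos_pos, hK.site_site]
    refine ⟨1, .inr rfl, hK.pos_eq ?_, fun _ => ⟨e, hae, h4⟩⟩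
    rw [hK.map.tgt_prev, ← h3, ← hK.map.tgt_rev, ← hK.map.src_next, hK.site_self _ hf.next, h4,
      bpos, add_comm, pow_add, Equiv.Perm.mul_apply, pow_one]
  · obtain ⟨h1, h2, h3⟩ := hK.vorSteps_site (hK.crossing_of_isVorVertex ha) hae
    refine ⟨0, .inl rfl, ?_, by simp⟩
    rw [add_zero]
    exact hK.pos_eq (by rw [hK.bpos_pos, hK.site_tgt_vorCross, h2])

/-- The times are the partial sums of the advances. No position is left twice, because each dart of
the hole ends the Voronoi edge of at most one corner; so the whole list makes at most one turn. -/
theorem arranged {L : List D} (hL : K.IsTriVor h site L) : Arranged (K.bsize h) hK.pos L := by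
  rcases Nat.eq_zero_or_pos L.length with hm | hm
  · obtain rfl := List.length_eq_zero_iff.1 hm
    exact ⟨fun _ => 0, by simp⟩
  let a : ℕ → D := fun k => L[k % L.length]'(Nat.mod_lt _ hm)
  have haL : ∀ k, K.IsVorVertex h site (a k) := fun k => (hL.mem_iff _).1 (List.getElem_mem _)
  have hnext : ∀ k, K.SpokeNext h site (a k) (a (k + 1)) := by
    intro k
    have h1 := hL.next (k % L.length) (Nat.mod_lt _ hm)
    simp only [Nat.mod_add_mod] at h1
    exact h1
  choose inc hinc hpos hcross using fun k => hK.spokeNext_pos (haL k) (hnext k)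
  let T : ℕ → ℕ := fun k => hK.pos (a 0) + ∑ j ∈ Finset.range k, inc j
  have hT : ∀ k, T k % K.bsize h = hK.pos (a k) := by
    intro k
    induction k with
    | zero => simp [T, Nat.mod_eq_of_lt (hK.pos_lt _)]
    | succ k ih =>
      rw [hpos, ← ih, Nat.mod_add_mod]
      simp only [T, Finset.sum_range_succ, add_assoc]
  have hmono : ∀ i j, i ≤ j → T i ≤ T j := fun i j hij =>
    Nat.add_le_add_left (Finset.sum_le_sum_of_subset (Finset.range_mono hij)) _
  have hinj : ∀ i j, i < L.length → j < L.length → a i = a j → i = j := by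
    intro i j hi hj hij
    simp only [a, Nat.mod_eq_of_lt hi, Nat.mod_eq_of_lt hj] at hij
    exact (List.Nodup.getElem_inj_iff hL.nodup).1 hij
  -- The indices of the advances inject into the positions, by `vorSteps_unique`.
  have htotal : ∑ j ∈ Finset.range L.length, inc j ≤ K.bsize h := by
    have h1 : ∀ j, inc j = if inc j = 1 then 1 else 0 := by
      intro j
      rcases hinc j with h1 | h1 <;> simp [h1]
    rw [Finset.sum_congr rfl fun j _ => h1 j, Finset.sum_boole]
    have h2 : (Finset.filter (fun j => inc j = 1) (Finset.range L.length)).card ≤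
        (Finset.range (K.bsize h)).card := by
      refine Finset.card_le_card_of_injOn (fun j => hK.pos (a j)) ?_ ?_
      · intro j _
        exact Finset.mem_coe.2 (Finset.mem_range.2 (hK.pos_lt _))
      · intro i hi j hj hij
        simp only [Finset.coe_filter, Finset.mem_range, Set.mem_ofPred_eq] at hi hj
        obtain ⟨e, he1, he2⟩ := hcross i hi.2
        obtain ⟨f, hf1, hf2⟩ := hcross j hj.2
        simp only at hij
        rw [hij, ← hf2] at he2
        rw [K.rev.injective he2] at he1
        exact hinj i j hi.1 hj.1 (hK.vorSteps_unique (haL i) (haL j) he1 hf1)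
    simpa using h2
  have hidx : ∀ k (hk : k < L.length), L.idxOf L[k] = k := fun k hk =>
    List.Nodup.idxOf_getElem hL.nodup k hk
  refine ⟨fun x => T (L.idxOf x), ?_, ?_, ?_⟩
  · rw [List.pairwise_iff_getElem]
    intro i j hi hj hij
    show T (L.idxOf L[i]) ≤ T (L.idxOf L[j])
    rw [hidx i hi, hidx j hj]
    exact hmono _ _ hij.le
  · intro x hx
    obtain ⟨k, hk, rfl⟩ := List.getElem_of_mem hx
    show T (L.idxOf L[k]) % _ = _
    rw [hidx k hk, hT]
    simp only [a, Nat.mod_eq_of_lt hk]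
  · intro x hx y hy
    have h1 : T (L.idxOf x) ≤ T L.length := hmono _ _ (List.idxOf_lt_length_iff.2 hx).le
    have h2 : T 0 ≤ T (L.idxOf y) := hmono _ _ (Nat.zero_le _)
    simp only [T, Finset.range_zero, Finset.sum_empty, add_zero] at h1 h2 ⊢
    omega

/-- Binary search finds the cell of `v`. -/
theorem search_spec (hu : K.UniqueShortestPaths)
    (hclosed : ∀ z, ∀ y ∈ K.support (site z) (K.sp (site z) z), site y = site z)
    {S : Type*} {name : V → S} {code : Code} {mem : D → List ℕ} {w : ℕ} {v : V}
    (hmem : ∀ e, ∀ i < K.bsize h, ∀ j < K.bsize h, i ≠ j →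
      (K.support (K.bpos h i) (K.sp (K.bpos h i) (K.src e))).Disjoint
        (K.support (K.bpos h j) (K.sp (K.bpos h j) (K.tgt e))) →
      ((code.run (mem e) ![w, i, j]).val ≠ 0 ↔ v ∈ K.box h i j e))
    {L : List D} {t : SepTree D S} (hd : K.Decomposes h site name L t) (hL : L.Nodup)
    (ha : Arranged (K.bsize h) hK.pos L) (hvor : ∀ a ∈ L, K.IsVorVertex h site a)
    (hv : ∃ a ∈ L, site (K.tgt a) = site v) :
    name (site v) ∈ (Oracle.search code mem w t).val := by
  induction hd with
  | leaf L hL6 =>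
    obtain ⟨a, haL, h1⟩ := hv
    show name (site v) ∈ L.map _
    rw [List.mem_map]
    exact ⟨a, haL, by rw [h1]⟩
  | node L a b A B e i j l r hL6 hrot same _ _ edge pos_i pos_j _ _ ihl ihr =>
    have hnd : (a :: A ++ b :: B).Nodup := hrot.nodup_iff.1 hL
    have hL' : ∀ x, x ∈ L ↔ x ∈ a :: A ++ b :: B := fun x => hrot.mem_iff
    have hrot2 : (a :: A ++ b :: B).IsRotated (b :: B ++ a :: A) := by
      have := List.isRotated_append (l := a :: A) (l' := b :: B)
      simpa using this
    have hs1 : (a :: A ++ [b]).Sublist (a :: A ++ b :: B) :=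
      (List.Sublist.refl _).append (by simp)
    have hs2 : (b :: B ++ [a]).Sublist (b :: B ++ a :: A) :=
      (List.Sublist.refl _).append (by simp)
    have hnd2 : (b :: B ++ a :: A).Nodup := hrot2.nodup_iff.1 hnd
    have har : Arranged (K.bsize h) hK.pos (a :: A ++ b :: B) := ha.isRotated hL hrot
    have har1 := har.sublist hs1
    have har2 := (har.isRotated hnd hrot2).sublist hs2
    have hva := hvor a ((hL' a).2 (by simp))
    have hvb := hvor b ((hL' b).2 (by simp))
    have hpi : hK.pos a = i := by
      rw [hK.pos_eq pos_i.2, Nat.mod_eq_of_lt pos_i.1]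
    have hpj : hK.pos b = j := by
      rw [hK.pos_eq pos_j.2, Nat.mod_eq_of_lt pos_j.1]
    -- `a` and `b` are different corners of one triangle, which meets three cells.
    have hne : site (K.tgt a) ≠ site (K.tgt b) := by
      have hab : a ≠ b := by
        rintro rfl
        simp at hnd
      have hab' : b = K.next a ∨ b = K.next (K.next a) := by
        obtain ⟨k, -, rfl⟩ := Equiv.Perm.SameCycle.exists_pow_eq' same
        have h3 : (K.next ^ 3) a = a := hK.triangle a hva.1
        have h4 : ∀ q, (K.next ^ (3 * q)) a = a := by
          intro q
          induction q with
          | zero => simp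
          | succ q ihq => rw [mul_add, mul_one, pow_add, Equiv.Perm.mul_apply, h3, ihq]
        rw [← Nat.mod_add_div k 3, pow_add, Equiv.Perm.mul_apply, h4] at hab ⊢
        have : k % 3 < 3 := Nat.mod_lt _ (by norm_num)
        interval_cases hk : k % 3
        · simp at hab
        · exact .inl rfl
        · exact .inr rfl
      rw [← hK.map.src_next, ← hK.map.src_next]
      rcases hab' with rfl | rfl
      · exact hva.2.2.1
      · rw [hK.triangle a hva.1]
        exact hva.2.1.symm
    have hij : i ≠ j := by
      rintro rfl
      exact hne (pos_i.2.symm.trans pos_j.2)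
    -- Both tree paths stay in their own cells; this is the disjointness under which the program is
    -- known to be correct.
    have hdisj : (K.support (K.bpos h i) (K.sp (K.bpos h i) (K.src e))).Disjoint
        (K.support (K.bpos h j) (K.sp (K.bpos h j) (K.tgt e))) := by
      intro x hx1 hx2
      rw [pos_i.2, ← edge.1] at hx1
      rw [pos_j.2, ← edge.2.1] at hx2
      have h1 := (hclosed _ x hx1).symm.trans (hclosed _ x hx2)
      rw [edge.1, edge.2.1] at h1
      exact hne h1
    have hval : (Oracle.search code mem w (.node e i j l r)).val =
        if (code.run (mem e) ![w, i, j]).val ≠ 0 then (Oracle.search code mem w l).val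
        else (Oracle.search code mem w r).val := by
      by_cases h0 : (code.run (mem e) ![w, i, j]).val = 0
      · simp [Oracle.search, Timed.andThen, Timed.step, h0]
      · simp [Oracle.search, Timed.andThen, Timed.step, h0]
    have hl := ihl (hnd.sublist hs1) har1 (fun x hx => hvor x ((hL' x).2 (hs1.subset hx)))
    have hr := ihr (hnd2.sublist hs2) har2
      (fun x hx => hvor x ((hL' x).2 (hrot2.mem_iff.2 (hs2.subset hx))))
    rw [hval]
    -- The cells of `a` and `b` occur in both parts, so the answer of the program is irrelevant for
    -- them.
    by_cases hca : site (K.tgt a) = site v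
    · split_ifs
      · exact hl ⟨a, by simp, hca⟩
      · exact hr ⟨a, by simp, hca⟩
    by_cases hcb : site (K.tgt b) = site v
    · split_ifs
      · exact hl ⟨b, by simp, hcb⟩
      · exact hr ⟨b, by simp, hcb⟩
    obtain ⟨s, hs, hsv⟩ := hv
    have hs' : s ∈ A ∨ s ∈ B := by
      have := (hL' s).1 hs
      simp only [List.cons_append, List.mem_cons, List.mem_append] at this
      rcases this with rfl | h1 | rfl | h1
      · exact absurd hsv hca
      · exact .inl h1
      · exact absurd hsv hcb
      · exact .inr h1
    have hqi : hK.pos s ≠ i := by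
      intro h1
      have h2 := hK.bpos_pos s
      rw [h1, pos_i.2, hsv] at h2
      exact hca h2
    have hqj : hK.pos s ≠ j := by
      intro h1
      have h2 := hK.bpos_pos s
      rw [h1, pos_j.2, hsv] at h2
      exact hcb h2
    have hbox := hK.mem_box_iff hu hclosed (e := e) (v := v) pos_i.1 pos_j.1 (hK.pos_lt s)
      (by rw [pos_i.2, edge.1]) (by rw [pos_j.2, edge.2.1])
      (by rw [hK.bpos_pos, hsv]) hqi hqj
    rw [← hmem e i pos_i.1 j pos_j.1 hij hdisj] at hbox
    have hn := K.bsize_pos h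
    -- A position other than `y` and `z` is not on the arc from `y` to `z` and on that from `z` to
    -- `y`.
    have hmod : ∀ x y z : ℕ, x < K.bsize h → y < K.bsize h → z < K.bsize h → y ≠ z → x ≠ z → x ≠ y →
        (x + K.bsize h - y) % K.bsize h ≤ (z + K.bsize h - y) % K.bsize h →
        (x + K.bsize h - z) % K.bsize h ≤ (y + K.bsize h - z) % K.bsize h → False := by
      intro x y z hx hy hz hyz hxz hxy h1 h2
      have key : ∀ x y, x < K.bsize h → y < K.bsize h → (x + K.bsize h - y) % K.bsize h =
          if y ≤ x then x - y else x + K.bsize h - y := by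
        intro x y hx hy
        split_ifs with hle
        · rw [show x + K.bsize h - y = (x - y) + K.bsize h by omega, Nat.add_mod_right,
            Nat.mod_eq_of_lt (by omega)]
        · exact Nat.mod_eq_of_lt (by omega)
      rw [key x y hx hy, key z y hz hy] at h1
      rw [key x z hx hz, key y z hy hz] at h2
      split_ifs at h1 h2 <;> omega
    have hji : hK.pos a ≠ hK.pos b := by rw [hpi, hpj]; exact hij
    rcases hs' with hsA | hsB
    · have h1 := har1.sub_mod_le hsA hn hji
      rw [hpi, hpj] at h1
      rw [if_pos]
      · exact hl ⟨s, by simp [hsA], hsv⟩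
      · rw [hbox]
        refine lt_of_le_of_ne h1 fun h2 => hqj ?_
        by_contra
        have key : ∀ x, x < K.bsize h → (x + K.bsize h - i) % K.bsize h =
            if i ≤ x then x - i else x + K.bsize h - i := by
          intro x hx
          have := pos_i.1
          split_ifs with hle
          · rw [show x + K.bsize h - i = (x - i) + K.bsize h by omega, Nat.add_mod_right,
              Nat.mod_eq_of_lt (by omega)]
          · exact Nat.mod_eq_of_lt (by omega)
        rw [key _ (hK.pos_lt s), key _ pos_j.1] at h2
        have h3 := hK.pos_lt s
        have h4 := pos_j.1
        have h5 := pos_i.1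
        split_ifs at h2 <;> omega
    · have h1 := har2.sub_mod_le hsB hn hji.symm
      rw [hpi, hpj] at h1
      rw [if_neg]
      · exact hr ⟨s, by simp [hsB], hsv⟩
      · rw [hbox]
        intro h2
        exact hmod _ i j (hK.pos_lt s) pos_i.1 pos_j.1 hij hqj hqi h2.le h1

omit hK in
theorem search_leaf {S : Type*} {name : V → S} (code : Code) (mem : D → List ℕ) (w : ℕ)
    {L : List D} {t : SepTree D S} (hd : K.Decomposes h site name L t) :
    (Oracle.search code mem w t).val.length ≤ 6 ∧
      ∀ s ∈ (Oracle.search code mem w t).val, ∃ a, s = name (site (K.tgt a)) := by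
  induction hd with
  | leaf L hL6 =>
    refine ⟨?_, ?_⟩
    · show (L.map _).length ≤ 6
      simpa using hL6
    · intro s hs
      obtain ⟨a, -, rfl⟩ := List.mem_map.1 (show s ∈ L.map _ from hs)
      exact ⟨a, rfl⟩
  | node L a b A B e i j l r _ _ _ _ _ _ _ _ _ _ ihl ihr =>
    have hval : (Oracle.search code mem w (.node e i j l r)).val =
        if (code.run (mem e) ![w, i, j]).val ≠ 0 then (Oracle.search code mem w l).val
        else (Oracle.search code mem w r).val := by
      by_cases h0 : (code.run (mem e) ![w, i, j]).val = 0
      · simp [Oracle.search, Timed.andThen, Timed.step, h0]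
      · simp [Oracle.search, Timed.andThen, Timed.step, h0]
    rw [hval]
    split_ifs
    · exact ihl
    · exact ihr

end IsCells

/-! ### Running times -/

/-- An upper bound on the running time of a loop-free program. -/
def _root_.Code.timeBound : Code → ℕ
  | .arg _ => 1
  | .const _ => 1
  | .load a => a.timeBound + 1
  | .add a b => a.timeBound + (b.timeBound + 1)
  | .mul a b => a.timeBound + (b.timeBound + 1)
  | .ifLe a b c d => a.timeBound + (b.timeBound + (1 + (c.timeBound + d.timeBound)))

theorem _root_.Code.time_le (mem : List ℕ) (x : Fin 3 → ℕ) (c : Code) :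
    (c.run mem x).time ≤ c.timeBound := by
  induction c with
  | arg k => exact le_rfl
  | const n => exact le_rfl
  | load a iha => exact Nat.add_le_add_right iha 1
  | add a b iha ihb => exact Nat.add_le_add iha (Nat.add_le_add_right ihb 1)
  | mul a b iha ihb => exact Nat.add_le_add iha (Nat.add_le_add_right ihb 1)
  | ifLe a b c d iha ihb ihc ihd =>
    refine Nat.add_le_add iha (Nat.add_le_add ihb (Nat.add_le_add le_rfl ?_))
    by_cases hle : (a.run mem x).val ≤ (b.run mem x).val
    · simpa [Timed.step, hle] using ihc.trans (Nat.le_add_right _ _)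
    · simpa [Timed.step, hle] using ihd.trans (Nat.le_add_left _ _)

/-- A part has at most `2L/3 + 1` of the `L` faces, so `L - 3` shrinks by the factor `2/3`. The
hypothesis reads `L ≤ 3 + 3 (3/2) ^ k`, and for `k = 0` only a leaf is possible. Apart from the
program, a node costs the look-up of a memory and a comparison. -/
theorem search_time {S : Type*} {name : V → S} (code : Code) (mem : D → List ℕ) (w : ℕ)
    {L : List D} {t : SepTree D S} (hd : K.Decomposes h site name L t) (k : ℕ)
    (hk : L.length * 2 ^ k ≤ 3 * 2 ^ k + 3 * 3 ^ k) :
    (Oracle.search code mem w t).time ≤ (code.timeBound + 2) * k + 1 := by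
  induction hd generalizing k with
  | leaf L hL6 => exact Nat.le_add_left _ _
  | node L a b A B e i j l r hL6 _ _ hbl hbr _ _ _ _ _ ihl ihr =>
    obtain _ | k := k
    · simp only [pow_zero] at hk
      omega
    have h2 : (2 : ℕ) ^ (k + 1) = 2 * 2 ^ k := by ring
    have h3 : (3 : ℕ) ^ (k + 1) = 3 * 3 ^ k := by ring
    rw [h2, h3] at hk
    have hsz : ∀ m, 3 * (m + 1) ≤ 2 * L.length → (m + 2) * 2 ^ k ≤ 3 * 2 ^ k + 3 * 3 ^ k := by
      intro m hm
      have := Nat.mul_le_mul_right (2 ^ k) hm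
      nlinarith
    have hl := ihl k (by simpa using hsz A.length hbl.2)
    have hr := ihr k (by simpa using hsz B.length hbr.2)
    have hc := Code.time_le (mem e) ![w, i, j] code
    have h1 : (Oracle.search code mem w (.node e i j l r)).time =
        1 + ((code.run (mem e) ![w, i, j]).time + (1 +
          if (code.run (mem e) ![w, i, j]).val ≠ 0 then (Oracle.search code mem w l).time
          else (Oracle.search code mem w r).time)) := by
      by_cases h0 : (code.run (mem e) ![w, i, j]).val = 0
      · simp [Oracle.search, Timed.andThen, Timed.step, h0]
      · simp [Oracle.search, Timed.andThen, Timed.step, h0]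
    rw [h1]
    have : (code.timeBound + 2) * (k + 1) = (code.timeBound + 2) * k + (code.timeBound + 2) := by ring
    split_ifs <;> omega

end EmbeddedGraph
end

noncomputable section

/-! ### Cyclic chains -/

/-- Cyclically consecutive elements of the list are related. -/
def CycChain {D : Type*} (R : D → D → Prop) (L : List D) : Prop :=
  ∃ a l, L.IsRotated (a :: l) ∧ (a :: l ++ [a]).IsChain R

namespace CycChain

variable {D : Type*} {R : D → D → Prop} {L M : List D}

theorem isRotated (h : CycChain R L) (hr : L.IsRotated M) : CycChain R M := by
  obtain ⟨a, l, h1, h2⟩ := h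
  exact ⟨a, l, hr.symm.trans h1, h2⟩

theorem isChain {a : D} {l : List D} (h : CycChain R (a :: l)) : (a :: l ++ [a]).IsChain R := by
  obtain ⟨b, m, h1, h2⟩ := h
  obtain ⟨k, hk⟩ := h1.symm
  induction k generalizing b m with
  | zero =>
    obtain ⟨rfl, rfl⟩ := List.cons.inj (by simpa using hk)
    exact h2
  | succ k ih =>
    cases m with
    | nil =>
      obtain ⟨rfl, rfl⟩ := List.cons.inj (by simpa using hk)
      exact h2
    | cons c m =>
      rw [List.rotate_cons_succ] at hk
      refine ih c (m ++ [b]) (h1.trans ?_) ?_ hk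
      · exact ⟨1, by simp⟩
      · simp only [List.cons_append, List.isChain_cons_cons] at h2
        have h3 : (c :: (m ++ [b]) ++ [c]) = (c :: m) ++ b :: [c] := by simp
        rw [h3, List.isChain_split]
        exact ⟨h2.2, by simpa using h2.1⟩

theorem getElem (h : CycChain R L) (k : ℕ) (hk : k < L.length) :
    R L[k] (L[(k + 1) % L.length]'(Nat.mod_lt _ (by omega))) := by
  cases L with
  | nil => simp at hk
  | cons a l =>
    have h1 := h.isChain
    rw [List.isChain_iff_getElem] at h1
    have h2 := h1 k (by simpa using hk)
    rcases Nat.lt_or_ge (k + 1) (a :: l).length with hlt | hge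
    · simp only [Nat.mod_eq_of_lt hlt]
      rwa [List.getElem_append_left hk, List.getElem_append_left hlt] at h2
    · have hk1 : k + 1 = (a :: l).length := by omega
      simp only [hk1, Nat.mod_self, List.getElem_cons_zero]
      rw [List.getElem_append_left hk, List.getElem_append_right hge] at h2
      simpa using h2

end CycChain

theorem List.IsChain.change {D : Type*} {R R' : D → D → Prop} {l : List D} {c : D}
    (h : (l ++ [c]).IsChain R) (hR : ∀ a ∈ l, ∀ b ∈ l ++ [c], R a b → R' a b) :
    (l ++ [c]).IsChain R' := by
  rw [List.isChain_iff_getElem] at h ⊢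
  intro i hi
  have hi' : i < l.length := by simpa using hi
  have h1 := h i hi
  rw [List.getElem_append_left hi'] at h1 ⊢
  exact hR _ (List.getElem_mem _) _ (List.getElem_mem _) h1

/-! ### Nested lists -/

/-- A list that is composed of nested groups of two or three related elements. -/
inductive Fan {D : Type*} (r : D → D → Prop) (p : D → Prop) : List D → Prop
  | nil : Fan r p []
  | two (a b : D) (M : List D) (hab : r a b) (fresh : ∀ m ∈ M, ¬ r a m) (hM : Fan r p M) :
      Fan r p (a :: (M ++ [b]))
  | three (a t b : D) (M N : List D) (hp : p a) (hat : r a t) (hab : r a b)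
      (fresh : ∀ m ∈ M ++ N, ¬ r a m) (hM : Fan r p M) (hN : Fan r p N) :
      Fan r p (a :: (M ++ t :: (N ++ [b])))

namespace Fan

variable {D : Type*} {r : D → D → Prop} {p : D → Prop}

/-- The closing element `b` is not in the pair: its predecessor would be a fresh element related to
`a`. -/
theorem insert_last {a b : D} (hr : Equivalence r) {M : List D} (hab : r a b)
    (fresh : ∀ m ∈ M, ¬ r a m) {X Y : List D} {y y' : D} (h : M ++ [b] = X ++ y :: y' :: Y)
    (hyy : r y y') : ∃ Y', Y = Y' ++ [b] ∧ M = X ++ y :: y' :: Y' := by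
  rcases List.eq_nil_or_concat' Y with rfl | ⟨Y', b', rfl⟩
  · have h1 : M ++ [b] = (X ++ [y]) ++ [y'] := by simpa using h
    obtain ⟨rfl, h2⟩ := List.append_inj' h1 rfl
    obtain rfl : b = y' := by simpa using h2
    exact absurd (hr.trans hab (hr.symm hyy)) (fresh y (by simp))
  · have h1 : M ++ [b] = (X ++ y :: y' :: Y') ++ [b'] := by simpa using h
    obtain ⟨rfl, h2⟩ := List.append_inj' h1 rfl
    obtain rfl : b = b' := by simpa using h2
    exact ⟨Y', rfl, rfl⟩

/-- A nested list can be inserted between two adjacent related elements. -/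
theorem insert (hr : Equivalence r) {F N : List D} (hF : Fan r p F) (hN : Fan r p N)
    (hfresh : ∀ x ∈ F, ∀ n ∈ N, ¬ r x n) {X Y : List D} {y y' : D} (h : F = X ++ y :: y' :: Y)
    (hyy : r y y') : Fan r p (X ++ y :: (N ++ y' :: Y)) := by
  induction hF generalizing X y y' Y with
  | nil => simp at h
  | two a b M hab fresh hM ih =>
    -- If the pair starts with the opening element, freshness leaves nothing between it and the next
    -- member of its group, and the inserted list fills this gap.
    cases X with
    | nil =>
      obtain ⟨rfl, h1⟩ := List.cons.inj h
      cases M with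
      | nil =>
        obtain ⟨rfl, rfl⟩ : b = y' ∧ [] = Y := by simpa using h1
        exact .two a b N hab (hfresh a (by simp)) hN
      | cons m M =>
        obtain ⟨rfl, h2⟩ := List.cons.inj h1
        exact absurd hyy (fresh m (by simp))
    | cons x X =>
      obtain ⟨rfl, h1⟩ := List.cons.inj h
      obtain ⟨Y', rfl, rfl⟩ := insert_last hr hab fresh h1 hyy
      have h2 := ih (fun x hx => hfresh x (by simp only [List.mem_cons, List.mem_append] at hx ⊢; tauto)) rfl hyy
      have := Fan.two a b _ hab (fun m hm => by
        simp only [List.mem_append, List.mem_cons] at hm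
        by_cases hmN : m ∈ N
        · exact hfresh a (by simp) m hmN
        · exact fresh m (by simp only [List.mem_append, List.mem_cons]; tauto)) h2
      simpa using this
  | three a t b M M' hp hat hab fresh hM hM' ihM ihM' =>
    have fresh1 : ∀ m ∈ M, ¬ r a m := fun m hm => fresh m (by simp [hm])
    have fresh2 : ∀ m ∈ M', ¬ r a m := fun m hm => fresh m (by simp [hm])
    have hfa : ∀ n ∈ N, ¬ r a n := hfresh a (by simp)
    cases X with
    | nil =>
      obtain ⟨rfl, h1⟩ := List.cons.inj h
      cases M with
      | nil =>
        obtain ⟨rfl, rfl⟩ := List.cons.inj h1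
        have := Fan.three a t b N M' hp hat hab (fun m hm => by
          rcases List.mem_append.1 hm with h2 | h2
          · exact hfa m h2
          · exact fresh2 m h2) hN hM'
        simpa using this
      | cons m M =>
        obtain ⟨rfl, h2⟩ := List.cons.inj h1
        exact absurd hyy (fresh1 m (by simp))
    | cons x X =>
      obtain ⟨rfl, h1⟩ := List.cons.inj h
      have hsecond : ∀ X'', X = M ++ X'' → t :: (M' ++ [b]) = X'' ++ y :: y' :: Y →
          Fan r p ((a :: X) ++ y :: (N ++ y' :: Y)) := by
        rintro X'' rfl h2
        cases X'' with
        | nil =>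
          obtain ⟨rfl, h3⟩ := List.cons.inj h2
          cases M' with
          | nil =>
            obtain ⟨rfl, rfl⟩ : b = y' ∧ [] = Y := by simpa using h3
            have := Fan.three a t b M N hp hat hab (fun m hm => by
              rcases List.mem_append.1 hm with h4 | h4
              · exact fresh1 m h4
              · exact hfa m h4) hM hN
            simpa using this
          | cons m M' =>
            obtain ⟨rfl, h4⟩ := List.cons.inj h3
            exact absurd (hr.trans hat hyy) (fresh2 m (by simp))
        | cons x X'' =>
          obtain ⟨rfl, h3⟩ := List.cons.inj h2
          obtain ⟨Y', rfl, rfl⟩ := insert_last hr hab fresh2 h3 hyy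
          have h4 := ihM' (fun x hx => hfresh x (by
            simp only [List.mem_cons, List.mem_append] at hx ⊢; tauto)) rfl hyy
          have := Fan.three a t b M _ hp hat hab (fun m hm => by
            by_cases hmN : m ∈ N
            · exact hfa m hmN
            · refine fresh m ?_
              simp only [List.mem_append, List.mem_cons] at hm ⊢
              tauto) hM h4
          simpa using this
      rcases List.append_eq_append_iff.1 h1 with ⟨X'', h2, h3⟩ | ⟨M'', h2, h3⟩
      · exact hsecond X'' h2 h3
      · rcases M'' with _ | ⟨m, _ | ⟨m', M''⟩⟩
        · exact hsecond [] (by simpa using h2.symm) (by simpa using h3.symm)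
        · simp only [List.cons_append, List.nil_append, List.cons.injEq] at h3
          obtain ⟨rfl, rfl, h4⟩ := h3
          exact absurd (hr.trans hat (hr.symm hyy)) (fresh1 y (by simp [h2]))
        · simp only [List.cons_append, List.cons.injEq] at h3
          obtain ⟨rfl, rfl, rfl⟩ := h3
          have h4 := ihM (fun x hx => hfresh x (by
            simp only [List.mem_cons, List.mem_append] at hx ⊢; tauto)) h2 hyy
          have := Fan.three a t b _ M' hp hat hab (fun m hm => by
            by_cases hmN : m ∈ N
            · exact hfa m hmN
            · refine fresh m ?_
              rw [h2]
              simp only [List.mem_append, List.mem_cons] at hm ⊢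
              tauto) h4 hM'
          simpa using this

theorem map {S : Type*} {F : List S} (f : S → D) (hF : Fan (fun a b => r (f a) (f b))
    (fun a => p (f a)) F) : Fan r p (F.map f) := by
  induction hF with
  | nil => exact .nil
  | two a b M hab fresh hM ih =>
    have := Fan.two (p := p) (f a) (f b) _ hab (by simpa using fresh) ih
    simpa using this
  | three a t b M N hp hat hab fresh hM hN ihM ihN =>
    have := Fan.three (f a) (f t) (f b) _ _ hp hat hab (fun m hm => by
      rw [← List.map_append] at hm
      obtain ⟨x, hx, rfl⟩ := List.mem_map.1 hm
      exact fresh x hx) ihM ihN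
    simpa using this

/-- Whole groups are kept or dropped. Groups of three are always kept, so no kept list has to take
the place of two neighbouring ones. -/
theorem filter {F : List D} (hF : Fan r p F) (hp : ∀ a b, r a b → (p a ↔ p b)) :
    Fan r p (F.filter (fun a => p a)) := by
  induction hF with
  | nil => exact .nil
  | two a b M hab fresh hM ih =>
    by_cases ha : p a
    · have hb := (hp a b hab).1 ha
      have := Fan.two a b _ hab (fun m hm => fresh m (List.mem_of_mem_filter hm)) ih
      simpa [ha, hb] using this
    · have hb : ¬ p b := fun hb => ha ((hp a b hab).2 hb)
      simpa [ha, hb] using ih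
  | three a t b M N ha hat hab fresh hM hN ihM ihN =>
    have hb := (hp a b hab).1 ha
    have ht := (hp a t hat).1 ha
    have := Fan.three a t b _ _ ha hat hab (fun m hm => by
      rw [← List.filter_append] at hm
      exact fresh m (List.mem_of_mem_filter hm)) ihM ihN
    simpa [ha, hb, ht] using this

/-- A long nested list has a balanced decomposition into two nested lists. -/
theorem exists_balanced (hr : Equivalence r) {n : ℕ} (hn : 6 < n) {G X Y : List D}
    (hG : Fan r p G) (hlen : (X ++ G ++ Y).length = n) (hbig : 2 * n < 3 * (G.length + 1))
    (ctx : ∀ G', Fan r p G' → (∀ x ∈ G', x ∈ G) → Fan r p (X ++ G' ++ Y)) :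
    ∃ a b A B, r a b ∧ (X ++ G ++ Y).IsRotated (a :: A ++ b :: B) ∧
      (n ≤ 3 * (A.length + 1) ∧ 3 * (A.length + 1) ≤ 2 * n) ∧
      (n ≤ 3 * (B.length + 1) ∧ 3 * (B.length + 1) ≤ 2 * n) ∧
      (∃ F, Fan r p F ∧ (a :: A ++ [b]).IsRotated F) ∧
      ∃ F, Fan r p F ∧ (b :: B ++ [a]).IsRotated F := by
  -- Cutting at a pair of related elements: one part is the nested list between them, the other is
  -- the context with an empty gap between them.
  have split : ∀ (X Y A : List D) (a b : D), r a b → X ++ (a :: A ++ [b]) ++ Y ≠ [] →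
      (X ++ (a :: A ++ [b]) ++ Y).length = n → n ≤ 3 * (A.length + 1) →
      3 * (A.length + 1) ≤ 2 * n → Fan r p (a :: (A ++ [b])) → Fan r p (X ++ (a :: [b]) ++ Y) →
      ∃ a' b' A' B, r a' b' ∧ (X ++ (a :: A ++ [b]) ++ Y).IsRotated (a' :: A' ++ b' :: B) ∧
        (n ≤ 3 * (A'.length + 1) ∧ 3 * (A'.length + 1) ≤ 2 * n) ∧
        (n ≤ 3 * (B.length + 1) ∧ 3 * (B.length + 1) ≤ 2 * n) ∧
        (∃ F, Fan r p F ∧ (a' :: A' ++ [b']).IsRotated F) ∧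
        ∃ F, Fan r p F ∧ (b' :: B ++ [a']).IsRotated F := by
    intro X Y A a b hab _ hl h1 h2 hF1 hF2
    simp only [List.length_append, List.length_cons, List.length_nil] at hl
    refine ⟨a, b, A, Y ++ X, hab, ?_, ⟨h1, h2⟩, ?_, ⟨_, hF1, List.IsRotated.refl _⟩, ⟨_, hF2, ?_⟩⟩
    · have := List.isRotated_append (l := X) (l' := a :: A ++ [b] ++ Y)
      simpa using this
    · rw [List.length_append]
      omega
    · have := List.isRotated_append (l := b :: Y) (l' := X ++ [a])
      simpa using this
  induction hG generalizing X Y with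
  | nil =>
    simp only [List.length_nil] at hbig
    omega
  | two a b M hab fresh hM ih =>
    have hnil : r a b := hab
    simp only [List.length_append, List.length_cons, List.length_nil] at hlen hbig
    -- Descend while more than two thirds lie inside the group.
    by_cases h1 : 2 * n < 3 * (M.length + 1)
    · have := ih (X := X ++ [a]) (Y := b :: Y) (by simpa using by omega) h1 (fun G' hG' hsub => by
          have := ctx _ (.two a b G' hab (fun m hm => fresh m (hsub m hm)) hG') (by
            intro x hx
            simp only [List.mem_cons, List.mem_append] at hx ⊢
            have := hsub x
            tauto)
          simpa using this)
      simpa using this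
    -- Otherwise the pair itself is balanced: going inwards past two elements loses at most `6` of
    -- `3 (|G| + 1) > 2n`, which leaves at least `n` as `n > 6`.
    · have := split X Y M a b hab (by simp) (by simpa using by omega) (by omega) (by omega) (.two a b M hab fresh hM)
        (ctx _ (.two a b [] hab (by simp) .nil) (by simp))
      simpa using this
  | three a t b M N hpa hat hab fresh hM hN ihM ihN =>
    have fresh1 : ∀ m ∈ M, ¬ r a m := fun m hm => fresh m (by simp [hm])
    have fresh2 : ∀ m ∈ N, ¬ r a m := fun m hm => fresh m (by simp [hm])
    have htb : r t b := hr.trans (hr.symm hat) hab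
    have fresh3 : ∀ m ∈ N, ¬ r t m := fun m hm h => fresh2 m hm (hr.trans hat h)
    simp only [List.length_append, List.length_cons, List.length_nil] at hlen hbig
    by_cases h1 : 2 * n < 3 * (M.length + 1)
    · have := ihM (X := X ++ [a]) (Y := t :: (N ++ [b]) ++ Y) (by simpa using by omega) h1 (fun G' hG' hsub => by
          have := ctx _ (.three a t b G' N hpa hat hab (fun m hm => by
            rcases List.mem_append.1 hm with h2 | h2
            · exact fresh1 m (hsub m h2)
            · exact fresh2 m h2) hG' hN) (by
            intro x hx
            simp only [List.mem_cons, List.mem_append] at hx ⊢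
            have := hsub x
            tauto)
          simpa using this)
      simpa using this
    by_cases h2 : 2 * n < 3 * (N.length + 1)
    · have := ihN (X := X ++ a :: (M ++ [t])) (Y := b :: Y) (by simpa using by omega) h2 (fun G' hG' hsub => by
          have := ctx _ (.three a t b M G' hpa hat hab (fun m hm => by
            rcases List.mem_append.1 hm with h2 | h2
            · exact fresh1 m h2
            · exact fresh2 m (hsub m h2)) hM hG') (by
            intro x hx
            simp only [List.mem_cons, List.mem_append] at hx ⊢
            have := hsub x
            tauto)
          simpa using this)
      simpa using this
    -- Neither gap is too large. If one of them has at least a third, cut it off.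
    by_cases h3 : n ≤ 3 * (M.length + 1)
    · have := split X (N ++ [b] ++ Y) M a t hat (by simp) (by simpa using by omega) h3 (by omega) (.two a t M hat fresh1 hM) (by
          have := ctx _ (.three a t b [] N hpa hat hab (by simpa using fresh2) .nil hN) (by
            intro x hx
            simp only [List.mem_cons, List.mem_append] at hx ⊢
            simp only [List.not_mem_nil, false_or] at hx
            tauto)
          simpa using this)
      simpa using this
    by_cases h4 : n ≤ 3 * (N.length + 1)
    · have := split (X ++ a :: M) Y N t b htb (by simp) (by simpa using by omega) h4 (by omega) (.two t b N htb fresh3 hN) (by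
          have := ctx _ (.three a t b M [] hpa hat hab (by simpa using fresh1) hM .nil) (by
            intro x hx
            simp only [List.mem_cons, List.mem_append, List.not_mem_nil, false_or] at hx ⊢
            tauto)
          simpa using this)
      simpa using this
    -- If both gaps have less than a third, together they have less than two thirds, and at least a
    -- third by the bound on the whole group; so the outer pair is balanced.
    · have := split X Y (M ++ t :: N) a b hab (by simp) (by simpa using by omega)
        (by simp only [List.length_append, List.length_cons]; omega)
        (by simp only [List.length_append, List.length_cons]; omega)
        (by
          have := Fan.three a t b M N hpa hat hab fresh hM hN
          simpa using this)
        (ctx _ (.two a b [] hab (by simp) .nil) (by simp))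
      simpa using this

end Fan

end

noncomputable section

/-! ### Trees of small orbits -/

/-- A permutation with orbits of size two or three and an involution. The orbits are regarded as the
vertices of a graph, and the pairs of the involution as its edges. -/
structure IsCubic {S : Type*} (τ : Equiv.Perm S) (α : S → S) (r : S → S → Prop) (p : S → Prop) :
    Prop where
  ne : ∀ x, τ x ≠ x
  small : ∀ x, τ (τ x) = x ∨ τ (τ (τ x)) = x
  invol : ∀ x, α (α x) = x
  equiv : Equivalence r
  rel_iff : ∀ x y, r x y ↔ y = x ∨ y = τ x ∨ y = τ (τ x)
  of_ne : ∀ x, τ (τ x) ≠ x → p x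

namespace IsCubic

variable {S : Type*} {τ : Equiv.Perm S} {α : S → S} {r : S → S → Prop} {p : S → Prop}

theorem rel_apply (h : IsCubic τ α r p) (x : S) : r x (τ x) := (h.rel_iff _ _).2 (by simp)

/-- A finite forest has a vertex of degree at most one. If each of the orbits had two edge ends
inside `X`, there would be at least as many edges as orbits. But without cycles the boundary map is
injective on the edge functions, with values in the proper subspace of functions of sum zero. -/
theorem exists_leaf [Fintype S] (h : IsCubic τ α r p)
    (acyclic : ∀ g : S → ZMod 2, (∀ x, g (α x) = g x) → (∀ x, α x = x → g x = 0) →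
      (∀ x, ∑ y with r x y, g y = 0) → ∀ x, g x = 0)
    (X : Finset S) (hX : X.Nonempty) :
    ∃ x ∈ X, ∀ y z, r x y → r x z → (y ∈ X ∧ α y ∈ X ∧ α y ≠ y) →
      (z ∈ X ∧ α z ∈ X ∧ α z ≠ z) → y = z := by
  by_contra! hcon
  let Y := {x // x ∈ X ∧ α x ∈ X ∧ α x ≠ x}
  let β : Y → Y := fun y => ⟨α y, y.2.2.1, by rw [h.invol]; exact y.2.1, by
    rw [h.invol]; exact y.2.2.2.symm⟩
  have hβ : ∀ y, β (β y) = y := fun y => Subtype.ext (h.invol _)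
  have hβne : ∀ y, β y ≠ y := fun y hy => y.2.2.2 (congrArg Subtype.val hy)
  let A : (Y → ZMod 2) →ₗ[ZMod 2] (Y → ZMod 2) :=
    LinearMap.funLeft (ZMod 2) (ZMod 2) β + LinearMap.id
  have hA : ∀ z y, A z y = z (β y) + z y := fun z y => rfl
  -- In characteristic two `A ∘ A = 0`. So the functions on edges, that is the kernel of `A`, have
  -- at least half the dimension of those on edge ends.
  have hrange : LinearMap.range A ≤ LinearMap.ker A := by
    rintro _ ⟨z, rfl⟩
    rw [LinearMap.mem_ker]
    funext y
    rw [hA, hA, hA, hβ]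
    simp only [Pi.zero_apply]
    grind
  have h1 : Fintype.card Y ≤ 2 * Module.finrank (ZMod 2) (LinearMap.ker A) := by
    have := LinearMap.finrank_range_add_finrank_ker A
    have := Submodule.finrank_mono hrange
    rw [Module.finrank_fintype_fun_eq_card] at *
    omega
  let s : Setoid Y := ⟨fun a b => r a b, ⟨fun a => h.equiv.refl _, fun h' => h.equiv.symm h',
    fun h1 h2 => h.equiv.trans h1 h2⟩⟩
  let O := Quotient s
  let B : (Y → ZMod 2) →ₗ[ZMod 2] (O → ZMod 2) :=
    { toFun := fun z o => ∑ y with Quotient.mk s y = o, z y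
      map_add' := fun z w => by funext o; simp [Finset.sum_add_distrib]
      map_smul' := fun c z => by funext o; simp [Finset.mul_sum] }
  let T : (O → ZMod 2) →ₗ[ZMod 2] ZMod 2 := ∑ o, LinearMap.proj o
  have hT : ∀ f, T f = ∑ o, f o := fun f => by simp [T]
  have hTB : ∀ z ∈ LinearMap.ker A, B z ∈ LinearMap.ker T := by
    intro z hz
    rw [LinearMap.mem_ker, hT]
    have : ∑ o, B z o = ∑ y, z y := Finset.sum_fiberwise Finset.univ (Quotient.mk s) z
    rw [this]
    refine Finset.sum_involution (fun y _ => β y) (fun y _ => ?_) (fun y _ _ => hβne y)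
      (fun y _ => Finset.mem_univ _) (fun y _ => hβ y)
    have := congrFun (LinearMap.mem_ker.1 hz) y
    rw [hA] at this
    rw [add_comm]
    exact this
  -- A function on edges without boundary, extended by zero, is a cycle in the sense of `acyclic`.
  have hBinj : ∀ z ∈ LinearMap.ker A, B z = 0 → z = 0 := by
    intro z hz hBz
    have hinv : ∀ y, z (β y) = z y := by
      intro y
      have := congrFun (LinearMap.mem_ker.1 hz) y
      rw [hA] at this
      simp only [Pi.zero_apply] at this
      grind
    let g : S → ZMod 2 := fun x => if hx : x ∈ X ∧ α x ∈ X ∧ α x ≠ x then z ⟨x, hx⟩ else 0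
    have hg : ∀ y : Y, g y = z y := fun y => dif_pos y.2
    have hg0 : ∀ x, ¬ (x ∈ X ∧ α x ∈ X ∧ α x ≠ x) → g x = 0 := fun x hx => dif_neg hx
    have key := acyclic g (fun x => by
      by_cases hx : x ∈ X ∧ α x ∈ X ∧ α x ≠ x
      · have e1 := hg ⟨x, hx⟩
        have e2 := hg (β ⟨x, hx⟩)
        rw [hinv] at e2
        exact e2.trans e1.symm
      · rw [hg0 x hx, hg0]
        rw [h.invol]
        rintro ⟨k1, k2, k3⟩
        exact hx ⟨k2, k1, k3.symm⟩) (fun x hx => hg0 x fun k => k.2.2 hx) (fun x => by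
      by_cases hne : ∃ y : Y, r x y
      · obtain ⟨y, hy⟩ := hne
        have e1 : B z (Quotient.mk s y) = 0 := congrFun hBz _
        have e2 : B z (Quotient.mk s y) = ∑ w : Y with Quotient.mk s w = Quotient.mk s y, z w := rfl
        rw [← e1, e2]
        symm
        rw [Finset.sum_filter, Finset.sum_filter]
        have e3 : ∑ w ∈ Finset.univ.filter (fun x => x ∈ X ∧ α x ∈ X ∧ α x ≠ x),
            (if r x w then g w else 0) = ∑ w, if r x w then g w else 0 := by
          refine Finset.sum_subset (Finset.subset_univ _) fun w _ hw => ?_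
          rw [hg0 w (by simpa using hw)]
          simp
        rw [← e3, Finset.sum_subtype (p := fun x => x ∈ X ∧ α x ∈ X ∧ α x ≠ x) _ (by simp)]
        refine Finset.sum_congr rfl fun w _ => ?_
        rw [hg]
        have : Quotient.mk s w = Quotient.mk s y ↔ r x w := by
          rw [Quotient.eq]
          exact ⟨fun k => h.equiv.trans hy (h.equiv.symm k),
            fun k => h.equiv.trans (h.equiv.symm k) hy⟩
        simp [this]
      · push Not at hne
        refine Finset.sum_eq_zero fun w hw => hg0 w fun hw' => hne ⟨w, hw'⟩ ?_
        simpa using hw)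
    funext y
    rw [← hg, key]
    rfl
  have hfib : ∀ o : O, 2 ≤ (Finset.univ.filter fun y : Y => Quotient.mk s y = o).card := by
    intro o
    obtain ⟨y, rfl⟩ := Quotient.exists_rep o
    obtain ⟨u, v, hu, hv, hu', hv', huv⟩ := hcon y y.2.1
    refine Finset.one_lt_card.2 ⟨⟨u, hu'⟩, ?_, ⟨v, hv'⟩, ?_, fun k => huv (congrArg Subtype.val k)⟩
    · simp only [Finset.mem_filter, Finset.mem_univ, true_and]
      exact Quotient.sound (h.equiv.symm hu)
    · simp only [Finset.mem_filter, Finset.mem_univ, true_and]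
      exact Quotient.sound (h.equiv.symm hv)
  have h2 : 2 * Fintype.card O ≤ Fintype.card Y := by
    have := Finset.card_eq_sum_card_fiberwise (f := Quotient.mk s) (s := Finset.univ)
      (t := Finset.univ) (by simp [Set.MapsTo])
    rw [Finset.card_univ] at this
    rw [this]
    have := Finset.sum_le_sum fun (o : O) (_ : o ∈ Finset.univ) => hfib o
    simpa [mul_comm] using this
  have h3 : Module.finrank (ZMod 2) (LinearMap.ker A) ≤ Module.finrank (ZMod 2) (LinearMap.ker T) := by
    refine LinearMap.finrank_le_finrank_of_injective (f := B.restrict hTB) ?_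
    rw [← LinearMap.ker_eq_bot, LinearMap.ker_eq_bot']
    intro z hz
    exact Subtype.ext (hBinj z z.2 (congrArg Subtype.val hz))
  -- Not all functions on orbits have sum zero, as there is at least one orbit.
  have h4 : Module.finrank (ZMod 2) (LinearMap.ker T) < Fintype.card O := by
    rw [← Module.finrank_fintype_fun_eq_card (ZMod 2)]
    refine Submodule.finrank_lt fun htop => ?_
    obtain ⟨x, hx⟩ := hX
    obtain ⟨u, v, hu, hv, hu', hv', huv⟩ := hcon x hx
    let o : O := Quotient.mk s ⟨u, hu'⟩
    have : T (Pi.single o 1) = 0 := LinearMap.mem_ker.1 (htop ▸ Submodule.mem_top)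
    rw [hT, Finset.sum_pi_single'] at this
    simp at this
  omega

/-- An orbit written so that it ends in `z`, as it is traversed when entered and left through the
edge at `z`. The last clause lets the orbit become the outermost group, for the case that there is
no gap between adjacent elements into which it could be inserted. -/
theorem exists_orbit_list (h : IsCubic τ α r p) (z : S) :
    ∃ N : List S, Fan r p N ∧ N.Nodup ∧ (∀ n, n ∈ N ↔ r z n) ∧ (∃ N', N = τ z :: N') ∧
      (∀ R : S → S → Prop, ∀ y w, R y (τ z) → R z w → (∀ u, r z u → u ≠ z → R u (τ u)) →
        (y :: N ++ [w]).IsChain R) ∧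
      ∀ F, Fan r p F → (∀ m ∈ F, ¬ r z m) → ∃ F', Fan r p F' ∧ F'.IsRotated (N ++ F) := by
  have h1 := h.rel_apply z
  have h2 := h.rel_apply (τ z)
  have h12 := h.equiv.trans h1 h2
  have n1 := h.ne z
  have n2 := h.ne (τ z)
  by_cases h3 : τ (τ z) = z
  · refine ⟨[τ z, z], .two (τ z) z [] (h.equiv.symm h1) (by simp) .nil, by simpa using n1, ?_,
      ⟨_, rfl⟩, ?_, ?_⟩
    · intro n
      rw [h.rel_iff]
      simp [h3]
      tauto
    · intro R y w hy hw hR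
      have := hR (τ z) h1 n1
      rw [h3] at this
      simp [hy, hw, this]
    · intro F hF hfresh
      refine ⟨_, .two z (τ z) F h1 hfresh hF, ?_⟩
      have := List.isRotated_append (l := z :: F) (l' := [τ z])
      simpa using this
  · have h4 := (h.small z).resolve_left h3
    have n3 : τ (τ z) ≠ τ z := n2
    refine ⟨[τ z, τ (τ z), z], .three (τ z) (τ (τ z)) z [] [] (h.of_ne _ ?_) h2
      (h.equiv.symm h1) (by simp) .nil .nil, ?_, ?_, ⟨_, rfl⟩, ?_, ?_⟩
    · exact fun k => h3 (τ.injective k)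
    · simp [n1, n3.symm, h3]
    · intro n
      rw [h.rel_iff]
      simp
      tauto
    · intro R y w hy hw hR
      have e1 := hR (τ z) h1 n1
      have e2 := hR (τ (τ z)) h12 h3
      rw [h4] at e2
      simp [hy, hw, e1, e2]
    · intro F hF hfresh
      refine ⟨_, .three (τ (τ z)) z (τ z) [] F (h.of_ne _ ?_) (h.equiv.symm h12)
        (h.equiv.symm h2) ?_ .nil hF, ?_⟩
      · rw [h4]; exact fun k => n3 k.symm
      · intro m hm k
        exact hfresh m (by simpa using hm) (h.equiv.trans h12 k)
      · have := List.isRotated_append (l := τ (τ z) :: z :: F) (l' := [τ z])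
        simpa using this

/-- The closed tour around a plane tree, which crosses an edge if there is one and then turns. By
induction a leaf orbit is removed; in the tour of the rest, its elements are put between the two
consecutive elements `α z` and `τ (α z)`, where `α z` is the end of the removed edge. -/
theorem exists_fan [Fintype S] (h : IsCubic τ α r p)
    (acyclic : ∀ g : S → ZMod 2, (∀ x, g (α x) = g x) → (∀ x, α x = x → g x = 0) →
      (∀ x, ∑ y with r x y, g y = 0) → ∀ x, g x = 0)
    (X : Finset S) (hX : X.Nonempty) (closed : ∀ x ∈ X, τ x ∈ X)
    (conn : ∀ Z ⊆ X, Z.Nonempty → (∀ x ∈ Z, τ x ∈ Z) → (∀ x ∈ Z, α x ∈ X → α x ∈ Z) → Z = X) :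
    ∃ F : List S, Fan r p F ∧ F.Nodup ∧ (∀ x, x ∈ F ↔ x ∈ X) ∧
      CycChain (fun u v => v = τ (if α u ∈ X then α u else u)) F := by
  induction hn : X.card using Nat.strong_induction_on generalizing X with
  | _ n ih =>
  obtain ⟨x, hx, leaf⟩ := h.exists_leaf acyclic X hX
  have hTX : ∀ u, r x u → u ∈ X := by
    intro u hu
    rcases (h.rel_iff _ _).1 hu with rfl | rfl | rfl
    · exact hx
    · exact closed _ hx
    · exact closed _ (closed _ hx)
  have rτ : ∀ u, r x u → r x (τ u) := fun u hu => h.equiv.trans hu (h.rel_apply u)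
  by_cases hz : ∃ z, r x z ∧ α z ∈ X ∧ α z ≠ z
  swap
  · push Not at hz
    have hall : X.filter (r x) = X := by
      refine conn _ (Finset.filter_subset _ _) ⟨x, by simp [hx, h.equiv.refl x]⟩ ?_ ?_
      · intro u hu
        rw [Finset.mem_filter] at hu ⊢
        exact ⟨closed _ hu.1, rτ _ hu.2⟩
      · intro u hu hu'
        rw [Finset.mem_filter] at hu
        rw [hz u hu.2 hu', Finset.mem_filter]
        exact hu
    obtain ⟨N, hN, hnd, hmem, ⟨N', rfl⟩, hch, -⟩ := h.exists_orbit_list x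
    refine ⟨_, hN, hnd, fun u => ?_, τ x, N', List.IsRotated.refl _, ?_⟩
    · rw [hmem]
      exact ⟨hTX u, fun k => (Finset.mem_filter.1 (hall.symm.subset k)).2⟩
    · have hstep : ∀ u, r x u → τ u = τ (if α u ∈ X then α u else u) := by
        intro u hu
        by_cases hu' : α u ∈ X
        · rw [if_pos hu', hz u hu hu']
        · rw [if_neg hu']
      have := hch (fun u v => v = τ (if α u ∈ X then α u else u)) x (τ x)
        (hstep x (h.equiv.refl x)) (hstep x (h.equiv.refl x)) (fun u hu _ => hstep u hu)
      exact (List.isChain_cons_cons.1 this).2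
  obtain ⟨z, hxz, hyX, hyz⟩ := hz
  have hzx := h.equiv.symm hxz
  -- The orbit is a leaf: only its element `z` has an edge to another element of `X`.
  have hint : ∀ u, r x u → α u ∈ X → α u ≠ u → u = z := fun u hu h1 h2 =>
    leaf u z hu hxz ⟨hTX u hu, h1, h2⟩ ⟨hTX z hxz, hyX, hyz⟩
  have hyT : ¬ r x (α z) := fun k => hyz (hint _ k (by rw [h.invol]; exact hTX z hxz)
    (by rw [h.invol]; exact hyz.symm))
  have hback : ∀ u ∈ X, ¬ r x u → r x (α u) → u = α z := by
    intro u hu hu1 hu2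
    rw [← hint (α u) hu2 (by rwa [h.invol]) (by rw [h.invol]; rintro k; rw [← k] at hu2; exact hu1 hu2),
      h.invol]
  let X' := X.filter fun u => ¬ r x u
  have hX' : ∀ u, u ∈ X' ↔ u ∈ X ∧ ¬ r x u := fun u => Finset.mem_filter
  have hy' : α z ∈ X' := (hX' _).2 ⟨hyX, hyT⟩
  have hcard : X'.card < n := by
    rw [← hn]
    exact Finset.card_lt_card (Finset.filter_ssubset.2 ⟨x, hx, fun k => k (h.equiv.refl x)⟩)
  obtain ⟨F, hF, hnd, hmem, hcyc⟩ := ih _ hcard X' ⟨_, hy'⟩ (by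
      intro u hu
      rw [hX'] at hu ⊢
      exact ⟨closed _ hu.1, fun k => hu.2 (h.equiv.trans k (h.equiv.symm (h.rel_apply u)))⟩) (by
      intro Z hZ hne hZτ hZα
      -- If `Z` contains the place of attachment, then `Z` together with the leaf is closed in `X`;
      -- otherwise `Z` alone is. In either case connectedness of `X` applies.
      by_cases hyZ : α z ∈ Z
      · have hun : Z ∪ X.filter (r x) = X := by
          refine conn _ (Finset.union_subset (hZ.trans (Finset.filter_subset _ _))
            (Finset.filter_subset _ _)) (hne.mono Finset.subset_union_left) ?_ ?_
          · intro u hu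
            rw [Finset.mem_union, Finset.mem_filter] at hu ⊢
            rcases hu with hu | hu
            · exact Or.inl (hZτ _ hu)
            · exact Or.inr ⟨closed _ hu.1, rτ _ hu.2⟩
          · intro u hu hu'
            rw [Finset.mem_union, Finset.mem_filter] at hu ⊢
            by_cases hr : r x (α u)
            · exact Or.inr ⟨hu', hr⟩
            · left
              rcases hu with hu | hu
              · exact hZα u hu ((hX' _).2 ⟨hu', hr⟩)
              · rw [hint u hu.2 hu' (fun k => hr (k.symm ▸ hu.2))]
                exact hyZ
        refine hZ.antisymm fun u hu => ?_
        have hu1 := (hX' u).1 hu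
        have : u ∈ Z ∪ X.filter (r x) := by rw [hun]; exact hu1.1
        rw [Finset.mem_union, Finset.mem_filter] at this
        exact this.resolve_right fun k => hu1.2 k.2
      · exfalso
        have : Z = X := by
          refine conn Z (hZ.trans (Finset.filter_subset _ _)) hne hZτ fun u hu hu' => ?_
          refine hZα u hu ((hX' _).2 ⟨hu', fun k => hyZ ?_⟩)
          have hu1 := (hX' u).1 (hZ hu)
          rw [← hback u hu1.1 hu1.2 k]
          exact hu
        have hxZ : x ∈ X' := hZ (this ▸ hx)
        exact ((hX' x).1 hxZ).2 (h.equiv.refl x)) rfl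
  obtain ⟨N, hN, hndN, hmemN, -, hch, hwrap⟩ := h.exists_orbit_list z
  obtain ⟨P, Q, rfl⟩ := List.append_of_mem ((hmem _).2 hy')
  set R' : S → S → Prop := fun u v => v = τ (if α u ∈ X' then α u else u) with hR'
  set R : S → S → Prop := fun u v => v = τ (if α u ∈ X then α u else u) with hR
  have hRR : ∀ u ∈ X', u ≠ α z → ∀ v, R' u v → R u v := by
    intro u hu hne v huv
    have hu1 := (hX' u).1 hu
    have : α u ∈ X' ↔ α u ∈ X := by
      rw [hX']
      exact ⟨fun k => k.1, fun k => ⟨k, fun k' => hne (hback u hu1.1 hu1.2 k')⟩⟩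
    simp only [hR', hR, this] at huv ⊢
    exact huv
  have hzX' : z ∉ X' := fun k => ((hX' _).1 k).2 hxz
  have hrot : (P ++ α z :: Q).IsRotated (α z :: (Q ++ P)) := by
    have := List.isRotated_append (l := P) (l' := α z :: Q)
    simpa using this
  have hchain : (α z :: (Q ++ P) ++ [α z]).IsChain R' := (hcyc.isRotated hrot).isChain
  have hnd2 : (α z :: (Q ++ P)).Nodup := (hrot.perm.nodup_iff).1 hnd
  -- Without the leaf, `α z` has no edge, and the tour merely turns to `τ (α z)`.
  have hstep : ∀ v, R' (α z) v → v = τ (α z) := by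
    intro v hv
    simpa [hR', h.invol, hzX'] using hv
  obtain ⟨M, hQP⟩ : ∃ M, Q ++ P = τ (α z) :: M := by
    cases hc : Q ++ P with
    | nil =>
      rw [hc] at hchain
      simp only [List.cons_append, List.nil_append, List.isChain_cons_cons] at hchain
      exact absurd (hstep _ hchain.1).symm (h.ne _)
    | cons q M =>
      rw [hc] at hchain
      simp only [List.cons_append, List.isChain_cons_cons] at hchain
      exact ⟨M, by rw [hstep _ hchain.1]⟩
  have hmemM : ∀ u, u ∈ τ (α z) :: M → u ∈ X' ∧ u ≠ α z := by
    intro u hu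
    rw [← hQP] at hu
    refine ⟨(hmem u).1 (hrot.perm.mem_iff.2 (List.mem_cons_of_mem _ hu)), ?_⟩
    rintro rfl
    exact (List.nodup_cons.1 hnd2).1 hu
  rw [hQP] at hchain hrot hnd2
  have hNX' : ∀ u ∈ N, u ∉ X' := fun u hu k =>
    ((hX' u).1 k).2 (h.equiv.trans hxz ((hmemN u).1 hu))
  -- The new tour crosses from `α z` to `z`, turns to `τ z`, goes around the leaf up to `z`, crosses
  -- back and turns to `τ (α z)`.
  have hchain2 : (α z :: (N ++ τ (α z) :: M) ++ [α z]).IsChain R := by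
    have e1 : (α z :: N ++ [τ (α z)]).IsChain R := by
      refine hch R (α z) (τ (α z)) ?_ ?_ ?_
      · simp only [hR, h.invol, if_pos (hTX z hxz)]
      · simp only [hR, if_pos hyX]
      · intro u hu hne
        have hxu := h.equiv.trans hxz hu
        by_cases hu' : α u ∈ X
        · simp only [hR, if_pos hu']
          by_contra hcon
          exact hne (hint u hxu hu' fun k => hcon (by rw [k]))
        · simp only [hR, if_neg hu']
    have e2 : (τ (α z) :: M ++ [α z]).IsChain R := by
      refine List.IsChain.change (List.isChain_cons_cons.1 hchain).2 fun a ha b _ hab => ?_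
      obtain ⟨k1, k2⟩ := hmemM a ha
      exact hRR a k1 k2 b hab
    have e3 : α z :: (N ++ τ (α z) :: M) ++ [α z] = (α z :: N) ++ τ (α z) :: (M ++ [α z]) := by simp
    rw [e3, List.isChain_split]
    exact ⟨e1, e2⟩
  -- If `α z` is not the last element of `F`, it is followed by the related element `τ (α z)`, and
  -- the leaf can be inserted between them. If it is the last, the gap is the outer one.
  obtain ⟨F', hF', hrot'⟩ : ∃ F', Fan r p F' ∧ F'.IsRotated (α z :: (N ++ τ (α z) :: M)) := by
    have hfresh : ∀ u ∈ P ++ α z :: Q, ¬ r x u := fun u hu => ((hX' u).1 ((hmem u).1 hu)).2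
    cases Q with
    | nil =>
      obtain ⟨F', hF', hrot'⟩ := hwrap _ hF fun m hm k => hfresh m hm (h.equiv.trans hxz k)
      refine ⟨F', hF', hrot'.trans ?_⟩
      rw [List.nil_append] at hQP
      subst hQP
      have := List.isRotated_append (l := N ++ τ (α z) :: M) (l' := [α z])
      simpa using this
    | cons q Q =>
      obtain ⟨rfl, rfl⟩ := List.cons.inj hQP
      refine ⟨_, Fan.insert h.equiv hF hN ?_ rfl (h.rel_apply _), ?_⟩
      · intro u hu n hn k
        exact hfresh u hu (h.equiv.trans hxz (h.equiv.trans ((hmemN n).1 hn) (h.equiv.symm k)))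
      · have := List.isRotated_append (l := P) (l' := α z :: (N ++ τ (α z) :: Q))
        simpa using this
  refine ⟨F', hF', ?_, ?_, _, _, hrot', hchain2⟩
  · rw [hrot'.perm.nodup_iff]
    have hp : (α z :: (N ++ τ (α z) :: M)).Perm (N ++ α z :: τ (α z) :: M) := List.perm_middle.symm
    rw [hp.nodup_iff, List.nodup_append']
    refine ⟨hndN, hnd2, fun u hu hu' => hNX' u hu ?_⟩
    exact (hmem u).1 (hrot.perm.mem_iff.2 hu')
  · intro u
    have hp : (α z :: (N ++ τ (α z) :: M)).Perm (N ++ α z :: τ (α z) :: M) := List.perm_middle.symm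
    rw [hrot'.perm.mem_iff, hp.mem_iff, List.mem_append, ← hrot.perm.mem_iff, hmem, hmemN, hX']
    constructor
    · rintro (k | k)
      · exact hTX u (h.equiv.trans hxz k)
      · exact k.1
    · intro k
      by_cases hr : r x u
      · exact Or.inl (h.equiv.trans hzx hr)
      · exact Or.inr ⟨k, hr⟩

end IsCubic

end

/-! ### Chains with elements left out; the tree of the Voronoi diagram -/

noncomputable section

/-- Consecutive kept elements remain joined by a chain through the omitted ones. `N` collects the
elements omitted since the last kept one. -/
theorem List.IsChain.filter_gaps {D : Type*} {R : D → D → Prop} {p : D → Prop} {a b : D}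
    {N l : List D} (h : (a :: (N ++ l) ++ [b]).IsChain R) (hN : ∀ n ∈ N, ¬ p n) (ha : p a)
    (hb : p b) :
    (a :: l.filter (fun x => p x) ++ [b]).IsChain fun x y => p x ∧ p y ∧
      ∃ N, (x :: N ++ [y]).IsChain R ∧ ∀ n ∈ N, ¬ p n := by
  induction l generalizing a N with
  | nil =>
    simp only [List.filter_nil, List.cons_append, List.nil_append, List.isChain_cons_cons,
      List.isChain_singleton, and_true]
    exact ⟨ha, hb, N, by simpa using h, hN⟩
  | cons x l ih =>
    by_cases hx : p x
    · have h1 : a :: (N ++ x :: l) ++ [b] = (a :: N) ++ x :: (l ++ [b]) := by simp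
      rw [h1, List.isChain_split] at h
      have h2 := ih (a := x) (N := []) (by simpa using h.2) (by simp) hx
      rw [List.filter_cons_of_pos (by simpa using hx)]
      simp only [List.cons_append, List.isChain_cons_cons] at h2 ⊢
      exact ⟨⟨ha, hx, N, h.1, hN⟩, h2⟩
    · rw [List.filter_cons_of_neg (by simpa using hx)]
      refine ih (N := N ++ [x]) (by simpa using h) ?_ ha
      intro n hn
      rcases List.mem_append.1 hn with h1 | h1
      · exact hN n h1
      · rw [List.mem_singleton.1 h1]
        exact hx

theorem CycChain.filter {D : Type*} {R : D → D → Prop} {p : D → Prop} {L : List D}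
    (h : CycChain R L) {a : D} (ha : a ∈ L) (hpa : p a) :
    CycChain (fun x y => p x ∧ p y ∧ ∃ N, (x :: N ++ [y]).IsChain R ∧ ∀ n ∈ N, ¬ p n)
      (L.filter fun x => p x) := by
  obtain ⟨P, Q, rfl⟩ := List.append_of_mem ha
  have h1 : (P ++ a :: Q).IsRotated (a :: (Q ++ P)) := by
    have := List.isRotated_append (l := P) (l' := a :: Q)
    simpa using this
  refine ⟨a, (Q ++ P).filter fun x => p x, ?_, ?_⟩
  · rw [List.filter_append, List.filter_append, List.filter_cons_of_pos (by simpa using hpa)]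
    have := List.isRotated_append (l := P.filter fun x => p x)
      (l' := a :: Q.filter fun x => p x)
    simpa using this
  · exact List.IsChain.filter_gaps (N := []) (by simpa using (h.isRotated h1).isChain) (by simp)
      hpa hpa

theorem CycChain.map {S D : Type*} {R : D → D → Prop} {f : S → D} {L : List S}
    (h : CycChain (fun x y => R (f x) (f y)) L) : CycChain R (L.map f) := by
  obtain ⟨a, l, h1, h2⟩ := h
  refine ⟨f a, l.map f, by simpa using h1.map f, ?_⟩
  have := (List.isChain_map f (R := R) (l := a :: l ++ [a])).2 h2
  simpa using this

theorem CycChain.imp {D : Type*} {R R' : D → D → Prop} {L : List D} (h : CycChain R L)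
    (hR : ∀ a b, R a b → R' a b) : CycChain R' L := by
  obtain ⟨a, l, h1, h2⟩ := h
  exact ⟨a, l, h1, h2.imp hR⟩

namespace EmbeddedGraph

variable {V D : Type*} {K : EmbeddedGraph V D} {h : D} {site : V → V} [Fintype D]

/-! ### Potentials -/

theorem sum_count_mul {D : Type*} [Fintype D] (Γ : D → ZMod 2) (γ : List D) :
    ∑ d, (γ.count d : ZMod 2) * Γ d = (γ.map Γ).sum := by
  induction γ with
  | nil => simp
  | cons e γ ih =>
    have : ∀ d, ((e :: γ).count d : ZMod 2) * Γ d =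
        (γ.count d : ZMod 2) * Γ d + if d = e then Γ d else 0 := by
      intro d
      rw [List.count_cons]
      by_cases hd : d = e
      · subst hd
        simp
        ring
      · simp [hd, Ne.symm hd]
    simp only [this, Finset.sum_add_distrib, ih]
    simp [add_comm]

/-- Stokes' theorem modulo two: a closed walk is the sum of the boundaries of the triangles that it
encloses. -/
theorem IsDisc.sum_closed (hK : K.IsDisc h) {Γ : D → ZMod 2} (hs : ∀ d, Γ (K.rev d) = Γ d)
    (ht : ∀ d, ¬ K.SameFace h d → Γ d + Γ (K.next d) + Γ (K.next (K.next d)) = 0) {u : V}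
    {γ : List D} (hγ : K.IsWalk u γ u) : (γ.map Γ).sum = 0 := by
  obtain ⟨col, hc⟩ := hK.map.exists_coloring h γ fun w => by
    rw [starSum_crossings hK.map.rev_rev hγ, CharTwo.add_self_eq_zero]
  have h1 : ∑ d, col d * Γ d = 0 := by
    have e1 : ∑ d, col d * Γ d = ∑ d, col d * Γ (K.next d) := by
      rw [← Equiv.sum_comp K.next]
      simp only [hc.next]
    have e2 : ∑ d, col d * Γ (K.next d) = ∑ d, col d * Γ (K.next (K.next d)) := by
      rw [← Equiv.sum_comp K.next]
      simp only [hc.next]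
    -- Each dart occurs in three summands, which counts as one modulo two. The outer face
    -- contributes nothing since its colour is zero.
    have e3 : ∑ d, col d * (Γ d + Γ (K.next d) + Γ (K.next (K.next d))) = 0 := by
      refine Finset.sum_eq_zero fun d _ => ?_
      by_cases hd : K.SameFace h d
      · rw [hc.sameFace hd, hc.zero, zero_mul]
      · rw [ht d hd, mul_zero]
    simp only [mul_add, Finset.sum_add_distrib] at e3
    rw [← e2, ← e1] at e3
    grind
  rw [← sum_count_mul]
  have o := Fintype.equivFin D
  rw [← sum_half K.rev hK.map.rev_rev hK.map.rev_ne o] at h1 ⊢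
  rw [← h1]
  refine Finset.sum_congr rfl fun e _ => ?_
  rw [hs, hc.rev, crossings]
  push_cast
  grind

/-- A disc is simply connected, so a function that is closed on every triangle is a difference of
values at vertices. -/
theorem IsDisc.exists_potential (hK : K.IsDisc h) {Γ : D → ZMod 2} (hs : ∀ d, Γ (K.rev d) = Γ d)
    (ht : ∀ d, ¬ K.SameFace h d → Γ d + Γ (K.next d) + Γ (K.next (K.next d)) = 0) :
    ∃ f : V → ZMod 2, ∀ d, f (K.tgt d) = f (K.src d) + Γ d := by
  choose w hw using fun v => hK.map.connected (K.src h) v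
  refine ⟨fun v => ((w v).map Γ).sum, fun d => ?_⟩
  obtain ⟨q, hq⟩ := hK.map.connected (K.tgt d) (K.src h)
  have e1 := hK.sum_closed hs ht ((hw (K.tgt d)).append hq)
  have e2 := hK.sum_closed hs ht ((hw (K.src d)).append (q := d :: q) ⟨rfl, hq⟩)
  simp only [List.map_append, List.map_cons, List.sum_append, List.sum_cons] at e1 e2
  grind

theorem IsDisc.sameFace_iff (hK : K.IsDisc h) {a b : D} (ha : ¬ K.SameFace h a) :
    K.SameFace a b ↔ b = a ∨ b = K.next a ∨ b = K.next (K.next a) := by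
  have h0 : K.SameFace a a := Equiv.Perm.SameCycle.refl _ _
  constructor
  · intro hab
    obtain ⟨k, -, rfl⟩ := Equiv.Perm.SameCycle.exists_pow_eq' hab
    clear hab
    induction k with
    | zero => simp
    | succ k ih =>
      rw [pow_succ', Equiv.Perm.mul_apply]
      rcases ih with h1 | h1 | h1 <;> rw [h1]
      · simp
      · simp
      · rw [hK.triangle a ha]
        simp
  · rintro (rfl | rfl | rfl)
    · exact h0
    · exact h0.next
    · exact h0.next.next

namespace IsCells

variable (hK : K.IsCells h site)
include hK

theorem eq_of_crossing {β : Type*} {f : V → β}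
    (hf : ∀ d, ¬ K.Crossing site d → f (K.tgt d) = f (K.src d)) (z : V) : f z = f (site z) := by
  obtain ⟨p, hp, hc⟩ := hK.path z
  have key : ∀ (p : List D) (u : V), K.IsWalk u p z → (∀ y ∈ K.support u p, site y = site z) →
      f z = f u := by
    intro p
    induction p with
    | nil =>
      intro u hu _
      rw [show u = z from hu]
    | cons d p ih =>
      rintro u ⟨rfl, hp⟩ hc
      rw [ih _ hp fun y hy => hc y (List.mem_cons_of_mem _ hy)]
      refine hf d fun hd => hd ?_
      rw [hc _ (start_mem_support _ _), hc _ (tgt_mem_support List.mem_cons_self)]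
  exact key p _ hp fun y hy => by rw [hc y hy]

theorem next_ne_of_crossing {a : D} (ha : K.Crossing site a) : K.next a ≠ a := by
  intro h1
  apply ha
  rw [← hK.map.src_next, h1]

/-- The possible positions of the cells at the corners of a triangle. -/
theorem triangle_cases {a : D} (ha : K.Crossing site a) (hf : ¬ K.SameFace h a) :
    (K.vorCross site (K.rev a) = K.next a ∧ K.vorCross site (K.rev (K.next a)) = a ∧
      ¬ K.Crossing site (K.next (K.next a))) ∨
    (K.vorCross site (K.rev a) = K.next (K.next a) ∧
      K.vorCross site (K.rev (K.next (K.next a))) = a ∧ ¬ K.Crossing site (K.next a)) ∨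
    (K.IsVorVertex h site a ∧ K.vorCross site (K.rev a) = K.next (K.next a) ∧
      K.vorCross site (K.rev (K.next (K.next a))) = K.next a ∧
      K.vorCross site (K.rev (K.next a)) = a) := by
  have t := hK.triangle a hf
  have hs : ∀ b, site (K.tgt b) = site (K.src (K.next b)) := fun b => by rw [hK.map.src_next]
  have ha' : site (K.src a) ≠ site (K.src (K.next a)) := by rw [← hs]; exact ha
  have hp := hK.prev_eq hf
  have hp2 : K.next.symm (K.next (K.next a)) = K.next a := by simp
  by_cases h1 : site (K.src (K.next (K.next a))) = site (K.src a)
  · left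
    refine ⟨?_, ?_, ?_⟩
    · rw [vorCross, hK.map.rev_rev, hK.map.tgt_rev, hp, if_pos h1]
    · rw [vorCross, hK.map.rev_rev, hK.map.tgt_rev, Equiv.symm_apply_apply, if_neg ha']
    · rw [Crossing, hs, t, not_not]
      exact h1
  · by_cases h2 : site (K.src (K.next a)) = site (K.src (K.next (K.next a)))
    · right; left
      refine ⟨?_, ?_, ?_⟩
      · rw [vorCross, hK.map.rev_rev, hK.map.tgt_rev, hp, if_neg h1]
      · rw [vorCross, hK.map.rev_rev, hK.map.tgt_rev, Equiv.symm_apply_apply, if_pos h2, t]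
      · rw [Crossing, hs, not_not]
        exact h2
    · right; right
      have hv : K.IsVorVertex h site a := ⟨hf, ha', h2, h1⟩
      refine ⟨hv, ?_, ?_, ?_⟩
      · rw [hK.vorCross_rev_of_isVorVertex hv, hp]
      · rw [hK.vorCross_rev_of_isVorVertex ((isVorVertex_next hK.toIsDisc).2
          ((isVorVertex_next hK.toIsDisc).2 hv)), hp2]
      · rw [hK.vorCross_rev_of_isVorVertex ((isVorVertex_next hK.toIsDisc).2 hv),
          Equiv.symm_apply_apply]

omit hK [Fintype D] in
/-- The darts of triangles between different cells. -/
abbrev _root_.EmbeddedGraph.InnerDart (K : EmbeddedGraph V D) (h : D) (site : V → V) : Type _ :=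
  {a // K.Crossing site a ∧ ¬ K.SameFace h a}

/-- Go around a triangle. -/
def turn : Equiv.Perm (K.InnerDart h site) :=
  Equiv.ofBijective (fun a => ⟨K.vorCross site (K.rev a),
    hK.crossing_vorCross (hK.crossing_rev.2 a.2.1), fun h1 => a.2.2 (by
      rw [hK.sameFace_vorCross_iff, hK.map.rev_rev] at h1
      exact h1)⟩)
    (Finite.injective_iff_bijective.1 fun a b hab => Subtype.ext (K.rev.injective
      (hK.vorCross_injOn (hK.crossing_rev.2 a.2.1) (hK.crossing_rev.2 b.2.1)
        (congrArg Subtype.val hab))))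

theorem coe_turn (a : K.InnerDart h site) : (hK.turn a : D) = K.vorCross site (K.rev a) := rfl

/-- Go to the other side of an edge, unless it is the outer face. -/
def flip (a : K.InnerDart h site) : K.InnerDart h site :=
  if hf : K.SameFace h (K.rev a) then a else ⟨K.rev a, hK.crossing_rev.2 a.2.1, hf⟩

theorem flip_of_sameFace {a : K.InnerDart h site} (hf : K.SameFace h (K.rev a)) :
    hK.flip a = a := dif_pos hf

theorem coe_flip {a : K.InnerDart h site} (hf : ¬ K.SameFace h (K.rev a)) :
    (hK.flip a : D) = K.rev a := by rw [flip, dif_neg hf]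

theorem flip_eq {a : K.InnerDart h site} {d : D} (hd : d = K.rev a)
    (h1 : K.Crossing site d ∧ ¬ K.SameFace h d) : hK.flip a = ⟨d, h1⟩ := by
  subst hd
  exact dif_neg h1.2

/-- The orbits of `turn` are the triangles that meet two or three cells, with their darts between
different cells; `flip` joins triangles across such darts. -/
theorem isCubic : IsCubic hK.turn hK.flip (fun a b => K.SameFace a b)
    (fun a => K.IsVorVertex h site a) where
  ne a h1 := by
    have h2 : K.vorCross site (K.rev a) = a := congrArg Subtype.val h1
    have n1 := hK.next_ne_of_crossing a.2.1
    have n2 : K.next (K.next a) ≠ a := fun k => n1 (by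
      have := hK.triangle a a.2.2
      rwa [k] at this)
    rcases hK.triangle_cases a.2.1 a.2.2 with k | k | k
    · exact n1 (k.1.symm.trans h2)
    · exact n2 (k.1.symm.trans h2)
    · exact n2 (k.2.1.symm.trans h2)
  small a := by
    rcases hK.triangle_cases a.2.1 a.2.2 with k | k | k
    · exact .inl (Subtype.ext (by rw [coe_turn, coe_turn, k.1, k.2.1]))
    · exact .inl (Subtype.ext (by rw [coe_turn, coe_turn, k.1, k.2.1]))
    · exact .inr (Subtype.ext (by rw [coe_turn, coe_turn, coe_turn, k.2.1, k.2.2.1, k.2.2.2]))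
  invol a := by
    by_cases hf : K.SameFace h (K.rev a)
    · rw [hK.flip_of_sameFace hf, hK.flip_of_sameFace hf]
    · have h1 : K.rev (hK.flip a) = a := by rw [hK.coe_flip hf, hK.map.rev_rev]
      exact Subtype.ext (by rw [hK.coe_flip (by rw [h1]; exact a.2.2), h1])
  equiv := ⟨fun _ => Equiv.Perm.SameCycle.refl _ _, fun h1 => Equiv.Perm.SameCycle.symm h1,
    fun h1 h2 => Equiv.Perm.SameCycle.trans h1 h2⟩
  rel_iff a b := by
    rw [hK.sameFace_iff a.2.2, Subtype.ext_iff, Subtype.ext_iff, Subtype.ext_iff, coe_turn,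
      coe_turn, coe_turn]
    rcases hK.triangle_cases a.2.1 a.2.2 with k | k | k
    · rw [k.1, k.2.1]
      have : (b : D) ≠ K.next (K.next a) := fun h1 => k.2.2 (h1 ▸ b.2.1)
      tauto
    · rw [k.1, k.2.1]
      have : (b : D) ≠ K.next a := fun h1 => k.2.2 (h1 ▸ b.2.1)
      tauto
    · rw [k.2.1, k.2.2.1]
      tauto
  of_ne a h1 := by
    rcases hK.triangle_cases a.2.1 a.2.2 with k | k | k
    · exact absurd (Subtype.ext (by rw [coe_turn, coe_turn, k.1, k.2.1])) h1
    · exact absurd (Subtype.ext (by rw [coe_turn, coe_turn, k.1, k.2.1])) h1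
    · exact k.1

/-- A dual cycle off the hole has a potential on the vertices. It is constant on each cell, and
constant along the hole, whose edges are not used. As each cell reaches the hole, the potential is
constant and the cycle is zero. -/
theorem acyclic (g : K.InnerDart h site → ZMod 2) (h1 : ∀ x, g (hK.flip x) = g x)
    (h2 : ∀ x, hK.flip x = x → g x = 0)
    (h3 : ∀ x : K.InnerDart h site, ∑ y ∈ Finset.univ.filter (fun y : K.InnerDart h site => K.SameFace x y), g y = 0)
    (x : K.InnerDart h site) : g x = 0 := by
  let Γ : D → ZMod 2 := fun d => if hd : K.Crossing site d ∧ ¬ K.SameFace h d then g ⟨d, hd⟩ else 0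
  have hΓ : ∀ y : K.InnerDart h site, Γ y = g y := fun y => dif_pos y.2
  have hΓ0 : ∀ d, ¬ (K.Crossing site d ∧ ¬ K.SameFace h d) → Γ d = 0 := fun d hd => dif_neg hd
  have hz : ∀ d, K.SameFace h (K.rev d) → Γ d = 0 := by
    intro d hd
    by_cases hc : K.Crossing site d ∧ ¬ K.SameFace h d
    · have e1 := hΓ ⟨d, hc⟩
      rw [h2 _ (hK.flip_of_sameFace hd)] at e1
      exact e1
    · exact hΓ0 d hc
  have hs : ∀ d, Γ (K.rev d) = Γ d := by
    intro d
    by_cases hd : K.SameFace h d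
    · rw [hΓ0 d fun k => k.2 hd, hz]
      rwa [hK.map.rev_rev]
    by_cases hr : K.SameFace h (K.rev d)
    · rw [hz d hr, hΓ0 _ fun k => k.2 hr]
    by_cases hc : K.Crossing site d
    · have e1 := hΓ ⟨d, hc, hd⟩
      have e2 := hΓ ⟨K.rev d, hK.crossing_rev.2 hc, hr⟩
      exact e2.trans ((congrArg g (hK.flip_eq (a := ⟨d, hc, hd⟩) rfl _)).symm.trans
        ((h1 _).trans e1.symm))
    · rw [hΓ0 d fun k => hc k.1, hΓ0 _ fun k => hc (hK.crossing_rev.1 k.1)]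
  have htri : ∀ x : K.InnerDart h site, Γ x + Γ (K.next x) + Γ (K.next (K.next x)) = 0 := by
    intro x
    have n1 := hK.next_ne_of_crossing x.2.1
    have n2 : K.next (K.next x) ≠ x := fun k => n1 (by
      have := hK.triangle x x.2.2
      rwa [k] at this)
    rw [← h3 x]
    have e1 : ∑ y ∈ Finset.univ.filter (fun y : K.InnerDart h site => K.SameFace x y), g y =
        ∑ d, if K.SameFace x d then Γ d else 0 := by
      have e2 : ∑ d ∈ Finset.univ.filter (fun d => K.Crossing site d ∧ ¬ K.SameFace h d),
          (if K.SameFace x d then Γ d else 0) = ∑ d, if K.SameFace x d then Γ d else 0 := by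
        refine Finset.sum_subset (Finset.subset_univ _) fun d _ hd => ?_
        rw [hΓ0 d (by simpa using hd)]
        simp
      rw [← e2, Finset.sum_subtype (p := fun d => K.Crossing site d ∧ ¬ K.SameFace h d) _ (by simp),
        Finset.sum_filter]
      refine Finset.sum_congr rfl fun y _ => ?_
      rw [hΓ]
    have e3 : (Finset.univ.filter fun d => K.SameFace x d) =
        {(x : D), K.next x, K.next (K.next x)} := by
      ext d
      simp [hK.sameFace_iff x.2.2]
    rw [e1, ← Finset.sum_filter, e3, Finset.sum_insert, Finset.sum_insert, Finset.sum_singleton,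
      add_assoc]
    · simpa using fun k : x.1 = _ => n1 k.symm
    · simp only [Finset.mem_insert, Finset.mem_singleton, not_or]
      exact ⟨n1.symm, n2.symm⟩
  -- A triangle that meets only one cell has no contribution; any other one may be read off starting
  -- at a dart between different cells.
  have ht : ∀ d, ¬ K.SameFace h d → Γ d + Γ (K.next d) + Γ (K.next (K.next d)) = 0 := by
    intro d hd
    have hn : ¬ K.SameFace h (K.next d) := fun k => hd (sameFace_next_iff.1 k)
    have hnn : ¬ K.SameFace h (K.next (K.next d)) := fun k => hn (sameFace_next_iff.1 k)
    by_cases c1 : K.Crossing site d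
    · exact htri ⟨d, c1, hd⟩
    by_cases c2 : K.Crossing site (K.next d)
    · have := htri ⟨_, c2, hn⟩
      simp only [hK.triangle d hd] at this
      rw [← this]
      ring
    by_cases c3 : K.Crossing site (K.next (K.next d))
    · have := htri ⟨_, c3, hnn⟩
      simp only [hK.triangle d hd] at this
      rw [← this]
      ring
    · rw [hΓ0 _ fun k => c1 k.1, hΓ0 _ fun k => c2 k.1, hΓ0 _ fun k => c3 k.1]
      simp
  obtain ⟨f, hf⟩ := hK.exists_potential hs ht
  have hcell := hK.eq_of_crossing (f := f) fun d hd => by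
    rw [hf, hΓ0 d fun k => hd k.1, add_zero]
  have hbd : ∀ k, f (K.src ((K.next ^ k) h)) = f (K.src h) := by
    intro k
    induction k with
    | zero => rfl
    | succ k ih =>
      rw [pow_succ', Equiv.Perm.mul_apply, hK.map.src_next, hf, ih,
        hΓ0 _ fun k' => k'.2 (sameFace_pow h k), add_zero]
  have hconst : ∀ z, f z = f (K.src h) := by
    intro z
    obtain ⟨e, he, hez⟩ := hK.site_mem z
    obtain ⟨k, -, rfl⟩ := exists_pow_of_sameFace he
    rw [hcell, ← hez, hbd]
  have := hf x
  rw [hconst, hconst (K.src x), hΓ] at this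
  simpa using this

/-- The edges on the boundary of a single cell belong to `Z` all or none, since the other cells are
joined along the rest of the hole. Neighbouring cells on the hole share an edge of the hole, so the
alternative is the same for all cells. -/
theorem connected_inner (Z : Finset (K.InnerDart h site)) (hne : Z.Nonempty)
    (hτ : ∀ x ∈ Z, hK.turn x ∈ Z) (hα : ∀ x ∈ Z, hK.flip x ∈ Z) (x : K.InnerDart h site) :
    x ∈ Z := by
  let P : D → Prop := fun d => ∃ x ∈ Z, (x : D) = d ∨ (x : D) = K.rev d
  have hPrev : ∀ d, P (K.rev d) ↔ P d := by
    intro d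
    refine exists_congr fun x => and_congr_right fun _ => ?_
    rw [hK.map.rev_rev]
    exact or_comm
  have hP : ∀ x : K.InnerDart h site, P x ↔ x ∈ Z := by
    intro x
    refine ⟨?_, fun hx => ⟨x, hx, .inl rfl⟩⟩
    rintro ⟨y, hy, h1 | h1⟩
    · rwa [← Subtype.ext h1]
    · have : hK.flip y = x := hK.flip_eq (by rw [h1, hK.map.rev_rev]) x.2
      rw [← this]
      exact hα y hy
  have hrel : ∀ x y : K.InnerDart h site, K.SameFace x y → (P x ↔ P y) := by
    have key : ∀ x y : K.InnerDart h site, K.SameFace x y → x ∈ Z → y ∈ Z := by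
      intro x y hxy hx
      rcases (hK.isCubic.rel_iff x y).1 hxy with rfl | rfl | rfl
      · exact hx
      · exact hτ _ hx
      · exact hτ _ (hτ _ hx)
    intro x y hxy
    rw [hP, hP]
    exact ⟨key x y hxy, key y x (Equiv.Perm.SameCycle.symm hxy)⟩
  have main : ∀ e, K.SameFace h e → ∀ d, K.Crossing site d →
      (site (K.src d) = K.src e ∨ site (K.tgt d) = K.src e) → (P d ↔ P e) := by
    intro e he
    set c := K.src e with hc
    -- `Γ` is the boundary of the cell of `c`, restricted to the edges that belong to `Z`. It is
    -- closed because membership in `Z` is constant on the relevant edges of a triangle.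
    let i : V → ZMod 2 := fun z => if site z = c then 1 else 0
    let Γ : D → ZMod 2 := fun d => if P d then i (K.src d) + i (K.tgt d) else 0
    have hΓ0 : ∀ d, ¬ K.Crossing site d → Γ d = 0 := by
      intro d hd
      have hd' : site (K.src d) = site (K.tgt d) := not_not.1 hd
      by_cases hp : P d
      · simp only [Γ, if_pos hp, i, hd', CharTwo.add_self_eq_zero]
      · exact if_neg hp
    have hs : ∀ d, Γ (K.rev d) = Γ d := by
      intro d
      simp only [Γ, hPrev, hK.map.tgt_rev]
      rw [add_comm]
      rfl
    have ht : ∀ d, ¬ K.SameFace h d → Γ d + Γ (K.next d) + Γ (K.next (K.next d)) = 0 := by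
      intro d hd
      have hn : ¬ K.SameFace h (K.next d) := fun k => hd (sameFace_next_iff.1 k)
      have hnn : ¬ K.SameFace h (K.next (K.next d)) := fun k => hn (sameFace_next_iff.1 k)
      have hff : ∀ x y, K.SameFace d x → K.SameFace d y → K.Crossing site x →
          K.Crossing site y → (P x ↔ P y) := fun x y hx hy cx cy =>
        hrel ⟨x, cx, fun k => hd (k.trans hx.symm)⟩ ⟨y, cy, fun k => hd (k.trans hy.symm)⟩
          (hx.symm.trans hy)
      have f0 : K.SameFace d d := Equiv.Perm.SameCycle.refl _ _
      have hval : ∀ q : Prop, (∀ x, K.SameFace d x → K.Crossing site x → (P x ↔ q)) →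
          ∀ x, K.SameFace d x → Γ x = if q then i (K.src x) + i (K.tgt x) else 0 := by
        intro q hq x hx
        by_cases cx : K.Crossing site x
        · simp only [Γ, hq x hx cx]
        · rw [hΓ0 x cx]
          have : i (K.src x) = i (K.tgt x) := by
            simp only [i, not_not.1 cx]
          rw [this, CharTwo.add_self_eq_zero, ite_self]
      obtain ⟨q, hq⟩ : ∃ q : Prop, ∀ x, K.SameFace d x → K.Crossing site x → (P x ↔ q) := by
        by_cases hex : ∃ x, K.SameFace d x ∧ K.Crossing site x
        · obtain ⟨y, hy, cy⟩ := hex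
          exact ⟨P y, fun x hx cx => hff x y hx hy cx cy⟩
        · exact ⟨True, fun x hx cx => absurd ⟨x, hx, cx⟩ hex⟩
      rw [hval q hq d f0, hval q hq _ f0.next, hval q hq _ f0.next.next]
      by_cases hq' : q
      · simp only [if_pos hq']
        rw [← hK.map.src_next, ← hK.map.src_next (K.next d), ← hK.map.src_next (K.next (K.next d)),
          hK.triangle d hd]
        grind
      · simp only [if_neg hq', add_zero]
    obtain ⟨f, hf⟩ := hK.exists_potential hs ht
    have hcell := hK.eq_of_crossing (f := f) fun d hd => by
      rw [hf, hΓ0 d hd, add_zero]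
    -- The hole without `c` is a path on which `Γ` vanishes, so the potential is the same on all
    -- other cells.
    have hout : ∀ k, k + 1 < K.bsize e → f (K.src ((K.next ^ (k + 1)) e)) = f (K.src (K.next e)) := by
      intro k
      induction k with
      | zero => intro _; rfl
      | succ k ih =>
        intro hk
        rw [pow_succ', Equiv.Perm.mul_apply, hK.map.src_next, hf, ih (by omega)]
        have hne : ∀ j, 0 < j → j < K.bsize e → site (K.src ((K.next ^ j) e)) ≠ c := by
          intro j h0 hj k'
          have hfe : K.SameFace h ((K.next ^ j) e) := he.trans (sameFace_pow e j)
          rw [hK.site_self _ hfe] at k'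
          exact (K.exists_bsize e).2.2 j h0 hj (hK.simple _ _ hfe he k')
        have e1 := hne (k + 1) (by omega) (by omega)
        have e2 := hne (k + 1 + 1) (by omega) (by omega)
        rw [pow_succ', Equiv.Perm.mul_apply, hK.map.src_next] at e2
        have : Γ ((K.next ^ (k + 1)) e) = 0 := by
          simp only [Γ, i, if_neg e1, if_neg e2, add_zero, ite_self]
        rw [this, add_zero]
    have hother : ∀ z, site z ≠ c → f z = f (K.src (K.next e)) := by
      intro z hz
      obtain ⟨e', he', hez⟩ := hK.site_mem z
      obtain ⟨k, hk, rfl⟩ := exists_pow_of_sameFace (he.symm.trans he')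
      rw [hcell, ← hez]
      cases k with
      | zero => exact absurd hez.symm hz
      | succ k => exact hout k hk
    have hin : ∀ z, site z = c → f z = f c := by
      intro z hz
      rw [hcell, hz]
    -- Across each boundary edge of the cell the potential jumps by the same amount, which is one
    -- exactly if the edge belongs to `Z`.
    have hd : ∀ d, K.Crossing site d → (site (K.src d) = c ∨ site (K.tgt d) = c) →
        (if P d then 1 else 0 : ZMod 2) = f c + f (K.src (K.next e)) := by
      intro d hd hor
      have e1 := hf d
      have e2 : Γ d = if P d then 1 else 0 := by
        rcases hor with k | k
        · have : site (K.tgt d) ≠ c := fun k' => hd (k.trans k'.symm)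
          simp [Γ, i, k, this]
        · have : site (K.src d) ≠ c := fun k' => hd (k'.trans k.symm)
          simp [Γ, i, k, this]
      rw [← e2]
      rcases hor with k | k
      · have : site (K.tgt d) ≠ c := fun k' => hd (k.trans k'.symm)
        rw [hin _ k, hother _ this] at e1
        grind
      · have : site (K.src d) ≠ c := fun k' => hd (k'.trans k.symm)
        rw [hin _ k, hother _ this] at e1
        grind
    intro d hcd hor
    have e1 := hd d hcd hor
    have e2 := hd e (hK.crossing_of_sameFace he) (.inl (hK.site_self e he))
    rw [← e2] at e1
    by_cases p1 : P d <;> by_cases p2 : P e <;> simp [p1, p2] at e1 ⊢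
  -- A dart of the hole lies on the boundaries of the cells at both of its ends.
  have hnext : ∀ e, K.SameFace h e → (P e ↔ P (K.next e)) := fun e he =>
    main _ he.next e (hK.crossing_of_sameFace he)
      (.inr (by rw [← hK.map.src_next, hK.site_self _ he.next]))
  have hall : ∀ e, K.SameFace h e → (P e ↔ P h) := by
    intro e he
    obtain ⟨k, -, rfl⟩ := exists_pow_of_sameFace he
    clear he
    induction k with
    | zero => rfl
    | succ k ih => rw [pow_succ', Equiv.Perm.mul_apply, ← hnext _ (sameFace_pow h k), ih]
  have hinner : ∀ y : K.InnerDart h site, P y ↔ P h := by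
    intro y
    obtain ⟨e, he, hes⟩ := hK.site_mem (K.src y)
    rw [main e he y y.2.1 (.inl hes.symm), hall e he]
  obtain ⟨y, hy⟩ := hne
  rw [← hP, hinner, ← hinner y, hP]
  exact hy

/-! ### The cyclic order of the corners of the Voronoi diagram -/

theorem not_sameFace_of_vorSteps {a e : D} (ha : K.IsVorVertex h site a)
    (hae : Relation.ReflTransGen (K.VorStep h site) a e) : ¬ K.SameFace h e := by
  rcases Relation.ReflTransGen.cases_tail hae with rfl | ⟨c, -, hc⟩
  · exact ha.1
  · rw [hc.2.1, hK.sameFace_vorCross_iff]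
    exact hc.1

/-- Go around a cell, and turn back at the outer face. -/
def _root_.EmbeddedGraph.CellStep (K : EmbeddedGraph V D) (h : D) (site : V → V) (u v : D) : Prop :=
  (K.SameFace h (K.rev u) ∧ v = K.vorCross site (K.rev u)) ∨
    (¬ K.SameFace h (K.rev u) ∧ v = K.vorCross site u)

/-- After turning at the hole, the tour retraces the Voronoi edge on its other side, until it is
back in the triangle of `a`, at the corner in the neighbouring cell. -/
theorem eq_prev_of_chain {a e b v : D} (ha : K.IsVorVertex h site a) (hb : K.IsVorVertex h site b)
    (hae : Relation.ReflTransGen (K.VorStep h site) a e) {N rest : List D}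
    (hN : ∀ n ∈ N, ¬ K.IsVorVertex h site n) (hv : N ++ [b] = v :: rest)
    (hve : v = K.vorCross site (K.rev e)) (hch : (N ++ [b]).IsChain (K.CellStep h site)) :
    b = K.next.symm a := by
  induction hae generalizing N rest v with
  | refl =>
    rw [hK.vorCross_rev_of_isVorVertex ha] at hve
    cases N with
    | nil =>
      obtain ⟨rfl, -⟩ := List.cons.inj hv
      exact hve
    | cons n N =>
      obtain ⟨rfl, -⟩ := List.cons.inj hv
      refine absurd ?_ (hN n (by simp))
      rw [hve]
      exact (isVorVertex_prev hK.toIsDisc).2 ha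
  | @tail f e haf hfe ih =>
    have hcf := (hK.vorSteps_site (hK.crossing_of_isVorVertex ha) haf).1
    obtain ⟨h1, rfl, h3⟩ := hfe
    rw [hK.vorCross_rev_vorCross hcf h1 h3] at hve
    have hvn : ¬ K.IsVorVertex h site v := by
      rw [hve, isVorVertex_congr hK.toIsDisc (hK.vorCross_sameFace f)]
      exact h3
    cases N with
    | nil =>
      obtain ⟨rfl, hr⟩ := List.cons.inj hv
      exact absurd hb hvn
    | cons n N =>
      obtain ⟨rfl, hr⟩ := List.cons.inj hv
      cases hN' : N ++ [b] with
      | nil => simp at hN'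
      | cons w rest' =>
        have hch2 := hch
        rw [List.cons_append, hN', List.isChain_cons_cons] at hch2
        refine ih (fun n hn => hN n (List.mem_cons_of_mem _ hn)) hN' ?_ (by rw [hN']; exact hch2.2)
        have hnf := hK.not_sameFace_of_vorSteps ha haf
        rcases hch2.1 with k | k
        · rw [hve, hK.map.rev_rev] at k
          exact absurd k.1 hnf
        · rw [k.2, hve]

/-- Between two consecutive corners of triangles with three cells, the tour follows one Voronoi
edge: it reaches the next such triangle, or turns at the hole and comes back. -/
theorem spokeNext_of_chain {a e b : D} (ha : K.IsVorVertex h site a) (hb : K.IsVorVertex h site b)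
    (hae : Relation.ReflTransGen (K.VorStep h site) a e) {N : List D}
    (hN : ∀ n ∈ N, ¬ K.IsVorVertex h site n)
    (hch : (e :: N ++ [b]).IsChain (K.CellStep h site)) : K.SpokeNext h site a b := by
  induction N generalizing e with
  | nil =>
    simp only [List.cons_append, List.nil_append, List.isChain_cons_cons, List.isChain_singleton,
      and_true] at hch
    rcases hch with k | k
    · exact ⟨e, hae, .inl ⟨k.1, hK.eq_prev_of_chain (N := []) ha hb hae (by simp) rfl k.2 (by simp)⟩⟩
    · exact ⟨e, hae, .inr ⟨k.1, k.2 ▸ hb, k.2⟩⟩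
  | cons n N ih =>
    simp only [List.cons_append, List.isChain_cons_cons] at hch
    rcases hch.1 with k | k
    · exact ⟨e, hae, .inl ⟨k.1, hK.eq_prev_of_chain ha hb hae hN rfl k.2 hch.2⟩⟩
    · exact ih (hae.tail ⟨k.1, k.2, hN n (by simp)⟩) (fun m hm => hN m (List.mem_cons_of_mem _ hm))
        hch.2

/-- The tour around the tree of triangles, restricted to the triangles that meet three cells. The
restriction is still nested, which the recursive decomposition needs. -/
theorem exists_isTriVor : ∃ L : List D, K.IsTriVor h site L ∧
    Fan K.SameFace (K.IsVorVertex h site) L := by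
  obtain ⟨a, ha, -⟩ := hK.exists_isVorVertex (Equiv.Perm.SameCycle.refl K.next h)
  let a' : K.InnerDart h site := ⟨a, hK.crossing_of_isVorVertex ha, ha.1⟩
  obtain ⟨F, hF, hnd, hmem, hcyc⟩ := hK.isCubic.exists_fan hK.acyclic Finset.univ ⟨a', by simp⟩
    (by simp) (fun Z _ hne h1 h2 => Finset.eq_univ_of_forall fun x =>
      hK.connected_inner Z hne h1 (fun y hy => h2 y hy (by simp)) x)
  have hF2 : Fan K.SameFace (K.IsVorVertex h site) (F.map Subtype.val) := hF.map _
  have hcyc2 : CycChain (K.CellStep h site) (F.map Subtype.val) := by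
    refine CycChain.map (hcyc.imp fun u v huv => ?_)
    rw [if_pos (Finset.mem_univ _)] at huv
    subst huv
    rw [coe_turn]
    by_cases hf : K.SameFace h (K.rev u)
    · exact .inl ⟨hf, by rw [hK.flip_of_sameFace hf]⟩
    · exact .inr ⟨hf, by rw [hK.coe_flip hf, hK.map.rev_rev]⟩
  have hmem2 : ∀ b, K.IsVorVertex h site b → b ∈ F.map Subtype.val := fun b hb =>
    List.mem_map.2 ⟨⟨b, hK.crossing_of_isVorVertex hb, hb.1⟩, by simp [hmem], rfl⟩
  refine ⟨(F.map Subtype.val).filter fun b => K.IsVorVertex h site b, ⟨?_, ?_, ?_⟩,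
    hF2.filter fun b c hbc => isVorVertex_congr hK.toIsDisc hbc⟩
  · exact (hnd.map Subtype.val_injective).filter _
  · intro b
    rw [List.mem_filter]
    exact ⟨fun k => of_decide_eq_true k.2, fun hb => ⟨hmem2 b hb, decide_eq_true hb⟩⟩
  · refine CycChain.getElem ((hcyc2.filter (hmem2 a ha) ha).imp fun u v huv => ?_)
    obtain ⟨hu, hv, N, hch, hN⟩ := huv
    exact hK.spokeNext_of_chain hu hv .refl hN hch

/-- Nested lists of corners have recursive decompositions. -/
theorem exists_decomposes {S : Type*} (name : V → S) (L F : List D)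
    (hF : Fan K.SameFace (K.IsVorVertex h site) F) (hLF : L.IsRotated F) (hnd : L.Nodup)
    (hL : ∀ a ∈ L, K.IsVorVertex h site a) : ∃ t, K.Decomposes h site name L t := by
  induction hn : L.length using Nat.strong_induction_on generalizing L F with
  | _ n ih =>
  rcases Nat.lt_or_ge 6 n with h6 | h6
  swap
  · exact ⟨_, .leaf L (by omega)⟩
  have hlen : F.length = n := by rw [← hn, hLF.perm.length_eq]
  obtain ⟨a, b, A, B, hab, hrot, hA, hB, ⟨F₁, hF₁, hr₁⟩, F₂, hF₂, hr₂⟩ :=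
    Fan.exists_balanced (r := K.SameFace) (X := []) (Y := [])
      ⟨fun _ => Equiv.Perm.SameCycle.refl _ _, fun h1 => Equiv.Perm.SameCycle.symm h1,
        fun h1 h2 => Equiv.Perm.SameCycle.trans h1 h2⟩ h6 hF (by simpa using hlen)
      (by omega) (fun G hG _ => by simpa using hG)
  have hrot' : L.IsRotated (a :: A ++ b :: B) := hLF.trans (by simpa using hrot)
  have hnd' := hrot'.perm.nodup_iff.1 hnd
  have hmem : ∀ x ∈ a :: A ++ b :: B, K.IsVorVertex h site x := fun x hx =>
    hL x (hrot'.perm.mem_iff.2 hx)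
  have hlen' : (a :: A ++ b :: B).length = n := by rw [← hn, hrot'.perm.length_eq]
  simp only [List.length_append, List.length_cons] at hlen'
  have hva := hmem a (by simp)
  have hne : b ≠ a := by
    rintro rfl
    simp at hnd'
  obtain ⟨l, hl⟩ := ih (a :: A ++ [b]).length (by simp; omega) (a :: A ++ [b]) F₁ hF₁ hr₁
    (hnd'.sublist (by simp)) (fun x hx => hmem x (by simp at hx ⊢; tauto)) rfl
  obtain ⟨r, hr⟩ := ih (b :: B ++ [a]).length (by simp; omega) (b :: B ++ [a]) F₂ hF₂ hr₂
    (by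
      have h1 : (b :: B ++ [a]).Perm (a :: b :: B) := by
        have := List.perm_append_comm (l₁ := b :: B) (l₂ := [a])
        simpa using this
      rw [h1.nodup_iff]
      exact hnd'.sublist (by simp))
    (fun x hx => hmem x (by simp at hx ⊢; tauto)) rfl
  obtain ⟨i, hi⟩ := hK.exists_pos a
  obtain ⟨j, hj⟩ := hK.exists_pos b
  -- The side of the triangle from the head of `a` to that of `b` is `b` itself or the reverse of
  -- `a`.
  have hedge : ∃ e, K.src e = K.tgt a ∧ K.tgt e = K.tgt b ∧
      (K.SameFace a e ∨ K.SameFace a (K.rev e)) := by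
    rcases (hK.sameFace_iff hva.1).1 hab with rfl | rfl | rfl
    · exact absurd rfl hne
    · exact ⟨_, hK.map.src_next a, rfl, .inl hab⟩
    · refine ⟨K.rev a, rfl, ?_, .inr ?_⟩
      · rw [hK.map.tgt_rev, ← hK.prev_eq hva.1, hK.map.tgt_prev]
      · rw [hK.map.rev_rev]
        exact Equiv.Perm.SameCycle.refl _ _
  obtain ⟨e, he⟩ := hedge
  rw [← hn] at hA hB
  exact ⟨_, .node L a b A B e i j l r (by omega) hrot' hab hA hB he hi hj hl hr⟩

end IsCells

end EmbeddedGraph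

end

/-! ### Preorder ranks and sectors of shortest path trees -/

noncomputable section

/-- In the lexicographic order, the words with a given prefix form an interval. -/
theorem List.isPrefix_of_between {α : Type*} [LinearOrder α] {p a b c : List α} (ha : p <+: a)
    (hc : p <+: c) (hab : a ≤ b) (hbc : b ≤ c) : p <+: b := by
  induction p generalizing a b c with
  | nil => exact List.nil_prefix
  | cons x p ih =>
    obtain ⟨a, rfl⟩ := ha
    obtain ⟨c, rfl⟩ := hc
    rw [← not_lt] at hab hbc
    cases b with
    | nil => exact absurd (List.nil_lt_cons _ _) hab
    | cons y b =>
      rw [List.cons_append, List.cons_lt_cons_iff, not_or, not_and] at hab hbc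
      obtain rfl : x = y := le_antisymm (not_lt.1 hab.1) (not_lt.1 hbc.1)
      exact List.cons_prefix_cons.2 ⟨rfl, ih (List.prefix_append _ _) (List.prefix_append _ _)
        (not_lt.1 (hab.2 rfl)) (not_lt.1 (hbc.2 rfl))⟩

/-- Convex sets are intervals of ranks. -/
theorem exists_ranks {V α : Type*} [Fintype V] [LinearOrder α] (key : V → α) (S : V → Set V)
    (hne : ∀ w, w ∈ S w) (hconv : ∀ w a b c, a ∈ S w → c ∈ S w → key a ≤ key b → key b ≤ key c →
      b ∈ S w) :
    ∃ pre lo hi : V → ℕ, (∀ v, pre v ≤ Fintype.card V ∧ lo v ≤ Fintype.card V ∧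
      hi v ≤ Fintype.card V) ∧ ∀ u w, u ∈ S w ↔ lo w ≤ pre u ∧ pre u ≤ hi w := by
  let pre : V → ℕ := fun v => (Finset.univ.filter fun u => key u < key v).card
  have hpre : ∀ v, pre v ≤ Fintype.card V := fun v => Finset.card_le_univ _
  have hmono : ∀ u v, pre u ≤ pre v ↔ key u ≤ key v := by
    intro u v
    constructor
    · intro h1
      by_contra h2
      rw [not_le] at h2
      refine absurd h1 (not_le.2 (Finset.card_lt_card ⟨?_, ?_⟩))
      · intro z hz
        simp only [Finset.mem_filter, Finset.mem_univ, true_and] at hz ⊢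
        exact hz.trans h2
      · intro h3
        have := h3 (Finset.mem_filter.2 ⟨Finset.mem_univ v, h2⟩)
        simp at this
    · intro h1
      refine Finset.card_le_card fun z hz => ?_
      simp only [Finset.mem_filter, Finset.mem_univ, true_and] at hz ⊢
      exact hz.trans_le h1
  have hmin : ∀ w, ∃ a ∈ S w, ∀ u ∈ S w, key a ≤ key u := fun w =>
    Set.exists_min_image _ key (Set.toFinite _) ⟨w, hne w⟩
  have hmax : ∀ w, ∃ a ∈ S w, ∀ u ∈ S w, key u ≤ key a := fun w =>
    Set.exists_max_image _ key (Set.toFinite _) ⟨w, hne w⟩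
  choose a ha ha' using hmin
  choose c hc hc' using hmax
  refine ⟨pre, fun w => pre (a w), fun w => pre (c w), fun v => ⟨hpre _, hpre _, hpre _⟩,
    fun u w => ?_⟩
  rw [hmono, hmono]
  exact ⟨fun h => ⟨ha' w u h, hc' w u h⟩, fun h => hconv w _ _ _ (ha w) (hc w) h.1 h.2⟩

namespace EmbeddedGraph

variable {V D : Type*} {K : EmbeddedGraph V D} {h : D}

/-! ### Membership in shortest paths -/

theorem support_append {u v : V} {p : List D} (hp : K.IsWalk u p v) (q : List D) :
    ∃ l, K.support u (p ++ q) = l ++ K.support v q := by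
  induction p generalizing u with
  | nil =>
    obtain rfl : u = v := hp
    exact ⟨[], rfl⟩
  | cons d p ih =>
    obtain ⟨l, hl⟩ := ih hp.2
    refine ⟨u :: l, ?_⟩
    rw [List.cons_append, List.cons_append, ← hl]
    rfl

/-- Read backwards, the shortest path of `u` is a word that spells the way from the root `x` to `u`.
Lying on this path is being a prefix, so sorting the words is a preorder of the tree, in which the
descendants of a vertex are consecutive. -/
theorem exists_intervals [Fintype V] (hu : K.UniqueShortestPaths) (x : V) :
    ∃ pre lo hi : V → ℕ, (∀ v, pre v ≤ Fintype.card V ∧ lo v ≤ Fintype.card V ∧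
      hi v ≤ Fintype.card V) ∧
      ∀ u w, w ∈ K.support u (K.sp u x) ↔ lo w ≤ pre u ∧ pre u ≤ hi w := by
  have o := Fintype.equivFin V
  let key : V → List (Fin (Fintype.card V)) := fun u => ((K.support u (K.sp u x)).map o).reverse
  have hkey : ∀ u w, w ∈ K.support u (K.sp u x) ↔ key w <+: key u := by
    intro u w
    rw [List.reverse_prefix]
    constructor
    · intro hw
      have h1 := sp_split hu hw
      obtain ⟨l, hl⟩ := support_append (sp_isWalk hu u w) (K.sp w x)
      rw [h1, hl, List.map_append]
      exact List.suffix_append _ _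
    · intro hw
      have h1 : o w ∈ (K.support u (K.sp u x)).map o :=
        hw.subset (List.mem_map_of_mem (start_mem_support _ _))
      obtain ⟨w', hw', h2⟩ := List.mem_map.1 h1
      rwa [← o.injective h2]
  refine exists_ranks key (fun w => {u | w ∈ K.support u (K.sp u x)})
    (fun w => start_mem_support _ _) ?_
  intro w a b c ha hc hab hbc
  have ha' := (hkey a w).1 ha
  have hc' := (hkey c w).1 hc
  exact (hkey b w).2 (List.isPrefix_of_between ha' hc' hab hbc)

/-! ### Sectors of a shortest path tree -/

/-- The dart is the first one on the shortest path to `x`. -/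
def TreeDart (K : EmbeddedGraph V D) (x : V) (d : D) : Prop :=
  K.sp (K.src d) x = d :: K.sp (K.tgt d) x

theorem treeDart_of_mem (hu : K.UniqueShortestPaths) {u x : V} {d : D} (hd : d ∈ K.sp u x) :
    K.TreeDart x d := by
  obtain ⟨p, q, hpq⟩ := List.append_of_mem hd
  have h1 := sp_isShortest hu u x
  rw [hpq] at h1
  obtain ⟨y, h2, h3⟩ := isWalk_append_iff.1 h1.1
  have h4 := (h1.of_append h2 h3).2
  obtain rfl : K.src d = y := h3.1
  have h5 := (IsShortest.of_append (p := [d]) h4 ⟨rfl, rfl⟩ h3.2).2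
  rw [TreeDart, ← h4.eq_sp hu, ← h5.eq_sp hu]

/-- A tree carries no cycle: at the tail of a dart of the cycle whose path to the root has the most
darts, that dart would be the only one of the cycle. -/
theorem eq_zero_of_tree [Fintype D] (hrr : ∀ d, K.rev (K.rev d) = d) {x : V} {z : D → ZMod 2}
    (hs : ∀ d, z (K.rev d) = z d)
    (ht : ∀ d, z d ≠ 0 → K.TreeDart x d ∨ K.TreeDart x (K.rev d)) (hz : ∀ v, K.starSum z v = 0)
    (d : D) : z d = 0 := by
  by_contra hd
  let S : Set D := {d | z d ≠ 0 ∧ K.TreeDart x d}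
  have hS : S.Nonempty := by
    rcases ht d hd with k | k
    · exact ⟨d, hd, k⟩
    · exact ⟨K.rev d, by rwa [hs], k⟩
  obtain ⟨e, ⟨he, het⟩, hmax⟩ := Set.exists_max_image S (fun d => (K.sp (K.src d) x).length)
    (Set.toFinite _) hS
  have h1 := hz (K.src e)
  rw [starSum, Finset.sum_eq_single e] at h1
  · simp at h1
    exact he h1
  · intro f _ hfe
    by_cases hf : K.src f = K.src e
    · rw [if_pos hf]
      by_contra hzf
      rcases ht f hzf with k | k
      · rw [TreeDart, hf, het] at k
        exact hfe (List.cons.inj k).1.symm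
      · have h2 := hmax (K.rev f) ⟨by rwa [hs], k⟩
        have h3 : K.tgt (K.rev f) = K.src e := by rw [tgt, hrr, hf]
        rw [TreeDart, h3] at k
        simp only [k, List.length_cons] at h2
        omega
    · rw [if_neg hf]
  · simp

theorem starSum_crossings_append [Fintype D] (p q : List D) (w : V) :
    K.starSum (fun d => (K.crossings (p ++ q) d : ZMod 2)) w =
      K.starSum (fun d => (K.crossings p d : ZMod 2)) w +
      K.starSum (fun d => (K.crossings q d : ZMod 2)) w := by
  rw [← starSum_add]
  simp only [crossings_append, Nat.cast_add]

/-- The closed walk formed by the shortest paths from the boundary vertices at positions `0` and `i`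
and by the part of the boundary between them. -/
def sector (K : EmbeddedGraph V D) (h : D) (x : V) (i : ℕ) : List D :=
  K.sp (K.bpos h i) x ++ (K.arc h 0 i ++ K.sp (K.bpos h 0) x)

theorem IsDisc.crossings_arc [Fintype D] (hK : K.IsDisc h) {q : ℕ} (hq : q < K.bsize h) {i : ℕ}
    (hi : i < K.bsize h) (j : ℕ) : K.crossings (K.arc h i j) ((K.next ^ q) h) =
      if (q + K.bsize h - i) % K.bsize h < (j + K.bsize h - i) % K.bsize h then 1 else 0 := by
  have h1 : K.rev ((K.next ^ q) h) ∉ K.arc h i j := fun h2 =>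
    hK.not_sameFace_rev (sameFace_pow h q) (sameFace_of_mem_arc h2)
  rw [crossings, List.count_eq_zero_of_not_mem h1, List.Nodup.count (arc_nodup h i j),
    if_congr (pow_mem_arc_iff hi hq j) rfl rfl, add_zero]

theorem crossings_rev (hrr : ∀ d, K.rev (K.rev d) = d) (γ : List D) (d : D) :
    K.crossings γ (K.rev d) = K.crossings γ d := by
  rw [crossings, crossings, hrr, add_comm]

theorem crossings_arc_eq_zero [Fintype D] {i j : ℕ} {d : D} (h1 : ¬ K.SameFace h d)
    (h2 : ¬ K.SameFace h (K.rev d)) : K.crossings (K.arc h i j) d = 0 :=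
  crossings_eq_zero (fun k => h1 (sameFace_of_mem_arc k)) (fun k => h2 (sameFace_of_mem_arc k))

theorem IsDisc.exists_sector_coloring [Fintype D] (hK : K.IsDisc h) (hu : K.UniqueShortestPaths)
    (x : V) {i : ℕ} : ∃ col, K.IsColoring h (K.sector h x i) col := by
  refine hK.map.exists_coloring h _ fun w => ?_
  rw [sector, starSum_crossings_append, starSum_crossings_append,
    starSum_crossings hK.map.rev_rev (sp_isWalk hu _ _),
    starSum_crossings hK.map.rev_rev (sp_isWalk hu _ _),
    starSum_crossings hK.map.rev_rev (hK.map.isWalk_arc (K.bsize_pos h) _)]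
  grind

/-- The sectors of the tree are nested. -/
theorem IsDisc.exists_sector [Fintype D] (hK : K.IsDisc h) (hu : K.UniqueShortestPaths) (x : V)
    {col : ℕ → D → ZMod 2} (hcol : ∀ i < K.bsize h, K.IsColoring h (K.sector h x i) (col i)) (d : D) :
    ∃ s ≤ K.bsize h, ∀ i < K.bsize h, col i d = if s < i then 1 else 0 := by
  -- `Q` holds for the faces with a threshold. The outer face has the trivial one, and it remains to
  -- pass from face to face.
  let Q : D → Prop := fun d => ∃ s ≤ K.bsize h, ∀ i < K.bsize h, col i d = if s < i then 1 else 0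
  have hQh : ∀ d, K.SameFace h d → Q d := by
    intro d hd
    refine ⟨K.bsize h, le_rfl, fun i hi => ?_⟩
    rw [(hcol i hi).sameFace hd, (hcol i hi).zero, if_neg (by omega)]
  have hnext : ∀ d, Q (K.next d) ↔ Q d := by
    intro d
    refine exists_congr fun s => and_congr_right fun _ => forall_congr' fun i =>
      forall_congr' fun hi => ?_
    rw [(hcol i hi).next]
  -- Edges off the tree do no harm: an inner one lies on no sector boundary, and the dart of the
  -- hole at position `q` lies on the arc from `0` to `i` exactly if `q < i`, which gives the
  -- threshold `q`.
  have hrev1 : ∀ d, ¬ K.TreeDart x d → ¬ K.TreeDart x (K.rev d) → Q d → Q (K.rev d) := by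
    rintro d t1 t2 ⟨s, hs, hsi⟩
    have htree : ∀ u, K.crossings (K.sp u x) d = 0 := fun u =>
      crossings_eq_zero (fun k => t1 (treeDart_of_mem hu k)) (fun k => t2 (treeDart_of_mem hu k))
    have hcr : ∀ i, K.crossings (K.sector h x i) d = K.crossings (K.arc h 0 i) d := by
      intro i
      rw [sector, crossings_append, crossings_append, htree, htree]
      omega
    by_cases hd : K.SameFace h d
    · obtain ⟨q, hq, rfl⟩ := exists_pow_of_sameFace hd
      refine ⟨q, hq.le, fun i hi => ?_⟩
      rw [(hcol i hi).rev, (hcol i hi).sameFace hd, (hcol i hi).zero, hcr,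
        hK.crossings_arc hq (K.bsize_pos h)]
      simp only [Nat.sub_zero, Nat.add_mod_right, Nat.mod_eq_of_lt hq, Nat.mod_eq_of_lt hi]
      split_ifs <;> simp
    by_cases hr : K.SameFace h (K.rev d)
    · exact hQh _ hr
    · refine ⟨s, hs, fun i hi => ?_⟩
      rw [(hcol i hi).rev, hcr, crossings_arc_eq_zero hd hr, hsi i hi]
      simp
  have hrev2 : ∀ d, ¬ K.TreeDart x d → ¬ K.TreeDart x (K.rev d) → (Q (K.rev d) ↔ Q d) := by
    intro d t1 t2
    refine ⟨fun k => ?_, hrev1 d t1 t2⟩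
    have := hrev1 (K.rev d) t2 (by rwa [hK.map.rev_rev]) k
    rwa [hK.map.rev_rev] at this
  let q : D → ZMod 2 := fun d => if Q d then 1 else 0
  -- So the edges at which `Q` changes all belong to the tree, and they form a cycle; hence there
  -- are none.
  have hz := eq_zero_of_tree (K := K) hK.map.rev_rev (x := x) (z := fun d => q d + q (K.rev d))
    (fun d => by rw [hK.map.rev_rev, add_comm]) (fun d hd => by
      by_contra hcon
      rw [not_or] at hcon
      apply hd
      simp only [q, hrev2 d hcon.1 hcon.2, CharTwo.add_self_eq_zero]) (fun v => by
      have h1 : ∀ d, q (K.rev d) = q (K.rot d) := fun d => by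
        simp only [q, rot_apply, hnext]
      simp only [h1]
      rw [starSum_add, starSum_rot hK.map.src_rot, CharTwo.add_self_eq_zero])
  have hinv := hK.map.eq_of_invariant (f := q) (fun d => by simp only [q, hnext])
    (fun d => by have := hz d; grind) d h
  have hQ : Q h := hQh h (Equiv.Perm.SameCycle.refl _ _)
  by_contra hcon
  have hcon' : ¬ Q d := hcon
  simp [q, hQ, hcon'] at hinv

/-- The colouring of the boundary of a box in terms of sectors. -/
theorem IsDisc.box_coloring [Fintype D] (hK : K.IsDisc h) {e : D} {A B E : D → ZMod 2} {i j : ℕ}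
    (hi : i < K.bsize h) (hj : j < K.bsize h)
    (hA : K.IsColoring h (K.sector h (K.src e) i) A) (hB : K.IsColoring h (K.sector h (K.tgt e) j) B)
    (hE : K.IsColoring h (K.sp (K.bpos h 0) (K.src e) ++ e :: K.sp (K.bpos h 0) (K.tgt e)) E) :
    K.IsColoring h (K.sp (K.bpos h i) (K.src e) ++ e :: (K.sp (K.bpos h j) (K.tgt e) ++ K.arc h i j))
      (fun d => A d + B d + E d + if j < i ∧ ¬ K.SameFace h d then 1 else 0) where
  next d := by simp only [hA.next, hB.next, hE.next, sameFace_next_iff]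
  zero := by
    have : K.SameFace h h := Equiv.Perm.SameCycle.refl _ _
    simp [hA.zero, hB.zero, hE.zero, this]
  rev d := by
    -- The arcs from `0` to `i` and to `j` add up to the arc from `i` to `j` if `i ≤ j`, and to its
    -- complement otherwise. In the latter case the whole hole has to be added, which reverses the
    -- colours of all inner faces.
    have key : ∀ d, K.SameFace h d → (K.crossings (K.arc h 0 i) d : ZMod 2) +
        K.crossings (K.arc h 0 j) d + (if j < i then 1 else 0) = K.crossings (K.arc h i j) d := by
      intro d hd
      obtain ⟨q, hq, rfl⟩ := exists_pow_of_sameFace hd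
      rw [hK.crossings_arc hq (K.bsize_pos h), hK.crossings_arc hq (K.bsize_pos h),
        hK.crossings_arc hq hi]
      simp only [Nat.sub_zero, Nat.add_mod_right, Nat.mod_eq_of_lt hq, Nat.mod_eq_of_lt hi,
        Nat.mod_eq_of_lt hj]
      have hm : ∀ k, k < K.bsize h → (k + K.bsize h - i) % K.bsize h =
          if k < i then k + K.bsize h - i else k - i := by
        intro k hk
        split_ifs with h1
        · exact Nat.mod_eq_of_lt (by omega)
        · rw [show k + K.bsize h - i = k - i + K.bsize h by omega, Nat.add_mod_right,
            Nat.mod_eq_of_lt (by omega)]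
      rw [hm q hq, hm j hj]
      by_cases c1 : q < i <;> by_cases c2 : q < j <;> by_cases c3 : j < i <;>
        simp only [c1, c2, c3, if_true, if_false]
      all_goals first
        | omega
        | (rw [if_pos (by omega)]; simp <;> rfl)
        | (rw [if_neg (by omega)]; simp <;> rfl)
    have key2 : (K.crossings (K.arc h 0 i) d : ZMod 2) + K.crossings (K.arc h 0 j) d +
        (if j < i ∧ ¬ K.SameFace h (K.rev d) then 1 else 0) +
        (if j < i ∧ ¬ K.SameFace h d then 1 else 0) = K.crossings (K.arc h i j) d := by
      by_cases hd : K.SameFace h d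
      · have := key d hd
        have hr := hK.not_sameFace_rev hd
        simp only [hd, hr, not_true, not_false_eq_true, and_true, and_false, if_false, add_zero]
        exact this
      by_cases hr : K.SameFace h (K.rev d)
      · have := key _ hr
        simp only [crossings_rev hK.map.rev_rev] at this
        simp only [hd, hr, not_true, not_false_eq_true, and_true, and_false, if_false, add_zero]
        exact this
      · simp only [crossings_arc_eq_zero hd hr, hd, hr, not_false_eq_true, and_true]
        simp only [Nat.cast_zero]
        grind
    rw [hA.rev, hB.rev, hE.rev, crossings_append, crossings_cons e, crossings_append,
      crossings_cons e (_ ++ _), sector, sector]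
    simp only [crossings_append]
    push_cast
    rw [← key2]
    grind

theorem IsDisc.mem_support_arc [Fintype D] (hK : K.IsDisc h) {i j : ℕ} (hi : i < K.bsize h)
    (hj : j < K.bsize h) {w : V} : w ∈ K.support (K.bpos h i) (K.arc h i j) ↔
      ∃ k < K.bsize h, K.bpos h k = w ∧ if i ≤ j then i ≤ k ∧ k ≤ j else i ≤ k ∨ k ≤ j := by
  have hn := K.bsize_pos h
  have hm : (j + K.bsize h - i) % K.bsize h = if i ≤ j then j - i else j + K.bsize h - i := by
    split_ifs with h1
    · rw [show j + K.bsize h - i = j - i + K.bsize h by omega, Nat.add_mod_right,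
        Nat.mod_eq_of_lt (by omega)]
    · exact Nat.mod_eq_of_lt (by omega)
  have h1 : w ∈ K.support (K.bpos h i) (K.arc h i j) ↔
      ∃ t ≤ (j + K.bsize h - i) % K.bsize h, K.bpos h (i + t) = w := by
    simp only [support, List.mem_cons, List.mem_map]
    constructor
    · rintro (rfl | ⟨d, hd, rfl⟩)
      · exact ⟨0, by omega, rfl⟩
      · obtain ⟨t, ht, rfl⟩ := mem_arc.1 hd
        refine ⟨t + 1, by omega, ?_⟩
        rw [← hK.map.src_next, bpos, ← add_assoc, pow_succ', Equiv.Perm.mul_apply]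
    · rintro ⟨t, ht, rfl⟩
      cases t with
      | zero => exact .inl rfl
      | succ t =>
        refine .inr ⟨_, mem_arc.2 ⟨t, by omega, rfl⟩, ?_⟩
        rw [← hK.map.src_next, bpos, ← add_assoc, pow_succ', Equiv.Perm.mul_apply]
  rw [h1, hm]
  constructor
  · rintro ⟨t, ht, rfl⟩
    refine ⟨(i + t) % K.bsize h, Nat.mod_lt _ hn, bpos_mod _ _, ?_⟩
    split_ifs at ht ⊢ with h2
    · rw [Nat.mod_eq_of_lt (by omega)]
      omega
    · rcases Nat.lt_or_ge (i + t) (K.bsize h) with h3 | h3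
      · rw [Nat.mod_eq_of_lt h3]
        omega
      · rw [Nat.mod_eq_sub_mod h3, Nat.mod_eq_of_lt (by omega)]
        omega
  · rintro ⟨k, hk, rfl, hk2⟩
    split_ifs at hk2 ⊢ with h2
    · exact ⟨k - i, by omega, by rw [show i + (k - i) = k by omega]⟩
    · rcases Nat.lt_or_ge k i with h3 | h3
      · refine ⟨k + K.bsize h - i, by omega, ?_⟩
        rw [show i + (k + K.bsize h - i) = k + K.bsize h by omega, ← bpos_mod, Nat.add_mod_right,
          bpos_mod]
      · exact ⟨k - i, by omega, by rw [show i + (k - i) = k by omega]⟩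

end EmbeddedGraph

end

noncomputable section

/-! ### The program that decides membership in a box -/

namespace Code

/-- One or zero, according to whether the inequality holds. -/
def bit (a b : Code) : Code := .ifLe a b (.const 1) (.const 0)

/-- Zero or one, according to whether both values are equal. -/
def differ (a b : Code) : Code := .ifLe a b (.ifLe b a (.const 0) (.const 1)) (.const 1)

/-- Read the given field of a record. The memory consists of records with twelve fields. -/
def field (t : ℕ) (a : Code) : Code := .load (.add (.mul (.const 12) a) (.const t))

section

variable (mem : List ℕ) (x : Fin 3 → ℕ)

theorem val_arg (k : Fin 3) : (run mem x (.arg k)).val = x k := rfl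

theorem val_const (n : ℕ) : (run mem x (.const n)).val = n := rfl

theorem val_add (a b : Code) :
    (run mem x (.add a b)).val = (run mem x a).val + (run mem x b).val := rfl

theorem val_mul (a b : Code) :
    (run mem x (.mul a b)).val = (run mem x a).val * (run mem x b).val := rfl

theorem val_ifLe (a b c d : Code) : (run mem x (.ifLe a b c d)).val =
    if (run mem x a).val ≤ (run mem x b).val then (run mem x c).val else (run mem x d).val := by
  simp only [run, Timed.andThen, Timed.step, decide_eq_true_eq]
  split_ifs <;> rfl

theorem val_field (t : ℕ) (a : Code) :
    (run mem x (field t a)).val = mem.getD (12 * (run mem x a).val + t) 0 := rfl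

theorem val_bit (a b : Code) : (run mem x (bit a b)).val =
    if (run mem x a).val ≤ (run mem x b).val then 1 else 0 := val_ifLe ..

theorem val_differ (a b : Code) : (run mem x (differ a b)).val =
    if (run mem x a).val = (run mem x b).val then 0 else 1 := by
  rw [differ, val_ifLe, val_ifLe, val_const, val_const]
  split_ifs <;> first | rfl | omega

end

/-- The inputs are the number of a vertex and two positions on the boundary. -/
def box : Code :=
  .add
    (.add (.mul (bit (field 0 (.arg 0)) (field 10 (.arg 1))) (bit (field 10 (.arg 1)) (field 1 (.arg 0))))
      (.mul (bit (field 2 (.arg 0)) (field 11 (.arg 2))) (bit (field 11 (.arg 2)) (field 3 (.arg 0)))))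
    (.add
      (.mul (field 5 (.arg 0)) (.ifLe (.arg 1) (.arg 2)
        (.mul (bit (.arg 1) (field 4 (.arg 0))) (bit (field 4 (.arg 0)) (.arg 2)))
        (.add (bit (.arg 1) (field 4 (.arg 0))) (bit (field 4 (.arg 0)) (.arg 2)))))
      (differ
        (differ (bit (.add (field 6 (.arg 0)) (.const 1)) (.arg 1))
          (bit (.add (field 7 (.arg 0)) (.const 1)) (.arg 2)))
        (differ (field 8 (.arg 0))
          (.mul (field 9 (.arg 0)) (bit (.add (.arg 2) (.const 1)) (.arg 1))))))

/-- The program adds up four natural numbers, which express the alternatives on the right; products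
of bits are conjunctions, and `differ` is addition modulo two. -/
theorem val_box (mem : List ℕ) (w i j : ℕ) {f : ℕ → ℕ → ℕ}
    (hf : ∀ t m, mem.getD (12 * m + t) 0 = f t m) (h8 : f 8 w ≤ 1) (h9 : f 9 w ≤ 1) :
    (run mem ![w, i, j] box).val ≠ 0 ↔
      (f 0 w ≤ f 10 i ∧ f 10 i ≤ f 1 w) ∨ (f 2 w ≤ f 11 j ∧ f 11 j ≤ f 3 w) ∨
      (f 5 w ≠ 0 ∧ if i ≤ j then i ≤ f 4 w ∧ f 4 w ≤ j else i ≤ f 4 w ∨ f 4 w ≤ j) ∨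
      (if f 6 w < i then 1 else 0 : ZMod 2) + (if f 7 w < j then 1 else 0) + (f 8 w : ZMod 2) +
        (if j < i ∧ f 9 w ≠ 0 then 1 else 0) = 1 := by
  have a0 : (![w, i, j] : Fin 3 → ℕ) 0 = w := rfl
  have a1 : (![w, i, j] : Fin 3 → ℕ) 1 = i := rfl
  have a2 : (![w, i, j] : Fin 3 → ℕ) 2 = j := rfl
  have hpar : ∀ a b c d : ℕ, a ≤ 1 → b ≤ 1 → c ≤ 1 → d ≤ 1 →
      ((if (if a = b then 0 else 1) = (if c = d then 0 else 1) then 0 else 1) ≠ 0 ↔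
        (a + b + c + d : ZMod 2) = 1) := by
    intro a b c d ha hb hc hd
    interval_cases a <;> interval_cases b <;> interval_cases c <;> interval_cases d <;> decide
  have hb : ∀ (q : Prop) [Decidable q], (if q then 1 else 0) ≤ 1 := fun q _ => by split_ifs <;> omega
  have hbit : ∀ (q q' : Prop) [Decidable q] [Decidable q'], (if q then 1 else 0) * (if q' then 1 else 0) ≠ 0 ↔ q ∧ q' := by
    intro q q' _ _
    by_cases h1 : q <;> by_cases h2 : q' <;> simp [h1, h2]
  have hor : ∀ (q q' : Prop) [Decidable q] [Decidable q'], (if q then 1 else 0) + (if q' then 1 else 0) ≠ 0 ↔ q ∨ q' := by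
    intro q q' _ _
    by_cases h1 : q <;> by_cases h2 : q' <;> simp [h1, h2]
  have hadd : ∀ a b : ℕ, a + b ≠ 0 ↔ a ≠ 0 ∨ b ≠ 0 := fun a b => by omega
  have h4 : f 9 w * (if j + 1 ≤ i then 1 else 0) ≤ 1 := by split_ifs <;> omega
  have hp := hpar (if f 6 w + 1 ≤ i then 1 else 0) (if f 7 w + 1 ≤ j then 1 else 0) (f 8 w)
    (f 9 w * (if j + 1 ≤ i then 1 else 0)) (hb _) (hb _) h8 h4
  have h5 : ((f 9 w * (if j + 1 ≤ i then 1 else 0) : ℕ) : ZMod 2) =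
      if j < i ∧ f 9 w ≠ 0 then 1 else 0 := by
    generalize f 9 w = z at *
    by_cases h1 : j < i
    · interval_cases z <;> simp [h1]
    · simp [h1]
  simp only [box, val_add, val_mul, val_bit, val_differ, val_field, val_ifLe, val_arg, val_const, a0,
    a1, a2, hf]
  rw [hadd, hadd, hadd, hbit, hbit, hp, h5, mul_ne_zero_iff, or_assoc]
  refine or_congr Iff.rfl (or_congr Iff.rfl (or_congr (and_congr Iff.rfl ?_) ?_))
  · by_cases hij : i ≤ j
    · simp only [if_pos hij]
      exact hbit (i ≤ f 4 w) (f 4 w ≤ j)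
    · simp only [if_neg hij]
      exact hor (i ≤ f 4 w) (f 4 w ≤ j)
  · simp only [Nat.succ_le_iff, Nat.cast_ite, Nat.cast_one, Nat.cast_zero]

end Code

namespace EmbeddedGraph

variable {V D : Type*} [Fintype V] [Fintype D] {K : EmbeddedGraph V D} {h : D}

/-- Every part of the test separates `i` from `j`, or compares them with one stored position. So one
record for each vertex, and two ranks for each position on the hole, serve all pairs of positions.
-/
theorem IsDisc.exists_memory (hK : K.IsDisc h) (hu : K.UniqueShortestPaths) {W : Type*} {N : ℕ}
    (ι : W → V) (num : W ≃ Fin N) (hN : K.bsize h ≤ N) (e : D) :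
    ∃ mem : List ℕ, mem.length = 12 * N ∧ (∀ n ∈ mem, n ≤ Fintype.card V + N) ∧
      ∀ i < K.bsize h, ∀ j < K.bsize h, ∀ w : W,
        (Code.box.run mem ![(num w : ℕ), i, j]).val ≠ 0 ↔ ι w ∈ K.box h i j e := by
  have hn := hK.three
  obtain ⟨px, lx, hx, hbx, hpx⟩ := exists_intervals hu (K.src e)
  obtain ⟨py, ly, hy, hby, hpy⟩ := exists_intervals hu (K.tgt e)
  choose A hA using fun i : ℕ => hK.exists_sector_coloring hu (K.src e) (i := i)
  choose B hB using fun i : ℕ => hK.exists_sector_coloring hu (K.tgt e) (i := i)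
  choose sx hsx hsx' using hK.exists_sector hu (K.src e) fun i _ => hA i
  choose sy hsy hsy' using hK.exists_sector hu (K.tgt e) fun i _ => hB i
  obtain ⟨E, hE⟩ := hK.map.exists_coloring h
    (K.sp (K.bpos h 0) (K.src e) ++ e :: K.sp (K.bpos h 0) (K.tgt e)) fun w => by
      rw [starSum_crossings_append, starSum_crossings hK.map.rev_rev (sp_isWalk hu _ _),
        show e :: K.sp (K.bpos h 0) (K.tgt e) = [e] ++ K.sp (K.bpos h 0) (K.tgt e) from rfl,
        starSum_crossings_append, starSum_crossings hK.map.rev_rev (sp_isWalk hu _ _),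
        starSum_crossings hK.map.rev_rev (p := [e]) (u := K.src e) (v := K.tgt e) ⟨rfl, rfl⟩]
      grind
  choose δ hδ using hK.map.src_surjective
  -- The value `0` off the hole is never used, as field 5 tells whether the vertex is on the hole.
  let pos : V → ℕ := fun w => if hw : ∃ k < K.bsize h, K.bpos h k = w then hw.choose else 0
  have hpos : ∀ k < K.bsize h, pos (K.bpos h k) = k := by
    intro k hk
    have hw : ∃ k' < K.bsize h, K.bpos h k' = K.bpos h k := ⟨k, hk, rfl⟩
    simp only [pos, dif_pos hw]
    exact hK.bpos_inj hw.choose_spec.1 hk hw.choose_spec.2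
  have hposlt : ∀ w, pos w ≤ N := by
    intro w
    by_cases hw : ∃ k < K.bsize h, K.bpos h k = w
    · obtain ⟨k, hk, rfl⟩ := hw
      rw [hpos k hk]
      omega
    · simp only [pos, dif_neg hw, zero_le]
  let vert : ℕ → V := fun m => if hm : m < N then ι (num.symm ⟨m, hm⟩) else K.src e
  have hvert : ∀ w, vert (num w) = ι w := fun w => by simp [vert]
  -- Fields 0–3 are the intervals of the vertex in the two trees, 4 and 5 its position on the hole,
  -- 6–9 the thresholds and colours of one dart at the vertex. Fields 10 and 11 are indexed by
  -- positions instead, and share the records because the hole has at most `N` vertices.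
  let g : ℕ → ℕ → ℕ := fun t m => match t with
    | 0 => lx (vert m)
    | 1 => hx (vert m)
    | 2 => ly (vert m)
    | 3 => hy (vert m)
    | 4 => pos (vert m)
    | 5 => if ∃ k < K.bsize h, K.bpos h k = vert m then 1 else 0
    | 6 => sx (δ (vert m))
    | 7 => sy (δ (vert m))
    | 8 => (E (δ (vert m))).val
    | 9 => if K.SameFace h (δ (vert m)) then 0 else 1
    | 10 => px (K.bpos h m)
    | 11 => py (K.bpos h m)
    | _ => 0
  have hg : ∀ t m, g t m ≤ Fintype.card V + N := by
    intro t m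
    have hb : ∀ (q : Prop) [Decidable q], (if q then 1 else 0) ≤ 1 := fun q _ => by split_ifs <;> omega
    have hb' : ∀ (q : Prop) [Decidable q], (if q then 0 else 1) ≤ 1 := fun q _ => by split_ifs <;> omega
    have b1 := hbx (vert m)
    have b2 := hby (vert m)
    have b3 := hposlt (vert m)
    have b5 := hsx (δ (vert m))
    have b6 := hsy (δ (vert m))
    have b7 := ZMod.val_lt (E (δ (vert m)))
    have b9 := hbx (K.bpos h m)
    have b10 := hby (K.bpos h m)
    match t with
    | 5 => exact (hb _).trans (by omega)
    | 9 => exact (hb' _).trans (by omega)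
    | 0 | 1 | 2 | 3 | 4 | 6 | 7 | 8 | 10 | 11 => simp only [g]; omega
    | _ + 12 => simp only [g]; omega
  let mem := (List.range (12 * N)).map fun q => g (q % 12) (q / 12)
  have hmem : ∀ t < 12, ∀ m < N, mem.getD (12 * m + t) 0 = g t m := by
    intro t ht m hm
    have h1 : 12 * m + t < mem.length := by simp [mem]; omega
    rw [List.getD_eq_getElem _ _ h1]
    simp only [mem, List.getElem_map, List.getElem_range]
    rw [show (12 * m + t) % 12 = t by omega, show (12 * m + t) / 12 = m by omega]
  refine ⟨mem, by simp [mem], ?_, ?_⟩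
  · intro n hn
    obtain ⟨q, -, rfl⟩ := List.mem_map.1 hn
    exact hg _ _
  intro i hi j hj w
  have hwN := (num w).2
  have g8 : g 8 (num w) ≤ 1 := by
    have := ZMod.val_lt (E (δ (vert (num w))))
    simp only [g]
    omega
  have g9 : g 9 (num w) ≤ 1 := by
    simp only [g]
    split_ifs <;> omega
  have hm : ∀ t < 12, mem.getD (12 * num w + t) 0 = g t (num w) := fun t ht => hmem t ht _ hwN
  rw [Code.val_box mem (num w) i j (fun t m => rfl) (by rw [hm 8 (by omega)]; exact g8)
    (by rw [hm 9 (by omega)]; exact g9)]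
  rw [hm 0 (by omega), hm 1 (by omega), hm 2 (by omega), hm 3 (by omega), hm 4 (by omega),
    hm 5 (by omega), hm 6 (by omega), hm 7 (by omega), hm 8 (by omega), hm 9 (by omega),
    hmem 10 (by omega) i (by omega), hmem 11 (by omega) j (by omega)]
  simp only [g, hvert]
  set v := ι w
  rw [← hpx, ← hpy]
  have harc : ((if ∃ k < K.bsize h, K.bpos h k = v then 1 else 0) ≠ 0 ∧
      if i ≤ j then i ≤ pos v ∧ pos v ≤ j else i ≤ pos v ∨ pos v ≤ j) ↔
      v ∈ K.support (K.bpos h i) (K.arc h i j) := by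
    rw [hK.mem_support_arc hi hj]
    constructor
    · rintro ⟨h1, h2⟩
      have h3 : ∃ k < K.bsize h, K.bpos h k = v := by
        by_contra h3
        exact h1 (if_neg h3)
      obtain ⟨k, hk, hkv⟩ := h3
      rw [← hkv, hpos k hk] at h2
      exact ⟨k, hk, hkv, h2⟩
    · rintro ⟨k, hk, hkv, h2⟩
      refine ⟨?_, ?_⟩
      · rw [if_pos ⟨k, hk, hkv⟩]
        exact one_ne_zero
      · rwa [← hkv, hpos k hk]
  rw [harc]
  show _ ↔ v ∈ K.support _ _ ∨ v ∈ K.support _ _ ∨ v ∈ K.support _ _ ∨ _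
  by_cases h1 : v ∈ K.support (K.bpos h i) (K.sp (K.bpos h i) (K.src e))
  · simp only [h1, true_or]
  by_cases h2 : v ∈ K.support (K.bpos h j) (K.sp (K.bpos h j) (K.tgt e))
  · simp only [h2, true_or, or_true]
  by_cases h3 : v ∈ K.support (K.bpos h i) (K.arc h i j)
  · simp only [h3, true_or, or_true]
  simp only [h1, h2, h3, false_or]
  have hc := hK.box_coloring hi hj (hA i) (hB j) hE
  -- A vertex on none of the walks is off the boundary of the box, so all darts at it have the same
  -- colour and the stored dart decides.
  have havoid : K.Avoids (K.sp (K.bpos h i) (K.src e) ++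
      e :: (K.sp (K.bpos h j) (K.tgt e) ++ K.arc h i j)) v := by
    have key : ∀ {u u' : V} {p : List D}, K.IsWalk u p u' → v ∉ K.support u p → ∀ d ∈ p,
        K.src d ≠ v ∧ K.tgt d ≠ v := fun hp hv d hd =>
      ⟨fun k => hv (k ▸ src_mem_support hp hd), fun k => hv (k ▸ tgt_mem_support hd)⟩
    intro d hd
    simp only [List.mem_append, List.mem_cons] at hd
    rcases hd with hd | rfl | hd | hd
    · exact key (sp_isWalk hu _ _) h1 d hd
    · exact ⟨fun k => h1 (k ▸ end_mem_support (sp_isWalk hu _ _)),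
        fun k => h2 (k ▸ end_mem_support (sp_isWalk hu _ _))⟩
    · exact key (sp_isWalk hu _ _) h2 d hd
    · exact key (hK.map.isWalk_arc hi j) h3 d hd
  have hval : ∀ a : ZMod 2, ((a.val : ℕ) : ZMod 2) = a := fun a => by simp
  rw [hval, ← hsx' _ i hi, ← hsy' _ j hj]
  have hZ : ((if K.SameFace h (δ v) then 0 else 1) ≠ 0) ↔ ¬ K.SameFace h (δ v) := by
    split_ifs with h <;> simp [h]
  simp only [hZ]
  constructor
  · intro h4
    exact ⟨δ v, hδ v, inside_iff.2 ⟨_, hc, h4⟩⟩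
  · rintro ⟨d, hd, hin⟩
    obtain ⟨col, hcol, hd1⟩ := inside_iff.1 hin
    rw [hK.map.coloring_unique hcol hc] at hd1
    exact (hK.map.coloring_eq_of_avoids hc havoid hd (hδ v)).symm.trans hd1

end EmbeddedGraph

end

noncomputable section

namespace EmbeddedGraph

variable {V D : Type*}

/-! ### The number of darts -/

/-- Without faces of length one or two, the number of darts is linear in the number of
vertices. -/
theorem IsMap.card_dart_le [Fintype D] {K : EmbeddedGraph V D} (hK : K.IsMap)
    (hface : ∀ d, K.next d ≠ d ∧ K.next (K.next d) ≠ d) : Nat.card D ≤ 6 * Nat.card V := by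
  have : Finite V := Finite.of_surjective _ hK.src_surjective
  have := Fintype.ofFinite V
  have := Fintype.ofFinite K.Face
  rw [Nat.card_eq_fintype_card, Nat.card_eq_fintype_card]
  let A : (D → ZMod 2) →ₗ[ZMod 2] (D → ZMod 2) :=
    LinearMap.funLeft (ZMod 2) (ZMod 2) K.rev + LinearMap.id
  have hA : ∀ z d, A z d = z (K.rev d) + z d := fun z d => rfl
  have hAker : ∀ z, z ∈ LinearMap.ker A ↔ ∀ d, z (K.rev d) = z d := by
    intro z
    rw [LinearMap.mem_ker, funext_iff]
    refine forall_congr' fun d => ?_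
    rw [hA]
    exact CharTwo.add_eq_zero
  have hrange : LinearMap.range A ≤ LinearMap.ker A := by
    rintro _ ⟨z, rfl⟩
    rw [hAker]
    intro d
    rw [hA, hA, hK.rev_rev, add_comm]
  have h1 : Fintype.card D ≤ 2 * Module.finrank (ZMod 2) (LinearMap.ker A) := by
    have := LinearMap.finrank_range_add_finrank_ker A
    have := Submodule.finrank_mono hrange
    rw [Module.finrank_fintype_fun_eq_card] at *
    omega
  let S : (D → ZMod 2) →ₗ[ZMod 2] (V → ZMod 2) :=
    { toFun := fun z v => K.starSum z v
      map_add' := fun z w => funext fun v => starSum_add z w v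
      map_smul' := fun c z => by
        funext v
        simp [starSum, Finset.mul_sum] }
  let B : (K.Face → ZMod 2) →ₗ[ZMod 2] (D → ZMod 2) :=
    LinearMap.funLeft (ZMod 2) (ZMod 2) (fun d => K.face (K.rev d)) +
      LinearMap.funLeft (ZMod 2) (ZMod 2) K.face
  have hB : ∀ c d, B c d = c (K.face (K.rev d)) + c (K.face d) := fun c d => rfl
  let T := S.domRestrict (LinearMap.ker A)
  -- Cycles are boundaries of face colourings, so there are at most `|F|` dimensions of them.
  -- Together with the at most `|V|` dimensions of values at vertices this gives `|E| ≤ |V| + |F|`,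
  -- a sufficient form of Euler's formula; and `3 |F| ≤ 2 |E|`.
  have h2 : Module.finrank (ZMod 2) (LinearMap.ker T) ≤ Fintype.card K.Face := by
    have h3 : (LinearMap.ker T).map (LinearMap.ker A).subtype ≤ LinearMap.range B := by
      rintro _ ⟨z, hz, rfl⟩
      obtain ⟨col, hn, hr⟩ := hK.exact z ((hAker z).1 z.2)
        (fun v => congrFun (LinearMap.mem_ker.1 hz) v)
      have hlift : ∀ d e, K.SameFace d e → col d = col e := fun d e hde =>
        (eq_of_sameCycle hn hde).symm
      refine ⟨fun f => Quotient.lift col hlift f, funext fun d => ?_⟩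
      rw [hB]
      show col (K.rev d) + col d = z.1 d
      rw [hr]
      grind
    have h4 := Submodule.finrank_mono h3
    rw [LinearEquiv.finrank_eq (Submodule.equivMapOfInjective _ (Submodule.injective_subtype _) _).symm]
      at h4
    refine h4.trans ((LinearMap.finrank_range_le B).trans ?_)
    rw [Module.finrank_fintype_fun_eq_card]
  have h3 : Module.finrank (ZMod 2) (LinearMap.range T) ≤ Fintype.card V := by
    refine (Submodule.finrank_le _).trans ?_
    rw [Module.finrank_fintype_fun_eq_card]
  have h4 := LinearMap.finrank_range_add_finrank_ker T
  have h5 : 3 * Fintype.card K.Face ≤ Fintype.card D := by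
    have hfib : ∀ f : K.Face, 3 ≤ (Finset.univ.filter fun d => K.face d = f).card := by
      intro f
      obtain ⟨d, rfl⟩ := K.face_surjective f
      have hsub : ({d, K.next d, K.next (K.next d)} : Finset D) ⊆
          Finset.univ.filter fun e => K.face e = K.face d := by
        intro e he
        simp only [Finset.mem_insert, Finset.mem_singleton] at he
        rcases he with rfl | rfl | rfl <;> simp [face_next]
      have hcard : ({d, K.next d, K.next (K.next d)} : Finset D).card = 3 := by
        rw [Finset.card_eq_three]
        exact ⟨_, _, _, (hface d).1.symm, (hface d).2.symm, (hface _).1.symm, rfl⟩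
      rw [← hcard]
      exact Finset.card_le_card hsub
    have h6 := Finset.card_eq_sum_card_fiberwise (f := K.face) (s := Finset.univ)
      (t := Finset.univ) (by simp [Set.MapsTo])
    rw [Finset.card_univ] at h6
    rw [h6]
    have := Finset.sum_le_sum fun (f : K.Face) (_ : f ∈ Finset.univ) => hfib f
    simpa [mul_comm] using this
  omega

/-! ### The existence of Voronoi diagrams -/

/-- Ties between sites are broken by the number of darts of the path, then by a fixed enumeration.
Both the distance and the number of darts are additive along paths, so the choice at `z` agrees with
the choice at every vertex of its path. The hypothesis on `ω` ensures that each site wins its own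
vertex. -/
theorem exists_isVoronoi [Finite D] {K : EmbeddedGraph V D} {h : D} (hu : K.UniqueShortestPaths)
    (hw : ∀ d, 0 ≤ K.wt d) {ω : V → ℝ} (hω : ∀ e e', K.SameFace h e → K.SameFace h e' →
      ω (K.src e) ≤ ω (K.src e') + K.dist (K.src e') (K.src e)) : ∃ site, K.IsVoronoi h ω site := by
  obtain ⟨n, ⟨o⟩⟩ := Finite.exists_equiv_fin D
  let key : V → D → ℝ ×ₗ (ℕ ×ₗ ℕ) := fun z e => toLex (ω (K.src e) + K.dist (K.src e) z,
    toLex ((K.sp (K.src e) z).length, (o e : ℕ)))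
  have hex : ∀ z, ∃ e, K.SameFace h e ∧ ∀ e', K.SameFace h e' → key z e ≤ key z e' := fun z =>
    Set.exists_min_image {e | K.SameFace h e} (key z) (Set.toFinite _)
      ⟨h, Equiv.Perm.SameCycle.refl _ _⟩
  choose s hs hmin using hex
  have hle : ∀ z e', K.SameFace h e' → ω (K.src (s z)) + K.dist (K.src (s z)) z <
      ω (K.src e') + K.dist (K.src e') z ∨
      ω (K.src (s z)) + K.dist (K.src (s z)) z = ω (K.src e') + K.dist (K.src e') z ∧
      ((K.sp (K.src (s z)) z).length < (K.sp (K.src e') z).length ∨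
        (K.sp (K.src (s z)) z).length = (K.sp (K.src e') z).length ∧ (o (s z) : ℕ) ≤ o e') := by
    intro z e' he'
    have h1 := hmin z e' he'
    rwa [Prod.Lex.toLex_le_toLex, Prod.Lex.toLex_le_toLex] at h1
  have hminimal : ∀ z e', K.SameFace h e' → ω (K.src (s z)) + K.dist (K.src (s z)) z ≤
      ω (K.src e') + K.dist (K.src e') z := by
    intro z e' he'
    rcases hle z e' he' with h1 | ⟨h1, -⟩
    · exact h1.le
    · exact h1.le
  refine ⟨fun z => K.src (s z), ⟨fun z => ⟨s z, hs z, rfl⟩, ?_, hminimal, ?_⟩⟩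
  · intro e he
    have h1 := hω e _ he (hs (K.src e))
    have h0 : (K.sp (K.src e) (K.src e)).length = 0 := by rw [sp_self hu hw]; rfl
    have hd0 := dist_self hu hw (K.src e)
    -- At a site the empty path is optimal, so the chosen path has no darts either and starts at the
    -- site itself.
    have hnil : (K.sp (K.src (s (K.src e))) (K.src e)).length = 0 := by
      rcases hle (K.src e) e he with h2 | ⟨-, h3 | ⟨h3, -⟩⟩
      · rw [hd0] at h2
        linarith
      · omega
      · omega
    have h2 := sp_isWalk hu (K.src (s (K.src e))) (K.src e)
    rw [List.length_eq_zero_iff.1 hnil] at h2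
    exact h2
  · intro z y hy
    have hsplit := sp_split hu hy
    have hd : K.dist (K.src (s z)) z = K.dist (K.src (s z)) y + K.dist y z := by
      rw [dist_eq_len_sp hu, hsplit, len_append, ← dist_eq_len_sp hu, ← dist_eq_len_sp hu]
    have hlen := congrArg List.length hsplit
    rw [List.length_append] at hlen
    have htri := dist_triangle hu (K.src (s y)) y z
    have e1 := hle y (s z) (hs z)
    have e2 := hle z (s y) (hs y)
    have hceq : ω (K.src (s y)) + K.dist (K.src (s y)) y =
        ω (K.src (s z)) + K.dist (K.src (s z)) y := by
      refine le_antisymm (hminimal y (s z) (hs z)) ?_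
      have := hminimal z (s y) (hs y)
      linarith
    have hceq2 : K.dist (K.src (s y)) z = K.dist (K.src (s y)) y + K.dist y z := by
      refine le_antisymm htri ?_
      have := hminimal z (s y) (hs y)
      linarith
    have hsp : K.sp (K.src (s y)) z = K.sp (K.src (s y)) y ++ K.sp y z := by
      symm
      refine IsShortest.eq_sp hu (isShortest_of_len_le hu
        ((sp_isWalk hu _ _).append (sp_isWalk hu _ _)) ?_)
      rw [len_append, ← dist_eq_len_sp hu, ← dist_eq_len_sp hu, hceq2]
    have hlen2 := congrArg List.length hsp
    rw [List.length_append] at hlen2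
    -- The sites of `y` and `z` tie in both comparisons: appending the path from `y` to `z` adds the
    -- same weight and the same number of darts.
    have hoeq : (o (s y) : ℕ) = o (s z) := by
      rcases e1 with k | ⟨-, k⟩
      · linarith
      · rcases e2 with k' | ⟨-, k'⟩
        · linarith
        · omega
    exact congrArg K.src (o.injective (Fin.ext hoeq))

end EmbeddedGraph

open EmbeddedGraph

namespace Region

variable {V D : Type*} {G : EmbeddedGraph V D} {R : Region G} [Fintype D]

/-! ### Filled regions -/

theorem isHole_congr {d e : R.Dart} (hde : R.graph.SameFace d e) : R.IsHole d ↔ R.IsHole e := by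
  have key : ∀ a b : R.Dart, R.graph.SameFace a b → R.IsHole a → R.IsHole b := by
    rintro a b hab h1 hb
    refine h1 fun x => ?_
    have hGa : G.SameFace b a := (hb a).2 ⟨a.2, hab.symm⟩
    constructor
    · intro hx
      obtain ⟨hm, hy⟩ := (hb x).1 (hGa.trans hx)
      exact ⟨hm, hab.trans hy⟩
    · rintro ⟨hm, hy⟩
      exact hGa.symm.trans ((hb x).2 ⟨hm, hab.symm.trans hy⟩)
  exact ⟨key _ _ hde, key _ _ hde.symm⟩

variable {h : R.Dart} {spoke : D → Bool → ℝ}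

theorem fill_next_of_sameFace {e : R.Dart} (he : R.graph.SameFace h e) :
    (R.fill h spoke).next (.inl e) = .inl (R.graph.next e) := by
  rw [fill_next_inl, dif_neg fun k => k.2 he]

theorem fill_next_pow (k : ℕ) :
    ((R.fill h spoke).next ^ k) (.inl h) = .inl ((R.graph.next ^ k) h) := by
  induction k with
  | zero => rfl
  | succ k ih =>
    rw [pow_succ', Equiv.Perm.mul_apply, ih, fill_next_of_sameFace (sameFace_pow h k), pow_succ',
      Equiv.Perm.mul_apply]

theorem fill_sameFace_iff {e : R.FillDart h} : (R.fill h spoke).SameFace (.inl h) e ↔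
    ∃ e', R.graph.SameFace h e' ∧ e = .inl e' := by
  constructor
  · intro he
    obtain ⟨k, -, rfl⟩ := exists_pow_of_sameFace he
    exact ⟨_, sameFace_pow h k, fill_next_pow k⟩
  · rintro ⟨e', he', rfl⟩
    obtain ⟨k, -, rfl⟩ := exists_pow_of_sameFace he'
    rw [← fill_next_pow (spoke := spoke)]
    exact sameFace_pow _ k

theorem fill_isDisc (hR : R.graph.IsMap) (hcycle : ∀ d, R.IsHole d → R.graph.IsSimpleCycle d)
    (htri : ∀ d, ¬ R.IsHole d → R.graph.IsTriangle d) (hh : R.IsHole h) :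
    (R.fill h spoke).IsDisc (.inl h) where
  map := fill_isMap hR
  simple e e' he he' hs := by
    obtain ⟨a, ha, rfl⟩ := fill_sameFace_iff.1 he
    obtain ⟨b, hb, rfl⟩ := fill_sameFace_iff.1 he'
    rw [(hcycle h hh).1 a b ha hb (Sum.inl_injective hs)]
  three := by
    refine (hcycle h hh).2.trans (Nat.card_le_card_of_injective
      (fun e : {e // R.graph.SameFace h e} => (⟨.inl e, fill_sameFace_iff.2 ⟨e, e.2, rfl⟩⟩ :
        {e // (R.fill h spoke).SameFace (.inl h) e})) fun a b hab => ?_)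
    exact Subtype.ext (Sum.inl_injective (congrArg Subtype.val hab))
  triangle d hd := by
    rcases d with e | ⟨e, _ | _⟩
    · by_cases he : R.IsOtherHole h e
      · rw [fill_next_inl, dif_pos he, fill_next_false, fill_next_true]
        simp
      · have hnh : ¬ R.IsHole e := fun k => he ⟨k, fun k' => hd (fill_sameFace_iff.2 ⟨e, k', rfl⟩)⟩
        rw [fill_next_inl, dif_neg he, fill_next_inl, dif_neg, fill_next_inl, dif_neg,
          (htri e hnh).1]
        · rwa [isOtherHole_next, isOtherHole_next]
        · rwa [isOtherHole_next]
    · rw [fill_next_false, fill_next_true, fill_next_inl, dif_pos (R.isOtherHole_prev h e e.2)]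
      simp
    · rw [fill_next_true, fill_next_inl, dif_pos e.2, fill_next_false]
      simp

theorem bsize_fill_le (hR : R.graph.IsMap) (hcycle : R.graph.IsSimpleCycle h) :
    (R.fill h spoke).bsize (.inl h) ≤ Nat.card R.Vert := by
  have : Finite R.Vert := Finite.of_surjective _ hR.src_surjective
  choose f hf hf' using fun e : {e // (R.fill h spoke).SameFace (.inl h) e} => fill_sameFace_iff.1 e.2
  refine Nat.card_le_card_of_injective (fun e => R.graph.src (f e)) fun a b hab => ?_
  have := hcycle.1 _ _ (hf a) (hf b) hab
  exact Subtype.ext (by rw [hf', hf', this])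

theorem card_dart_le (hR : R.graph.IsMap) (hcycle : ∀ d, R.IsHole d → R.graph.IsSimpleCycle d)
    (htri : ∀ d, ¬ R.IsHole d → R.graph.IsTriangle d) : Nat.card R.Dart ≤ 6 * Nat.card R.Vert := by
  refine hR.card_dart_le fun d => ?_
  by_cases hd : R.IsHole d
  · have h3 : 3 ≤ R.graph.bsize d := (hcycle d hd).2
    have := (R.graph.exists_bsize d).2.2
    exact ⟨this 1 (by omega) (by omega), this 2 (by omega) (by omega)⟩
  · have ht := htri d hd
    exact ⟨fun k => ht.2.1 (by rw [k]), fun k => ht.2.2.2 (by rw [k])⟩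

theorem card_fillDart_le : Nat.card (R.FillDart h) ≤ 3 * Nat.card R.Dart := by
  rw [Nat.card_sum, Nat.card_prod]
  have := Nat.card_le_card_of_injective (Subtype.val : {e : R.Dart // R.IsOtherHole h e} → R.Dart)
    Subtype.val_injective
  simp only [Nat.card_eq_fintype_card, Fintype.card_bool] at *
  omega

/-! ### Shortest paths in filled regions -/

theorem isWalk_of_fill {u : R.Vert} {v : R.FillVert h} {l : List R.Dart}
    (hl : (R.fill h spoke).IsWalk (.inl u) (l.map .inl) v) :
    ∃ v', v = .inl v' ∧ R.graph.IsWalk u l v' := by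
  induction l generalizing u with
  | nil => exact ⟨u, Eq.symm hl, rfl⟩
  | cons d l ih =>
    obtain ⟨v', hv', h1⟩ := ih hl.2
    exact ⟨v', hv', Sum.inl_injective hl.1, h1⟩

theorem isWalk_val {u v : R.Vert} {l : List R.Dart} (hl : R.graph.IsWalk u l v) :
    G.IsWalk u (l.map Subtype.val) v := by
  induction l generalizing u with
  | nil => exact congrArg Subtype.val hl
  | cons d l ih => exact ⟨congrArg Subtype.val hl.1, ih hl.2⟩

theorem len_fill_map (l : List R.Dart) :
    (R.fill h spoke).len (l.map .inl) = G.len (l.map Subtype.val) := by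
  simp only [len, List.map_map]
  rfl

theorem exists_lift {l : List D} {u v : V} (hl : G.IsWalk u l v) (hm : ∀ d ∈ l, d ∈ R.darts)
    (hu : u ∈ R.verts) : ∃ (hv : v ∈ R.verts) (l' : List R.Dart), l'.map Subtype.val = l ∧
      R.graph.IsWalk ⟨u, hu⟩ l' ⟨v, hv⟩ := by
  induction l generalizing u with
  | nil =>
    obtain rfl : u = v := hl
    exact ⟨hu, [], rfl, rfl⟩
  | cons d l ih =>
    have hd := hm d (by simp)
    obtain ⟨hv, l', h1, h2⟩ := ih hl.2 (fun e he => hm e (by simp [he]))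
      ⟨G.rev d, (R.rev_mem d).2 hd, rfl⟩
    exact ⟨hv, ⟨d, hd⟩ :: l', by simp [h1], Subtype.ext hl.1, h2⟩

theorem wt_fill_nonneg (hw : ∀ d, 0 ≤ G.wt d) (hs : ∀ d b, ∑ e, G.wt e < spoke d b)
    (d : R.FillDart h) : 0 ≤ (R.fill h spoke).wt d := by
  rcases d with e | ⟨e, b⟩
  · exact hw e
  · exact (Finset.sum_nonneg fun e _ => hw e).trans (hs _ _).le

/-- Shortest paths between vertices of the region do not use the spokes. -/
theorem sp_fill (hR : R.graph.IsMap) (hw : ∀ d, 0 ≤ G.wt d)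
    (hs : ∀ d b, ∑ e, G.wt e < spoke d b) (hu : (R.fill h spoke).UniqueShortestPaths)
    (u v : R.Vert) : ∃ l : List R.Dart, (R.fill h spoke).sp (.inl u) (.inl v) = l.map .inl ∧
      R.graph.IsWalk u l v ∧ (R.fill h spoke).dist (.inl u) (.inl v) = G.len (l.map Subtype.val) := by
  have hno : ∀ d ∈ (R.fill h spoke).sp (.inl u) (.inl v), ∃ e, .inl e = d := by
    rintro (e | ⟨e, b⟩) hd
    · exact ⟨e, rfl⟩
    · exfalso
      -- A walk without repeated darts inside the region is cheaper than one spoke.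
      obtain ⟨p, hp, hnd⟩ := exists_walk_nodup (hR.connected u v)
      have h1 := (sp_isShortest hu (.inl u) (.inl v)).2 _ (isWalk_map_inl hp)
      have h2 := wt_le_len (wt_fill_nonneg hw hs) hd
      have h3 := len_le_sum hw (hnd.map Subtype.val_injective)
      rw [len_fill_map] at h1
      have h4 : spoke (e : R.Dart) b = (R.fill h spoke).wt (.inr (e, b)) := rfl
      have := hs (e : R.Dart) b
      linarith
  have hl : ∃ l : List R.Dart, (R.fill h spoke).sp (.inl u) (.inl v) = l.map .inl := by
    generalize (R.fill h spoke).sp (.inl u) (.inl v) = p at hno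
    induction p with
    | nil => exact ⟨[], rfl⟩
    | cons d p ih =>
      obtain ⟨e, rfl⟩ := hno d (by simp)
      obtain ⟨l, rfl⟩ := ih fun d hd => hno d (by simp [hd])
      exact ⟨e :: l, rfl⟩
  obtain ⟨l, hl⟩ := hl
  have h1 := sp_isWalk hu (.inl u) (.inl v)
  rw [hl] at h1
  obtain ⟨v', hv', h2⟩ := isWalk_of_fill h1
  obtain rfl := Sum.inl_injective hv'
  exact ⟨l, hl, h2, by rw [dist_eq_len_sp hu, hl, len_fill_map]⟩

/-! ### Boundary vertices -/

theorem IsInternal.mem_darts {v : V} (hv : R.IsInternal v) {d : D} (hd : G.src d = v) :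
    d ∈ R.darts := by
  by_contra h1
  exact hv.2 ⟨hv.1, d, h1, hd⟩

/-- Backwards from its internal end, the walk can leave the region only at a boundary vertex. -/
theorem mem_darts_of_walk {u v : V} {p : List D}
    (hp : G.IsWalk u p v) (hv : R.IsInternal v) (hb : ∀ d ∈ p, ¬ R.IsBoundary (G.tgt d)) :
    (∀ d ∈ p, d ∈ R.darts) ∧ u ∈ R.verts := by
  induction p generalizing u with
  | nil =>
    obtain rfl : u = v := hp
    exact ⟨by simp, hv.1⟩
  | cons d p ih =>
    obtain ⟨h1, h2⟩ := ih hp.2 fun e he => hb e (by simp [he])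
    have h3 : G.rev d ∈ R.darts := IsInternal.mem_darts ⟨h2, hb d (by simp)⟩ rfl
    have h4 := (R.rev_mem d).1 h3
    refine ⟨fun e he => ?_, d, h4, hp.1⟩
    rcases List.mem_cons.1 he with rfl | h5
    · exact h4
    · exact h1 e h5

/-- A walk into a region has a last boundary vertex. -/
theorem exists_last_boundary {u v : V} {p : List D}
    (hp : G.IsWalk u p v) (hv : R.IsInternal v) (hu : u ∉ R.verts) :
    ∃ p₁ p₂ x, p = p₁ ++ p₂ ∧ G.IsWalk u p₁ x ∧ R.IsBoundary x ∧
      ∀ d ∈ p₂, ¬ R.IsBoundary (G.tgt d) := by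
  have key : ∀ (p : List D) (u : V), G.IsWalk u p v → (∀ y ∈ G.support u p, ¬ R.IsBoundary y) ∨
      ∃ p₁ p₂ x, p = p₁ ++ p₂ ∧ G.IsWalk u p₁ x ∧ R.IsBoundary x ∧
        ∀ d ∈ p₂, ¬ R.IsBoundary (G.tgt d) := by
    intro p
    induction p with
    | nil =>
      intro u hp
      by_cases hub : R.IsBoundary u
      · exact .inr ⟨[], [], u, rfl, rfl, hub, by simp⟩
      · exact .inl (by simpa [support] using hub)
    | cons d p ih =>
      intro u hp
      rcases ih _ hp.2 with h1 | ⟨p₁, p₂, x, rfl, h1, h2⟩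
      · by_cases hub : R.IsBoundary u
        · refine .inr ⟨[], d :: p, u, rfl, rfl, hub, fun e he => h1 _ ?_⟩
          simp only [support, List.mem_cons, List.mem_map] at he ⊢
          rcases he with rfl | he
          · exact .inl rfl
          · exact .inr ⟨e, he, rfl⟩
        · refine .inl fun y hy => ?_
          rcases List.mem_cons.1 hy with rfl | hy
          · exact hub
          · exact h1 y hy
      · exact .inr ⟨d :: p₁, p₂, x, rfl, ⟨hp.1, h1⟩, h2⟩
  rcases key p u hp with h1 | h1
  · exact absurd (mem_darts_of_walk hp hv fun d hd => h1 _ (tgt_mem_support hd)).2 hu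
  · exact h1

/-- Boundary vertices lie on holes. -/
theorem exists_isHole_of_isBoundary (hG : G.IsMap) (hR : R.graph.IsMap) {x : V}
    (hx : R.IsBoundary x) : ∃ e, R.IsHole e ∧ (R.graph.src e : V) = x := by
  obtain ⟨⟨d, hd, rfl⟩, d', hd', hs⟩ := hx
  -- Turning around `x`, some dart of the region is followed by one outside of it. The face of the
  -- region at this corner is not a face of `G`.
  obtain ⟨e, he, hes, hrot⟩ : ∃ e ∈ R.darts, G.src e = G.src d ∧ G.rot e ∉ R.darts := by
    by_contra! hcon
    obtain ⟨k, -, rfl⟩ := (hG.sameCycle d d' hs.symm).exists_pow_eq'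
    have : ∀ k, (G.rot ^ k) d ∈ R.darts ∧ G.src ((G.rot ^ k) d) = G.src d := by
      intro k
      induction k with
      | zero => exact ⟨hd, rfl⟩
      | succ k ih =>
        rw [pow_succ', Equiv.Perm.mul_apply]
        exact ⟨hcon _ ih.1 ih.2, (hG.src_rot _).trans ih.2⟩
    exact hd' (this k).1
  let f : R.Dart := ⟨G.rev e, (R.rev_mem e).2 he⟩
  have hf : R.IsHole f := by
    intro hcon
    obtain ⟨h1, -⟩ := (hcon (G.rot e)).1 ⟨1, by rw [zpow_one]; rfl⟩
    exact hrot h1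
  refine ⟨R.graph.next f, (isHole_congr (SameFace.next (Equiv.Perm.SameCycle.refl _ _))).1 hf, ?_⟩
  rw [hR.src_next, coe_graph_tgt, hG.tgt_rev, hes]

end Region

end

noncomputable section

/-! ### Minima -/

namespace Timed

variable {α : Type*} {f : α → Timed (WithTop ℝ)}

theorem le_minOver {l : List α} {b : WithTop ℝ} :
    b ≤ (minOver f l).val ↔ ∀ a ∈ l, b ≤ (f a).val := by
  induction l with
  | nil => simp [minOver, step]
  | cons a l ih =>
    have : (minOver f (a :: l)).val = min (f a).val (minOver f l).val := rfl
    rw [this, le_min_iff, ih, List.forall_mem_cons]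

theorem minOver_le {l : List α} {a : α} (ha : a ∈ l) : (minOver f l).val ≤ (f a).val :=
  le_minOver.1 le_rfl a ha

theorem time_minOver_le {l : List α} {T : ℕ} (hT : ∀ a ∈ l, (f a).time ≤ T) :
    (minOver f l).time ≤ l.length * (T + 1) + 1 := by
  induction l with
  | nil => simp [minOver, step]
  | cons a l ih =>
    have : (minOver f (a :: l)).time = (f a).time + ((minOver f l).time + 1) := rfl
    have h1 := hT a (by simp)
    have h2 := ih fun b hb => hT b (by simp [hb])
    rw [this, List.length_cons]
    nlinarith

end Timed

open EmbeddedGraph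

/-! ### Divisions -/

namespace IsRDivision

variable {V D ι : Type*} [Fintype D] {G : EmbeddedGraph V D} {R : ι → Region G} {r c₁ c₂ : ℝ} {c₃ : ℕ}

theorem eq_of_isInternal (hd : IsRDivision G R r c₁ c₂ c₃) {i j : ι} {v : V}
    (hi : (R i).IsInternal v) (hj : v ∈ (R j).verts) : i = j := by
  obtain ⟨d, hdj, rfl⟩ := hj
  exact (hd.partition d).unique (hi.mem_darts rfl) hdj

theorem graph_isMap (hd : IsRDivision G R r c₁ c₂ c₃) (hG : G.IsMap) (i : ι) : (R i).graph.IsMap :=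
  (R i).graph_isMap hG (hd.connected i)

theorem fill_isDisc (hd : IsRDivision G R r c₁ c₂ c₃) (hG : G.IsMap) {i : ι} {h : (R i).Dart}
    (hh : (R i).IsHole h) (spoke : D → Bool → ℝ) : ((R i).fill h spoke).IsDisc (.inl h) :=
  Region.fill_isDisc (hd.graph_isMap hG i) (hd.hole_cycle i) (hd.triangle i) hh

theorem card_fillDart_le (hd : IsRDivision G R r c₁ c₂ c₃) (hG : G.IsMap) {i : ι} (h : (R i).Dart) :
    (Nat.card ((R i).FillDart h) : ℝ) ≤ 18 * r := by
  have h1 := Region.card_dart_le (hd.graph_isMap hG i) (hd.hole_cycle i) (hd.triangle i)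
  have h2 := Region.card_fillDart_le (R := R i) (h := h)
  have h3 : (Nat.card ((R i).FillDart h) : ℝ) ≤ 18 * (Nat.card (R i).Vert : ℝ) := by
    exact_mod_cast h2.trans (by omega)
  have := hd.verts_le i
  linarith

theorem exists_isBoundary (hd : IsRDivision G R r c₁ c₂ c₃) (hG : G.IsMap) {v : V}
    (hv : ∀ i, ¬ (R i).IsInternal v) : ∃ i, (R i).IsBoundary v := by
  obtain ⟨d, rfl⟩ := hG.src_surjective v
  obtain ⟨i, hi, -⟩ := hd.partition d
  refine ⟨i, ?_⟩
  by_contra hb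
  exact hv i ⟨⟨d, hi, rfl⟩, hb⟩

end IsRDivision

/-! ### Correctness of the oracle -/

namespace Oracle.Valid

variable {V D ι : Type*} [Fintype D] {G : EmbeddedGraph V D} {R : ι → Region G} {r c₁ c₂ : ℝ}
  {c₃ : ℕ} {spoke : D → Bool → ℝ} {O : Oracle G R} {C : ℝ} {code : Code}

theorem length_holes_le (hO : O.Valid spoke r C code) (hd : IsRDivision G R r c₁ c₂ c₃) (i : ι) :
    (O.holes i).length ≤ c₃ := by
  refine le_trans ?_ (hd.holes_le i)
  let f : {h // h ∈ O.holes i} → {f : (R i).graph.Face // ∃ e, (R i).IsHole e ∧ (R i).graph.face e = f} :=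
    fun h => ⟨(R i).graph.face h, h, hO.holes_hole i h h.2, rfl⟩
  have hnd : ((O.holes i).attach.map f).Nodup := by
    rw [List.Nodup, List.pairwise_map]
    have h1 : (O.holes i).attach.Pairwise fun a b => ¬ (R i).graph.SameFace a.1 b.1 := by
      have := hO.holes_pairwise i
      rw [← List.attach_map_subtype_val (O.holes i), List.pairwise_map] at this
      exact this
    refine h1.imp fun hab k => hab ?_
    exact face_eq_iff.1 (congrArg Subtype.val k)
  have := Fintype.ofFinite {f : (R i).graph.Face // ∃ e, (R i).IsHole e ∧ (R i).graph.face e = f}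
  have h2 := hnd.length_le_card
  rw [List.length_map, List.length_attach] at h2
  rwa [Nat.card_eq_fintype_card]

section

variable (hO : O.Valid spoke r C code) (hd : IsRDivision G R r c₁ c₂ c₃) (hG : G.IsMap)
  (hw : ∀ d, 0 ≤ G.wt d) (hs : ∀ d b, ∑ e, G.wt e < spoke d b) (hu : G.UniqueShortestPaths)
  (huf : ∀ i h, (R i).IsHole h → ((R i).fill h spoke).UniqueShortestPaths)
  {u v : V} {i j : ι} (hij : i ≠ j) (hui : (R i).IsInternal u) (hvj : (R j).IsInternal v)
  {h : (R j).Dart} (hh : h ∈ O.holes j)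
include hO hd hG huf hij hui hvj hh

theorem not_mem_verts : u ∉ (R j).verts := fun hu => hij (hd.eq_of_isInternal hui hu)

theorem isCells : ((R j).fill h spoke).IsCells (.inl h) (O.site u j h) :=
  (hO.voronoi u j (not_mem_verts hO hd hG huf hij hui hvj hh) h hh).isCells
    (hd.fill_isDisc hG (hO.holes_hole j h hh) spoke) (huf j h (hO.holes_hole j h hh))

theorem exists_site (z : (R j).FillVert h) : ∃ e, (R j).graph.SameFace h e ∧
    O.site u j h z = .inl ((R j).graph.src e) := by
  obtain ⟨e, he, hez⟩ := (isCells hO hd hG huf hij hui hvj hh).site_mem z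
  obtain ⟨e', he', rfl⟩ := Region.fill_sameFace_iff.1 he
  exact ⟨e', he', hez.symm⟩

theorem candidates_spec :
    (O.candidates code u v j h).val.length ≤ 6 ∧
    (∀ x ∈ (O.candidates code u v j h).val, (R j).IsBoundary x) ∧
    ∃ e, (R j).graph.SameFace h e ∧ O.site u j h (.inl ⟨v, hvj.1⟩) = .inl ((R j).graph.src e) ∧
      ((R j).graph.src e : V) ∈ (O.candidates code u v j h).val := by
  have hum := not_mem_verts hO hd hG huf hij hui hvj hh
  have hhole := hO.holes_hole j h hh
  have hK := isCells hO hd hG huf hij hui hvj hh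
  obtain ⟨L, name, hL, hname, hdec⟩ := hO.decomposes u j hum h hh
  have hval : (O.candidates code u v j h).val =
    (search code (O.mem j h) (O.num j v) (O.tree u j h)).val := rfl
  rw [hval]
  obtain ⟨h6, hleaf⟩ := IsCells.search_leaf code (O.mem j h) (O.num j v) hdec
  refine ⟨h6, fun x hx => ?_, ?_⟩
  · obtain ⟨a, rfl⟩ := hleaf x hx
    obtain ⟨e, he, hes⟩ := exists_site hO hd hG huf hij hui hvj hh (((R j).fill h spoke).tgt a)
    rw [hes, hname]
    exact hd.hole_boundary j e ((Region.isHole_congr he).1 hhole)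
  · obtain ⟨e, he, hes⟩ := exists_site hO hd hG huf hij hui hvj hh (.inl ⟨v, hvj.1⟩)
    refine ⟨e, he, hes, ?_⟩
    -- Applied to the dart of the hole that enters the site of `v`: the cell of `v` has a corner in
    -- a triangle that meets three cells, so it occurs in the list that is searched.
    have hne := hK.exists_isVorVertex (Region.fill_sameFace_iff.2 ⟨_, he.prev, rfl⟩)
    obtain ⟨a, ha, hat⟩ := hne
    have hfe : ((R j).fill h spoke).SameFace (.inl h) (.inl e) := Region.fill_sameFace_iff.2 ⟨e, he, rfl⟩
    have htgt : ((R j).fill h spoke).tgt (.inl ((R j).graph.next.symm e)) =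
        .inl ((R j).graph.src e) := by
      show Sum.inl ((R j).graph.tgt ((R j).graph.next.symm e)) = _
      rw [(hd.graph_isMap hG j).tgt_prev]
    have hself : O.site u j h (.inl ((R j).graph.src e)) = .inl ((R j).graph.src e) :=
      hK.site_self _ hfe
    rw [htgt, hself, ← hes] at hat
    have hspec := hK.search_spec (huf j h hhole) (hO.voronoi u j hum h hh).closed (code := code)
      (mem := O.mem j h) (w := O.num j v) (v := .inl ⟨v, hvj.1⟩)
      (fun e a ha b hb hab hdis => hO.mem_correct j h hh e a ha b hb hab hdis ⟨v, hvj.1⟩)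
      hdec hL.nodup (hK.arranged hL) (fun a ha => (hL.mem_iff a).1 ha) ⟨a, (hL.mem_iff a).2 ha, hat⟩
    rwa [hes, hname] at hspec

include hw hs hu

/-- The path through the optimal site is no longer than the one through `x`, so by uniqueness it is
the same path. The optimal site is a boundary vertex and thus comes no later than the last one, `x`.
So `x` is on the tree path to `v`, and cells are closed along tree paths. -/
theorem site_eq {p q : List D} {x : (R j).Vert} (hpq : G.IsShortest u (p ++ q) v)
    (hp : G.IsWalk u p x) (hq : ∀ d ∈ q, ¬ (R j).IsBoundary (G.tgt d))
    (hx : ∃ e, (R j).graph.SameFace h e ∧ (R j).graph.src e = x) :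
    O.site u j h (.inl ⟨v, hvj.1⟩) = .inl x := by
  have hum := not_mem_verts hO hd hG huf hij hui hvj hh
  have hhole := hO.holes_hole j h hh
  have hR := hd.graph_isMap hG j
  have hK := isCells hO hd hG huf hij hui hvj hh
  have hV := hO.voronoi u j hum h hh
  have huK := huf j h hhole
  obtain ⟨e, he, rfl⟩ := hx
  obtain ⟨f, hf, hfs⟩ := exists_site hO hd hG huf hij hui hvj hh (.inl ⟨v, hvj.1⟩)
  have hqw : G.IsWalk ((R j).graph.src e) q v := by
    obtain ⟨y, h1, h2⟩ := isWalk_append_iff.1 hpq.1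
    rwa [hp.eq_of_isWalk h1]
  obtain ⟨hqR, -⟩ := Region.mem_darts_of_walk hqw hvj hq
  obtain ⟨_, q', rfl, hq'⟩ := Region.exists_lift hqw hqR ((R j).graph.src e).2
  have hmin := hV.minimal (.inl ⟨v, hvj.1⟩) (.inl e) (Region.fill_sameFace_iff.2 ⟨e, he, rfl⟩)
  obtain ⟨l, hl, hlw, hld⟩ := Region.sp_fill hR hw hs huK ((R j).graph.src f) ⟨v, hvj.1⟩
  rw [hfs, hld] at hmin
  have hdx : ((R j).fill h spoke).dist (.inl ((R j).graph.src e)) (.inl ⟨v, hvj.1⟩) ≤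
      G.len (q'.map Subtype.val) := by
    rw [← Region.len_fill_map (h := h) (spoke := spoke)]
    exact dist_le_len huK (Region.isWalk_map_inl hq')
  have hmin' : G.dist u ((R j).graph.src f) + G.len (l.map Subtype.val) ≤
      G.dist u ((R j).graph.src e) + ((R j).fill h spoke).dist (.inl ((R j).graph.src e))
        (.inl ⟨v, hvj.1⟩) := hmin
  have hlG := Region.isWalk_val hlw
  have hdp : G.dist u ((R j).graph.src e) = G.len p := (hpq.of_append hp hqw).1.dist_eq
  have hsh : G.IsShortest u (G.sp u ((R j).graph.src f) ++ l.map Subtype.val) v := by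
    refine isShortest_of_len_le hu ((sp_isWalk hu _ _).append hlG) ?_
    rw [len_append, ← dist_eq_len_sp hu, hpq.dist_eq, len_append]
    linarith
  have heq : G.sp u ((R j).graph.src f) ++ l.map Subtype.val = p ++ q'.map Subtype.val :=
    (hsh.eq_sp hu).trans (hpq.eq_sp hu).symm
  have hfb : (R j).IsBoundary ((R j).graph.src f) :=
    hd.hole_boundary j f ((Region.isHole_congr hf).1 hhole)
  have hspw := sp_isWalk hu u ((R j).graph.src f : V)
  -- Otherwise the path to the optimal site would end inside `q`, at the head of one of its darts,
  -- but these heads are no boundary vertices.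
  obtain ⟨p₂, hp₂, hl₂⟩ : ∃ p₂, p = G.sp u ((R j).graph.src f) ++ p₂ ∧
      l.map Subtype.val = p₂ ++ q'.map Subtype.val := by
    rcases List.append_eq_append_iff.1 heq with ⟨a, h1, h2⟩ | ⟨a, h1, h2⟩
    · exact ⟨a, h1, h2⟩
    · rcases List.eq_nil_or_concat' a with rfl | ⟨a', d, rfl⟩
      · exact ⟨[], by simpa using h1.symm, by simpa using h2.symm⟩
      · exfalso
        rw [h1] at hspw
        obtain ⟨y, -, h3⟩ := isWalk_append_iff.1 hspw
        obtain ⟨z, -, h4⟩ := isWalk_append_iff.1 h3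
        have h5 : G.tgt d = (R j).graph.src f := h4.2
        refine hq d ?_ (h5 ▸ hfb)
        rw [h2]
        simp
  obtain ⟨l₁, l₂, rfl, hl₁, -⟩ := List.map_eq_append_iff.1 hl₂
  obtain ⟨y, hy₁, hy₂⟩ := isWalk_append_iff.1 hlw
  have hye : y = (R j).graph.src e := by
    have h1 := Region.isWalk_val hy₁
    rw [hl₁] at h1
    rw [hp₂] at hp
    obtain ⟨z, h2, h3⟩ := isWalk_append_iff.1 hp
    rw [← hspw.eq_of_isWalk h2] at h3
    exact Subtype.ext (h1.eq_of_isWalk h3)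
  have hc := hV.closed (.inl ⟨v, hvj.1⟩) (.inl y) (by
    rw [hfs, hl, mem_support_iff (Region.isWalk_map_inl hlw), List.map_append]
    exact ⟨_, _, rfl, Region.isWalk_map_inl hy₁, Region.isWalk_map_inl hy₂⟩)
  rw [← hc, hye]
  exact hK.site_self _ (Region.fill_sameFace_iff.2 ⟨e, he, rfl⟩)

end

end Oracle.Valid

end

/-! ### Evaluation of queries, and construction of an oracle -/

noncomputable section

open EmbeddedGraph

namespace Oracle

section Query

variable {V D ι : Type*} [Finite D] {G : EmbeddedGraph V D} {R : ι → Region G} (O : Oracle G R)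
  (code : Code) {u v : V}

/-- The sum of the stored distances from `u` to `x` and from `x` to `v`. -/
def via (u v x : V) : Timed (WithTop ℝ) :=
  (Timed.step (O.bdist u x)).andThen fun a =>
  (Timed.step (O.bdist x v)).andThen fun b =>
  .step ((a + b : ℝ) : WithTop ℝ)

/-- The minimum of `via` over all candidates for all holes. -/
def viaHoles (u v : V) (j : ι) : Timed (WithTop ℝ) :=
  Timed.minOver (fun h => (O.candidates code u v j h).andThen fun X =>
    Timed.minOver (O.via u v) X) (O.holes j)

theorem query_of_ne {i j : ι} (hi : O.home u = some i) (hj : O.home v = some j) (hij : i ≠ j) :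
    O.query code u v = ⟨(O.viaHoles code u v j).val, (O.viaHoles code u v j).time + 4⟩ := by
  have : O.query code u v = ⟨(O.viaHoles code u v j).val,
      1 + (1 + (1 + (1 + (O.viaHoles code u v j).time)))⟩ := by
    simp only [query, Timed.andThen, Timed.step, hi, hj, hij, decide_false, Bool.false_eq_true,
      if_false]
    rfl
  rw [this]
  congr 1
  omega

theorem query_of_eq {i : ι} (hi : O.home u = some i) (hj : O.home v = some i) :
    O.query code u v = ⟨O.idist u v, 4⟩ := by
  simp [query, Timed.andThen, Timed.step, hi, hj]

theorem query_of_none (h : O.home u = none ∨ O.home v = none) :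
    O.query code u v = ⟨O.bdist u v, 3⟩ := by
  rcases hu : O.home u with _ | i <;> rcases hv : O.home v with _ | j
  · simp [query, Timed.andThen, Timed.step, hu, hv]
  · simp [query, Timed.andThen, Timed.step, hu, hv]
  · simp [query, Timed.andThen, Timed.step, hu, hv]
  · simp [hu, hv] at h

end Query

namespace Valid

variable {V D ι : Type*} [Fintype D] {G : EmbeddedGraph V D} {R : ι → Region G} {r c₁ c₂ : ℝ}
  {c₃ : ℕ} {spoke : D → Bool → ℝ} {O : Oracle G R} {C : ℝ} {code : Code}

theorem time_viaHoles_le (hO : O.Valid spoke r C code) (hd : IsRDivision G R r c₁ c₂ c₃)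
    (hG : G.IsMap) {u v : V} {j : ι} (hum : u ∉ (R j).verts) {k : ℕ}
    (hk : 18 * r * 2 ^ k ≤ 3 * 3 ^ k) :
    (O.viaHoles code u v j).time ≤ c₃ * ((code.timeBound + 2) * k + 29) + 1 := by
  -- Two look-ups, the search with its final step, and `6 * (3 + 1) + 1` steps for at most six
  -- candidates give the 28; taking the minimum adds one step for each hole.
  refine (Timed.time_minOver_le (T := (code.timeBound + 2) * k + 28) fun h hh => ?_).trans
    (Nat.add_le_add_right (Nat.mul_le_mul_right _ (hO.length_holes_le hd j)) 1)
  obtain ⟨L, name, hL, -, hdec⟩ := hO.decomposes u j hum h hh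
  have hlen : L.length * 2 ^ k ≤ 3 * 2 ^ k + 3 * 3 ^ k := by
    have h1 := hL.nodup.length_le_card
    have h2 := hd.card_fillDart_le hG h
    rw [Nat.card_eq_fintype_card] at h2
    have h3 : (L.length : ℝ) ≤ 18 * r := le_trans (by exact_mod_cast h1) h2
    have h4 : (L.length : ℝ) * 2 ^ k ≤ 3 * 3 ^ k :=
      (mul_le_mul_of_nonneg_right h3 (by positivity)).trans hk
    have h5 : L.length * 2 ^ k ≤ 3 * 3 ^ k := by exact_mod_cast h4
    omega
  have h1 := search_time code (O.mem j h) (O.num j v) hdec k hlen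
  obtain ⟨h6, -⟩ := IsCells.search_leaf code (O.mem j h) (O.num j v) hdec
  have h2 : ((O.candidates code u v j h).andThen fun X => Timed.minOver (O.via u v) X).time =
      1 + (1 + (search code (O.mem j h) (O.num j v) (O.tree u j h)).time) +
        (Timed.minOver (O.via u v) (search code (O.mem j h) (O.num j v) (O.tree u j h)).val).time :=
    rfl
  have h3 := Timed.time_minOver_le (f := O.via u v) (T := 3)
    (l := (search code (O.mem j h) (O.num j v) (O.tree u j h)).val) fun x _ => le_rfl
  rw [h2]
  omega

theorem exists_isBoundary_of_home (hO : O.Valid spoke r C code) (hd : IsRDivision G R r c₁ c₂ c₃)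
    (hG : G.IsMap) {v : V} (hv : O.home v = none) : ∃ i, (R i).IsBoundary v := by
  refine hd.exists_isBoundary hG fun i hi => ?_
  rw [(hO.home_iff v i).2 hi] at hv
  exact Option.some_ne_none _ hv

section

variable (hO : O.Valid spoke r C code) (hd : IsRDivision G R r c₁ c₂ c₃) (hG : G.IsMap)
  (hw : ∀ d, 0 ≤ G.wt d) (hs : ∀ d b, ∑ e, G.wt e < spoke d b) (hu : G.UniqueShortestPaths)
  (huf : ∀ i h, (R i).IsHole h → ((R i).fill h spoke).UniqueShortestPaths)
include hO hd hG hw hs hu huf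

/-- The last boundary vertex on the shortest path, and its cells. -/
theorem exists_boundary_cell {u v : V} {i j : ι} (hij : i ≠ j) (hui : (R i).IsInternal u)
    (hvj : (R j).IsInternal v) :
    ∃ (p q : List D) (x : (R j).Vert),
      G.IsShortest u (p ++ q) v ∧ G.IsWalk u p x ∧ (R j).IsBoundary x ∧
      (∀ d ∈ q, ¬ (R j).IsBoundary (G.tgt d)) ∧
      (∃ h ∈ O.holes j, ∃ e, (R j).graph.SameFace h e ∧ (R j).graph.src e = x) ∧
      ∀ h ∈ O.holes j,
        (O.candidates code u v j h).val.length ≤ 6 ∧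
        (∃ y : (R j).Vert, (y : V) ∈ (O.candidates code u v j h).val ∧
          .inl ⟨v, hvj.1⟩ ∈ EmbeddedGraph.voronoiCell (O.site u j h) (.inl y)) ∧
        ((∃ e, (R j).graph.SameFace h e ∧ (R j).graph.src e = x) →
          (x : V) ∈ (O.candidates code u v j h).val ∧
          .inl ⟨v, hvj.1⟩ ∈ EmbeddedGraph.voronoiCell (O.site u j h) (.inl x)) := by
  have hum : u ∉ (R j).verts := fun hu => hij (hd.eq_of_isInternal hui hu)
  have hsp := sp_isShortest hu u v
  obtain ⟨p, q, x, hpq, hp, hx, hq⟩ := Region.exists_last_boundary hsp.1 hvj hum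
  rw [hpq] at hsp
  obtain ⟨e, he, hex⟩ := Region.exists_isHole_of_isBoundary hG (hd.graph_isMap hG j) hx
  obtain ⟨h₀, hh₀, hf₀⟩ := hO.holes_all j e he
  refine ⟨p, q, ⟨x, hx.1⟩, hsp, hp, hx, hq, ⟨h₀, hh₀, e, hf₀, Subtype.ext hex⟩, fun h hh => ?_⟩
  obtain ⟨h6, -, f, hf, hfs, hfm⟩ := hO.candidates_spec hd hG huf hij hui hvj hh
  refine ⟨h6, ⟨_, hfm, hfs⟩, fun hxh => ?_⟩
  have hsite := hO.site_eq hd hG hw hs hu huf hij hui hvj hh hsp hp hq hxh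
  refine ⟨?_, hsite⟩
  rw [hsite] at hfs
  rw [← Sum.inl_injective hfs] at hfm
  exact hfm

theorem val_viaHoles {u v : V} {i j : ι} (hij : i ≠ j) (hui : (R i).IsInternal u)
    (hvj : (R j).IsInternal v) : (O.viaHoles code u v j).val = (G.dist u v : WithTop ℝ) := by
  have hvia : ∀ x, (R j).IsBoundary x →
      (O.via u v x).val = ((G.dist u x + G.dist x v : ℝ) : WithTop ℝ) := by
    intro x hx
    show ((O.bdist u x + O.bdist x v : ℝ) : WithTop ℝ) = _
    rw [hO.bdist_eq u x (.inr ⟨j, hx⟩), hO.bdist_eq x v (.inl ⟨j, hx⟩)]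
  obtain ⟨p, q, x, hpq, hp, hx, -, ⟨h, hh, hxh⟩, hall⟩ :=
    hO.exists_boundary_cell hd hG hw hs hu huf hij hui hvj
  apply le_antisymm
  · refine (Timed.minOver_le hh).trans ?_
    show (Timed.minOver (O.via u v) (O.candidates code u v j h).val).val ≤ _
    refine (Timed.minOver_le ((hall h hh).2.2 hxh).1).trans ?_
    rw [hvia x hx]
    have hq : G.IsWalk x q v := by
      obtain ⟨y, h1, h2⟩ := isWalk_append_iff.1 hpq.1
      rwa [hp.eq_of_isWalk h1]
    obtain ⟨h1, h2⟩ := hpq.of_append hp hq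
    rw [hpq.dist_eq, h1.dist_eq, h2.dist_eq, len_append]
  · refine Timed.le_minOver.2 fun h' hh' => ?_
    show _ ≤ (Timed.minOver (O.via u v) (O.candidates code u v j h').val).val
    refine Timed.le_minOver.2 fun y hy => ?_
    rw [hvia y ((hO.candidates_spec hd hG huf hij hui hvj hh').2.1 y hy), WithTop.coe_le_coe]
    exact dist_triangle hu u y v

theorem query_spec (u v : V) {k : ℕ} (hk : 18 * r * 2 ^ k ≤ 3 * 3 ^ k) :
    (O.query code u v).val = (G.dist u v : WithTop ℝ) ∧
      (O.query code u v).time ≤ c₃ * ((code.timeBound + 2) * k + 29) + 5 := by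
  rcases hhu : O.home u with _ | i
  · rw [O.query_of_none code (.inl hhu)]
    exact ⟨congrArg _ (hO.bdist_eq u v (.inl (hO.exists_isBoundary_of_home hd hG hhu))),
      (by omega : 3 ≤ 5).trans (Nat.le_add_left _ _)⟩
  rcases hhv : O.home v with _ | j
  · rw [O.query_of_none code (.inr hhv)]
    exact ⟨congrArg _ (hO.bdist_eq u v (.inr (hO.exists_isBoundary_of_home hd hG hhv))),
      (by omega : 3 ≤ 5).trans (Nat.le_add_left _ _)⟩
  have hui := (hO.home_iff u i).1 hhu
  have hvj := (hO.home_iff v j).1 hhv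
  by_cases hij : i = j
  · subst hij
    rw [O.query_of_eq code hhu hhv]
    exact ⟨congrArg _ (hO.idist_eq i u v hui hvj), (by omega : 4 ≤ 5).trans (Nat.le_add_left _ _)⟩
  · rw [O.query_of_ne code hhu hhv hij]
    refine ⟨hO.val_viaHoles hd hG hw hs hu huf hij hui hvj, ?_⟩
    have := hO.time_viaHoles_le hd hG (fun hu => hij (hd.eq_of_isInternal hui hu)) (v := v) hk
    show (O.viaHoles code u v j).time + 4 ≤ _
    omega

end

end Valid

/-! ### Construction of the oracle -/

section Construction

/-- There is a list of holes with exactly one representative of each of them. -/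
theorem _root_.Region.exists_holes {V D : Type*} [Fintype D] {G : EmbeddedGraph V D}
    (R : Region G) :
    ∃ l : List R.Dart, (∀ h ∈ l, R.IsHole h) ∧
      l.Pairwise (fun h h' => ¬ R.graph.SameFace h h') ∧
      ∀ e, R.IsHole e → ∃ h ∈ l, R.graph.SameFace h e := by
  choose rep hrep using R.graph.face_surjective
  have : Finite R.graph.Face := Finite.of_surjective _ R.graph.face_surjective
  have := Fintype.ofFinite R.graph.Face
  refine ⟨(Finset.univ.filter fun f => R.IsHole (rep f)).toList.map rep, ?_, ?_, ?_⟩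
  · intro h hh
    obtain ⟨f, hf, rfl⟩ := List.mem_map.1 hh
    exact (Finset.mem_filter.1 (Finset.mem_toList.1 hf)).2
  · rw [List.pairwise_map]
    refine (Finset.nodup_toList _).imp fun {f g} hfg k => hfg ?_
    rw [← hrep f, ← hrep g, face_eq_iff]
    exact k
  · intro e he
    have h1 : R.graph.SameFace (rep (R.graph.face e)) e := face_eq_iff.1 (hrep _)
    exact ⟨_, List.mem_map_of_mem (Finset.mem_toList.2 (Finset.mem_filter.2
      ⟨Finset.mem_univ _, (Region.isHole_congr h1).2 he⟩)), h1⟩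

variable {V D ι : Type*} [Fintype D] {G : EmbeddedGraph V D} {R : ι → Region G} {r c₁ c₂ : ℝ}
  {c₃ : ℕ} {spoke : D → Bool → ℝ}

theorem exists_diagram (hd : IsRDivision G R r c₁ c₂ c₃) (hG : G.IsMap)
    (hw : ∀ d, 0 ≤ G.wt d) (hs : ∀ d b, ∑ e, G.wt e < spoke d b) (hu : G.UniqueShortestPaths)
    {i : ι} {h : (R i).Dart} (hh : (R i).IsHole h)
    (huf : ((R i).fill h spoke).UniqueShortestPaths) (u : V) :
    ∃ site t, ((R i).fill h spoke).IsVoronoi (.inl h) (Sum.elim (fun x => G.dist u x) fun _ => 0) site ∧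
      ∃ L name, ((R i).fill h spoke).IsTriVor (.inl h) site L ∧
        (∀ x : (R i).Vert, name (.inl x) = (x : V)) ∧
        ((R i).fill h spoke).Decomposes (.inl h) site name L t := by
  have hR := hd.graph_isMap hG i
  -- Shortest paths in the filled region between vertices of the region are walks in `G`, so the
  -- weights satisfy the triangle inequality that is required.
  obtain ⟨site, hsite⟩ := exists_isVoronoi (h := .inl h) huf (Region.wt_fill_nonneg hw hs)
    (ω := Sum.elim (fun x => G.dist u x) fun _ => 0) (fun e e' he he' => by
      obtain ⟨a, -, rfl⟩ := Region.fill_sameFace_iff.1 he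
      obtain ⟨b, -, rfl⟩ := Region.fill_sameFace_iff.1 he'
      obtain ⟨l, -, hl, hlen⟩ := Region.sp_fill hR hw hs huf ((R i).graph.src b) ((R i).graph.src a)
      rw [Region.fill_src_inl, Region.fill_src_inl, hlen]
      exact (dist_triangle hu u ((R i).graph.src b) ((R i).graph.src a)).trans
        (add_le_add_right (dist_le_len hu (Region.isWalk_val hl)) _))
  have hK := hsite.isCells (hd.fill_isDisc hG hh spoke) huf
  obtain ⟨L, hL, hF⟩ := hK.exists_isTriVor
  obtain ⟨t, ht⟩ := hK.exists_decomposes (Sum.elim (fun x : (R i).Vert => (x : V)) fun _ => u) L L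
    hF (.refl _) hL.nodup fun a ha => (hL.mem_iff a).1 ha
  exact ⟨site, t, hsite, L, _, hL, fun x => rfl, ht⟩

theorem exists_valid (hd : IsRDivision G R r c₁ c₂ c₃) (hG : G.IsMap)
    (hw : ∀ d, 0 ≤ G.wt d) (hs : ∀ d b, ∑ e, G.wt e < spoke d b) (hu : G.UniqueShortestPaths)
    (huf : ∀ i h, (R i).IsHole h → ((R i).fill h spoke).UniqueShortestPaths) (hr : 2 ≤ r) {C : ℝ}
    (hC : 19 ≤ C) : ∃ O : Oracle G R, O.Valid spoke r C Code.box := by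
  have hfin : ∀ i, Finite (R i).Vert := fun i =>
    Finite.of_surjective _ (hd.graph_isMap hG i).src_surjective
  choose site tree hvor hdec using fun (u : V) (i : ι) (h : {h : (R i).Dart // (R i).IsHole h}) =>
    exists_diagram hd hG hw hs hu h.2 (huf i h h.2) u
  have hmem : ∀ (i : ι) (h : {h : (R i).Dart // (R i).IsHole h}) (e : (R i).FillDart h),
      ∃ mem : List ℕ, mem.length = 12 * Nat.card (R i).Vert ∧ (∀ n ∈ mem, (n : ℝ) ≤ 19 * r) ∧
        ∀ a < ((R i).fill h.1 spoke).bsize (.inl h.1), ∀ b < ((R i).fill h.1 spoke).bsize (.inl h.1),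
          ∀ w : (R i).Vert, (Code.box.run mem ![(Finite.equivFin (R i).Vert w : ℕ), a, b]).val ≠ 0 ↔
            .inl w ∈ ((R i).fill h.1 spoke).box (.inl h.1) a b e := by
    intro i h e
    have hK := hd.fill_isDisc hG h.2 spoke
    have hfinK : Finite ((R i).FillVert h.1) := Finite.of_surjective _ hK.map.src_surjective
    have := Fintype.ofFinite ((R i).FillVert h.1)
    obtain ⟨mem, h1, h2, h3⟩ := hK.exists_memory (huf i h h.2)
      (Sum.inl : (R i).Vert → (R i).FillVert h.1) (Finite.equivFin (R i).Vert)
      (Region.bsize_fill_le (hd.graph_isMap hG i) (hd.hole_cycle i h h.2)) e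
    refine ⟨mem, h1, fun n hn => ?_, h3⟩
    have h4 := Nat.card_le_card_of_surjective _ hK.map.src_surjective
    have h5 := hd.card_fillDart_le hG h.1
    have h6 := hd.verts_le i
    have h7 := h2 n hn
    rw [← Nat.card_eq_fintype_card] at h7
    -- At most `18 r` vertices of the filled region, bounded by its darts, and at most `r` vertices
    -- of the region.
    have h8 : (n : ℝ) ≤ Nat.card ((R i).FillDart h.1) + Nat.card (R i).Vert := by
      exact_mod_cast h7.trans (by omega)
    linarith
  choose mem hmem1 hmem2 hmem3 using hmem
  choose holes hhole hpair hall using fun i => (R i).exists_holes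
  -- The default values are for darts and vertices about which the conditions say nothing; listed
  -- holes are always holes.
  let O : Oracle G R :=
    { home := fun v => if hv : ∃ i, (R i).IsInternal v then some hv.choose else none
      bdist := G.dist
      idist := G.dist
      holes := holes
      site := fun u i h => if hh : (R i).IsHole h then site u i ⟨h, hh⟩ else id
      tree := fun u i h => if hh : (R i).IsHole h then tree u i ⟨h, hh⟩ else .leaf []
      num := fun i v => if hv : v ∈ (R i).verts then Finite.equivFin (R i).Vert ⟨v, hv⟩ else 0
      mem := fun i h e => if hh : (R i).IsHole h then mem i ⟨h, hh⟩ e else [] }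
  have hnum : ∀ i (w : (R i).Vert), O.num i w = Finite.equivFin (R i).Vert w := fun i w =>
    dif_pos w.2
  refine ⟨O, ?_, fun _ _ _ => rfl, fun _ _ _ _ _ => rfl, hhole, ?_, ?_, ?_, ?_, ?_, ?_, ?_, ?_⟩
  · intro v i
    constructor
    · intro h1
      by_cases hv : ∃ i, (R i).IsInternal v
      · have h2 : O.home v = some hv.choose := dif_pos hv
        rw [h2] at h1
        rw [← Option.some_injective _ h1]
        exact hv.choose_spec
      · have h2 : O.home v = none := dif_neg hv
        rw [h2] at h1
        exact absurd h1.symm (Option.some_ne_none _)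
    · intro h1
      have hv : ∃ i, (R i).IsInternal v := ⟨i, h1⟩
      have h2 : O.home v = some hv.choose := dif_pos hv
      rw [h2, hd.eq_of_isInternal hv.choose_spec h1.1]
  · exact hpair
  · exact hall
  · intro u i _ h hh
    have h1 : O.site u i h = site u i ⟨h, hhole i h hh⟩ := dif_pos _
    rw [h1]
    exact hvor u i ⟨h, hhole i h hh⟩
  · intro u i _ h hh
    have h1 : O.site u i h = site u i ⟨h, hhole i h hh⟩ := dif_pos _
    have h2 : O.tree u i h = tree u i ⟨h, hhole i h hh⟩ := dif_pos _
    rw [h1, h2]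
    exact hdec u i ⟨h, hhole i h hh⟩
  · intro i a ha b hb hab
    have h1 := hnum i ⟨a, ha⟩
    rw [show O.num i a = O.num i b from hab, hnum i ⟨b, hb⟩] at h1
    exact (congrArg Subtype.val ((Finite.equivFin (R i).Vert).injective (Fin.ext h1))).symm
  · intro i v hv
    rw [hnum i ⟨v, hv⟩]
    exact Fin.is_lt _
  · intro i h hh e
    have h1 : O.mem i h e = mem i ⟨h, hhole i h hh⟩ e := dif_pos _
    rw [h1, hmem1]
    have h2 := hd.verts_le i
    refine ⟨?_, fun n hn => (hmem2 _ _ _ n hn).trans (by nlinarith)⟩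
    push_cast
    nlinarith
  · intro i h hh e a ha b hb _ _ _ w
    have h1 : O.mem i h e = mem i ⟨h, hhole i h hh⟩ e := dif_pos _
    rw [h1, hnum]
    exact hmem3 i ⟨h, hhole i h hh⟩ e a ha b hb w

end Construction

/-- A logarithmic bound on the depth of recursive decompositions. -/
theorem exists_depth {r : ℝ} (hr : 2 ≤ r) :
    ∃ k : ℕ, 18 * r * 2 ^ k ≤ 3 * 3 ^ k ∧ (k : ℝ) ≤ 14 * Real.log r := by
  have hr0 : 0 < r := by linarith
  -- The depth is the least `k` with `(3/2) ^ k ≥ 6 r`. As `log (6 r) ≤ 4 log r` and `log (3/2) ≥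
  -- 1/3`, the quotient is at most `12 log r`; rounding up costs one, at most `2 log r`.
  have hl32 : 1 / 3 ≤ Real.log (3 / 2) := by
    have := Real.one_sub_inv_le_log_of_pos (show (0 : ℝ) < 3 / 2 by norm_num)
    norm_num at this ⊢
    linarith
  have hl2 : 1 / 2 ≤ Real.log r := by
    have h1 := Real.one_sub_inv_le_log_of_pos (show (0 : ℝ) < 2 by norm_num)
    have h2 := Real.log_le_log (by norm_num) hr
    norm_num at h1
    linarith
  have h6 : Real.log (6 * r) ≤ 4 * Real.log r := by
    have h1 : 6 * r ≤ r ^ 4 := by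
      have h2 : 8 ≤ r ^ 3 := by
        have := pow_le_pow_left₀ (by norm_num) hr 3
        norm_num at this
        exact this
      nlinarith
    have h2 := Real.log_le_log (by linarith) h1
    rwa [Real.log_pow] at h2
  have h60 : 0 ≤ Real.log (6 * r) := Real.log_nonneg (by linarith)
  refine ⟨⌈Real.log (6 * r) / Real.log (3 / 2)⌉₊, ?_, ?_⟩
  · set k := ⌈Real.log (6 * r) / Real.log (3 / 2)⌉₊
    have h1 : Real.log (6 * r) / Real.log (3 / 2) ≤ k := Nat.le_ceil _
    rw [div_le_iff₀ (by linarith), ← Real.log_pow, Real.log_le_log_iff (by linarith) (by positivity),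
      div_pow, le_div_iff₀ (by positivity)] at h1
    linarith
  · have h1 := (Nat.ceil_lt_add_one (div_nonneg h60 (by linarith : 0 ≤ Real.log (3 / 2)))).le
    have h2 : Real.log (6 * r) / Real.log (3 / 2) ≤ 12 * Real.log r := by
      rw [div_le_iff₀ (by linarith)]
      nlinarith
    linarith

end Oracle

end

theorem mainTheorem4 (c₂ : ℝ) (c₃ : ℕ) :
    ∃ (code : Code) (C : ℝ), ∀ (V D ι : Type*) [Fintype V] [Fintype D] [Fintype ι]
      (G : EmbeddedGraph V D) (R : ι → Region G) (r c₁ : ℝ) (spoke : D → Bool → ℝ),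
      G.IsPlane → (∀ d, 0 ≤ G.wt d) → G.UniqueShortestPaths →
      2 ≤ r → IsRDivision G R r c₁ c₂ c₃ →
      (∀ d b, ∑ e, G.wt e < spoke d b) →
      (∀ i h, (R i).IsHole h → ((R i).fill h spoke).UniqueShortestPaths) →
      (∃ O : Oracle G R, O.Valid spoke r C code) ∧
      ∀ O : Oracle G R, O.Valid spoke r C code →
        (∀ u v, (O.query code u v).val = (G.dist u v : WithTop ℝ) ∧
          ((O.query code u v).time : ℝ) ≤ C * Real.log r) ∧
        ∀ u v i j, i ≠ j → (R i).IsInternal u → ∀ hv : (R j).IsInternal v,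
          ∃ (p q : List D) (x : (R j).Vert),
            G.IsShortest u (p ++ q) v ∧ G.IsWalk u p x ∧ (R j).IsBoundary x ∧
            (∀ d ∈ q, ¬ (R j).IsBoundary (G.tgt d)) ∧
            (∃ h ∈ O.holes j, ∃ e, (R j).graph.SameFace h e ∧ (R j).graph.src e = x) ∧
            ∀ h ∈ O.holes j,
              (O.candidates code u v j h).val.length ≤ 6 ∧
              (∃ y : (R j).Vert, (y : V) ∈ (O.candidates code u v j h).val ∧
                .inl ⟨v, hv.1⟩ ∈ EmbeddedGraph.voronoiCell (O.site u j h) (.inl y)) ∧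
              ((∃ e, (R j).graph.SameFace h e ∧ (R j).graph.src e = x) →
                (x : V) ∈ (O.candidates code u v j h).val ∧
                .inl ⟨v, hv.1⟩ ∈ EmbeddedGraph.voronoiCell (O.site u j h) (.inl x)) := by
  set A : ℝ := 29 * c₃ + 5 with hA
  set B : ℝ := c₃ * (Code.box.timeBound + 2) with hB
  have hA0 : 0 ≤ A := by positivity
  have hB0 : 0 ≤ B := by positivity
  -- The 19 is needed for the memory. The query takes at most `A + B k` steps, where `k ≤ 14 log r`,
  -- and `A ≤ 2 A log r` because `log r ≥ 1/2`.
  refine ⟨Code.box, 19 + 2 * A + 14 * B, ?_⟩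
  intro V D ι _ _ _ G R r c₁ spoke hG hw hu hr hd hs huf
  have hM := hG.isMap
  refine ⟨Oracle.exists_valid hd hM hw hs hu huf hr (by linarith), fun O hO => ⟨fun u v => ?_, ?_⟩⟩
  · obtain ⟨k, hk, hkr⟩ := Oracle.exists_depth hr
    obtain ⟨h1, h2⟩ := hO.query_spec hd hM hw hs hu huf u v hk
    refine ⟨h1, ?_⟩
    have h3 : ((O.query Code.box u v).time : ℝ) ≤ B * k + A := by
      have : ((O.query Code.box u v).time : ℝ) ≤
          ((c₃ * ((Code.box.timeBound + 2) * k + 29) + 5 : ℕ) : ℝ) := by exact_mod_cast h2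
      push_cast at this
      rw [hA, hB]
      linarith
    have h4 : 1 / 2 ≤ Real.log r := by
      have h5 := Real.one_sub_inv_le_log_of_pos (show (0 : ℝ) < 2 by norm_num)
      have h6 := Real.log_le_log (by norm_num) hr
      norm_num at h5
      linarith
    nlinarith [mul_le_mul_of_nonneg_left hkr hB0, mul_nonneg hA0 (sub_nonneg.2 h4)]
  · intro u v i j hij hui hv
    exact hO.exists_boundary_cell hd hM hw hs hu huf hij hui hv
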